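/- Let $W=W(\mathrm D_n)$ be the group of signed permutations of the standard basis $e_1,\dots,e_n$ of $V=\mathbb R^n$ with an even number of signs, with roots $\pm e_i\pm e_j$ $(i\ne j)$ (for $n\ge 4$ the Coxeter group of type $\mathrm D_n$); it lies in $W(\mathrm B_n)$, the group of all signed permutations. Let $\lambda=(\lambda_1\ge\dots\ge\lambda_l>0)$ be a partition of $n$ with at least one odd part, and let $a_k$ be the multiplicity of the part $k$. *Conventions.* For a reflection subgroup $U$ of $W$ with a chosen positive system $\Phi^+$, normalized by $G\le W$, the *Howlett complement* of $U$ in $G$ is $\{g\in G : g\Phi^+\subseteq\Phi^+\}$; "in $W$" means in $N_W(U)$. The standard positive roots are $e_i\pm e_j$, $i<j$. Put $u_i=\lambda_1+\dots+\lambda_{i-1}$; the $i$-th block is $\{u_i+1,\dots,u_i+\lambda_i\}$. A parabolic subgroup (pointwise stabilizer of a subspace of $V$) has label $\lambda$ if it is $W$-conjugate to $W_\lambda=\prod_i\mathfrak S_{\lambda_i}$, the group of permutations preserving every block. Let $x_i$ (for $\lambda_i=\lambda_{i+1}$) interchange blocks $i$ and $i+1$ preserving order; let $y_i$ send $e_v\mapsto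 -e_{2u_i+\lambda_i+1-v}$ for $v$ in block $i$ and fix all other $e_v$; let $y_i'=x_iy_iy_{i+1}$ (for $\lambda_i=\lambda_{i+1}$) and $z_{ij}'=y_iy_j$ (for $\lambda_i\neq\lambda_j$ odd). Types $\mathrm B_0,\mathrm D_0,\mathrm D_1$ are trivial, $\mathrm D_2=\mathrm A_1\times \mathrm A_1$. **Claim 1.** If $P$ is a parabolic subgroup of $W$ with label $\lambda$, then its Howlett complement in $W$ (for any positive system of $P$) is isomorphic to a subgroup of index $2$ of $\prod_k W(\mathrm B_{a_k})$. **Claim 2.** Let $P=W_\lambda$, with standard positive roots; $P$ is parabolic with label $\lambda$. Its Howlett complement in $W$ is generated by the $x_i$ ($\lambda_i=\lambda_{i+1}$), $y_j$ ($\lambda_j$ even), $y_i'$ ($\lambda_i=\lambda_{i+1}$ odd), and $z_{ij}'$ ($i<j$, $\lambda_i\ne\lambda_j$ odd). Let $N=N_W(P)$; let $Q$ be the orthogonal complement of $P$, i.e. the subgroup generated by the reflections of $W$ whose hyperplanes are orthogonal to the hyperplanes of all reflections in $P$; $X=\mathrm{Fix}_V(P)$, $Y=\mathrm{Fix}_V(Q)$;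 let $D$ be the Howlett complement of $PQ$ in $N$ (for the standard positive roots), and let $A$ and $B$ be the pointwise stabilizers in $D$ of $Y^\perp$ and of $X\cap Y$. Let $$A_0=\langle x_i,\,y_j \mid \lambda_i=\lambda_{i+1}>2 \text{ even},\ \lambda_j>2\text{ even}\rangle .$$ Then $D=(A\times B)\rtimes C$ and $N=(P\times Q)\rtimes D=(P\times Q)\rtimes((A\times B)\rtimes C)$, where $A_0$ is a group of type $\mathrm B_{a_4}\mathrm B_{a_6}\mathrm B_{a_8}\cdots$, $B=\langle x_i\mid\lambda_i=\lambda_{i+1}=2\rangle\cong\mathfrak S_{a_2}$, and: (a) If $a_1\le 1$, then $Q=\langle y_j\mid\lambda_j=2\rangle$ is of type $\mathrm A_1^{a_2}$; $A=A_0\times A_1$, where $A_1=\langle x_i,y_i',z_{pq}'\mid\lambda_i=\lambda_{i+1}>2\text{ odd},\ \lambda_p>\lambda_q\text{ odd}\rangle$ is isomorphic to a subgroup of index $2$ of a group of type $\mathrm B_{a_1}\mathrm B_{a_3}\mathrm B_{a_5}\cdots$; and $C=1$. (b) If $a_1>1$, then $Q=\langle x_i,y_i',y_j\mid\lambda_i=\lambda_{i+1}=1,\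 \lambda_j=2\rangle$ is of type $\mathrm D_{a_1}\mathrm A_1^{a_2}$. If moreover $\lambda$ has an odd part $\lambda_r>1$, then $A=A_0\times A_1$, where $A_1=\langle x_i,y_i',z_{pq}'\mid\lambda_i=\lambda_{i+1}>2\text{ odd},\ \lambda_p>\lambda_q>2\text{ odd}\rangle$ is isomorphic to a subgroup of index $2$ of a group of type $\mathrm B_{a_3}\mathrm B_{a_5}\cdots$, and, for any such $r$, one can take $C=\langle z_{rl}'\rangle$, which has order $2$. If $\lambda$ has no odd part $>1$, then $A=A_0$ and $C=1$. In all cases, $A_0$ acts faithfully as a reflection group (of the type stated above) on $X\cap Y$; $B$ acts faithfully as a reflection group, of type $\mathrm A_{a_2-1}$, on $Y^\perp$ and on $X^\perp$; $Q\rtimes B$ acts faithfully on $Y^\perp$ as a Coxeter group of type $\mathrm D_{a_1}\mathrm B_{a_2}$ (which is $\mathrm B_{a_2}$ if $a_1\le 1$); and $P\rtimes B$ acts faithfully on $X^\perp$ as a Coxeter group of type $\mathrm B_{a_2}\mathrm A_2^{a_3}\mathrm A_3^{a_4}\cdots\mathrm A_{n-1}^{a_n}$. -/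

import Mathlib

noncomputable section

namespace ParabolicD

open scoped InnerProductSpace

/-! ### Reflections, fixed spaces, pointwise stabilizers -/

/-- The Euclidean space `ℝⁿ`. -/
abbrev E (n : ℕ) : Type := EuclideanSpace ℝ (Fin n)

/-- The orthogonal group of `ℝⁿ`. -/
abbrev O (n : ℕ) : Type := E n ≃ₗᵢ[ℝ] E n

/-- The standard basis vector `e_i`. -/
def e {n : ℕ} (i : Fin n) : E n := EuclideanSpace.single i (1 : ℝ)

/-- The reflection in the hyperplane orthogonal to `α`. -/
def refl {n : ℕ} (α : E n) : O n := (ℝ ∙ α)ᗮ.reflection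

/-- `g` is a reflection of `ℝⁿ`. -/
def IsRefl {n : ℕ} (g : O n) : Prop := ∃ α : E n, α ≠ 0 ∧ g = refl α

/-- The subspace of vectors fixed by every element of `G`. -/
def fixedSpace {n : ℕ} (G : Subgroup (O n)) : Submodule ℝ (E n) where
  carrier := {v | ∀ g ∈ G, g v = v}
  add_mem' := by
    intro a b ha hb g hg
    rw [map_add, ha g hg, hb g hg]
  zero_mem' := by
    intro g _
    exact map_zero g
  smul_mem' := by
    intro c a ha g hg
    rw [map_smul, ha g hg]

/-- The pointwise stabilizer of the subspace `U` in the group `G`. -/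
def pointwiseStab {n : ℕ} (G : Subgroup (O n)) (U : Submodule ℝ (E n)) : Subgroup (O n) where
  carrier := {g | g ∈ G ∧ ∀ x ∈ U, g x = x}
  mul_mem' := by
    rintro a b ⟨ha, ha'⟩ ⟨hb, hb'⟩
    refine ⟨mul_mem ha hb, fun x hx => ?_⟩
    change a (b x) = x
    rw [hb' x hx, ha' x hx]
  one_mem' := ⟨one_mem _, fun _ _ => rfl⟩
  inv_mem' := by
    rintro a ⟨ha, ha'⟩
    refine ⟨inv_mem ha, fun x hx => ?_⟩
    change a.symm x = x
    rw [LinearIsometryEquiv.symm_apply_eq, ha' x hx]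

/-- The normalizer `N_W(P)` of `P` in `W`. -/
def normalizerIn {n : ℕ} (W P : Subgroup (O n)) : Subgroup (O n) :=
  W ⊓ Subgroup.normalizer (P : Set (O n))

/-! ### The groups `W(B_n)` and `W(D_n)` of signed permutations -/

/-- The signed permutation `e_i ↦ ε_i e_{σ i}`. -/
def signedPerm {n : ℕ} (σ : Equiv.Perm (Fin n)) (ε : Fin n → ℤˣ) : O n :=
  (LinearIsometryEquiv.piLpCongrRight 2 fun i =>
    if ε i = 1 then LinearIsometryEquiv.refl ℝ ℝ else LinearIsometryEquiv.neg ℝ).trans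
    (LinearIsometryEquiv.piLpCongrLeft 2 ℝ ℝ σ)

theorem signedPerm_apply {n : ℕ} (σ : Equiv.Perm (Fin n)) (ε : Fin n → ℤˣ) (x : E n)
    (i : Fin n) :
    signedPerm σ ε x i = (((ε (σ.symm i) : ℤˣ) : ℤ) : ℝ) * x (σ.symm i) := by
  rcases Int.units_eq_one_or (ε (σ.symm i)) with h | h <;>
    simp [signedPerm, LinearIsometryEquiv.piLpCongrLeft_apply, Equiv.piCongrLeft', h]

theorem signedPerm_e {n : ℕ} (σ : Equiv.Perm (Fin n)) (ε : Fin n → ℤˣ) (i : Fin n) :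
    signedPerm σ ε (e i) = (((ε i : ℤˣ) : ℤ) : ℝ) • e (σ i) := by
  ext j
  rw [signedPerm_apply]
  by_cases h : j = σ i
  · subst h
    simp [e]
  · have h' : σ.symm j ≠ i := fun hh => h (by rw [← hh, Equiv.apply_symm_apply])
    simp [e, h, h']

theorem signedPerm_mul {n : ℕ} (σ τ : Equiv.Perm (Fin n)) (ε δ : Fin n → ℤˣ) :
    signedPerm σ ε * signedPerm τ δ = signedPerm (σ * τ) (fun i => ε (τ i) * δ i) := by
  ext x i
  change signedPerm σ ε (signedPerm τ δ x) i = _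
  rw [signedPerm_apply, signedPerm_apply, signedPerm_apply]
  simp [Equiv.Perm.mul_def, mul_assoc]

theorem signedPerm_one {n : ℕ} : signedPerm (1 : Equiv.Perm (Fin n)) (fun _ => 1) = 1 := by
  ext x i
  rw [signedPerm_apply]
  simp [Equiv.Perm.one_def]

theorem signedPerm_inv {n : ℕ} (σ : Equiv.Perm (Fin n)) (ε : Fin n → ℤˣ) :
    (signedPerm σ ε)⁻¹ = signedPerm σ⁻¹ (fun i => ε (σ⁻¹ i)) := by
  rw [inv_eq_iff_mul_eq_one, signedPerm_mul, ← signedPerm_one]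
  congr 1
  · simp
  · funext i
    simp

/-- The Coxeter group `W(B_n)`, as the group of all signed permutations. -/
def WB (n : ℕ) : Subgroup (O n) where
  carrier := {g | ∃ σ ε, g = signedPerm σ ε}
  mul_mem' := by
    rintro _ _ ⟨σ, ε, rfl⟩ ⟨τ, δ, rfl⟩
    exact ⟨_, _, signedPerm_mul σ τ ε δ⟩
  one_mem' := ⟨1, fun _ => 1, signedPerm_one.symm⟩
  inv_mem' := by
    rintro _ ⟨σ, ε, rfl⟩
    exact ⟨_, _, signedPerm_inv σ ε⟩

/-- The Coxeter group `W(D_n)`, as the group of signed permutations with an even number of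
signs. For `n = 0` and `n = 1` it is trivial, for `n = 2` it is of type `A₁ × A₁`. -/
def WD (n : ℕ) : Subgroup (O n) where
  carrier := {g | ∃ (σ : Equiv.Perm (Fin n)) (ε : Fin n → ℤˣ), ∏ i, ε i = 1 ∧ g = signedPerm σ ε}
  mul_mem' := by
    rintro _ _ ⟨σ, ε, hε, rfl⟩ ⟨τ, δ, hδ, rfl⟩
    refine ⟨_, _, ?_, signedPerm_mul σ τ ε δ⟩
    rw [Finset.prod_mul_distrib, hδ, mul_one, Equiv.prod_comp τ ε, hε]
  one_mem' := ⟨1, fun _ => 1, by simp, signedPerm_one.symm⟩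
  inv_mem' := by
    rintro _ ⟨σ, ε, hε, rfl⟩
    exact ⟨_, _, (Equiv.prod_comp σ⁻¹ ε).trans hε, signedPerm_inv σ ε⟩

/-- The root system `{± e_i ± e_j : i ≠ j}` of `W(D_n)`. -/
def rootsD (n : ℕ) : Set (E n) :=
  {α | ∃ (i j : Fin n) (ε δ : ℤˣ), i ≠ j ∧
    α = (((ε : ℤˣ) : ℤ) : ℝ) • e i + (((δ : ℤˣ) : ℤ) : ℝ) • e j}

/-! ### Parabolic subgroups, orthogonal complements, Howlett complements -/

/-- A parabolic subgroup of `W(D_n)` is the pointwise stabilizer of a subspace of `ℝⁿ`. -/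
def IsParabolic {n : ℕ} (P : Subgroup (O n)) : Prop :=
  ∃ U : Submodule ℝ (E n), P = pointwiseStab (WD n) U

/-- The orthogonal complement in `W(D_n)` of a reflection subgroup `U`: it is generated by the
reflections of `W(D_n)` whose hyperplane is orthogonal to the hyperplane of each reflection
in `U`. -/
def orthComplement {n : ℕ} (U : Subgroup (O n)) : Subgroup (O n) :=
  Subgroup.closure {t | t ∈ WD n ∧ ∃ α : E n, α ≠ 0 ∧ t = refl α ∧
    ∀ β : E n, β ≠ 0 → refl β ∈ U → ⟪α, β⟫_ℝ = 0}

/-- The roots of a reflection subgroup `U` of `W(D_n)`. -/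
def rootsOf {n : ℕ} (U : Subgroup (O n)) : Set (E n) := {α | α ∈ rootsD n ∧ refl α ∈ U}

/-- `ρ` is regular for `U`: it is not orthogonal to any root of `U`. -/
def IsRegular {n : ℕ} (U : Subgroup (O n)) (ρ : E n) : Prop := ∀ α ∈ rootsOf U, ⟪ρ, α⟫_ℝ ≠ 0

/-- The positive system of the root system of `U` that a regular vector `ρ` determines. -/
def posRoots {n : ℕ} (U : Subgroup (O n)) (ρ : E n) : Set (E n) :=
  {α | α ∈ rootsOf U ∧ 0 < ⟪ρ, α⟫_ℝ}

/-- The vector `(n, n - 1, …, 1)`, for which the positive roots are `e_i ± e_j`, `i < j`. -/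
def stdRho (n : ℕ) : E n := WithLp.toLp 2 fun i => (n : ℝ) - (i : ℕ)

/-- The Howlett complement in `G` of the reflection subgroup with positive roots `Φpos`: the
elements of `G` that map positive roots to positive roots. (As `Φpos` is finite and `a` is
injective, `a '' Φpos ⊆ Φpos` is the same as `a '' Φpos = Φpos`.) -/
def howlett {n : ℕ} (G : Subgroup (O n)) (Φpos : Set (E n)) : Subgroup (O n) where
  carrier := {a | a ∈ G ∧ (fun v => a v) '' Φpos = Φpos}
  mul_mem' := by
    rintro a b ⟨ha, ha'⟩ ⟨hb, hb'⟩
    refine ⟨mul_mem ha hb, ?_⟩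
    have h : (fun v => (a * b) v) = (fun v => a v) ∘ (fun v => b v) := rfl
    rw [h, Set.image_comp, hb', ha']
  one_mem' := ⟨one_mem _, Set.image_id Φpos⟩
  inv_mem' := by
    rintro a ⟨ha, ha'⟩
    refine ⟨inv_mem ha, ?_⟩
    conv_lhs => rw [← ha']
    rw [← Set.image_comp]
    have h : (fun v => a⁻¹ v) ∘ (fun v => a v) = id := by
      funext v
      exact a.symm_apply_apply v
    rw [h, Set.image_id]

/-! ### Internal products and Coxeter types -/

/-- `L = H × K`, as an internal direct product. -/
def IsDirect {G : Type*} [Group G] (H K L : Subgroup G) : Prop :=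
  H ⊔ K = L ∧ H ⊓ K = ⊥ ∧ ∀ h ∈ H, ∀ k ∈ K, h * k = k * h

/-- `L = H ⋊ K`, as an internal semidirect product, with `H` normal in `L`. -/
def IsSemidirect {G : Type*} [Group G] (H K L : Subgroup G) : Prop :=
  H ⊔ K = L ∧ H ⊓ K = ⊥ ∧ K ≤ Subgroup.normalizer (H : Set G)

/-- `g` leaves `U` invariant and acts on `U` as a reflection. -/
def ActsAsRefl {n : ℕ} (g : O n) (U : Submodule ℝ (E n)) : Prop :=
  ∃ α ∈ U, α ≠ 0 ∧ ∀ x ∈ U, g x = refl α x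

/-- `G` leaves `U` invariant and acts on `U` as a reflection group: the group of isometries of
`U` that `G` induces is generated by reflections of `U`. -/
def ActsAsReflGroup {n : ℕ} (G : Subgroup (O n)) (U : Submodule ℝ (E n)) : Prop :=
  (∀ g ∈ G, ∀ x ∈ U, g x ∈ U) ∧
  ∀ g ∈ G, ∃ h ∈ Subgroup.closure {s | s ∈ G ∧ ActsAsRefl s U}, ∀ x ∈ U, g x = h x

/-- `G` acts faithfully on `U` as a Coxeter group of the type of the group `M` with set of
reflections `R`: it acts as a reflection group, and there is an isomorphism from `G` to `M` under
which the elements that act as reflections on `U` correspond to the elements of `R`. -/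
def HasTypeOn {n : ℕ} (G : Subgroup (O n)) (U : Submodule ℝ (E n)) {M : Type} [Group M]
    (R : Set M) : Prop :=
  ActsAsReflGroup G U ∧ (∀ g ∈ G, (∀ x ∈ U, g x = x) → g = 1) ∧
  ∃ φ : G ≃* M, ∀ g : G, ActsAsRefl (g : O n) U ↔ φ g ∈ R

/-- The reflections of a direct product of two Coxeter groups. -/
def prodRefl {M M' : Type} [Group M] [Group M'] (R : Set M) (R' : Set M') : Set (M × M') :=
  {g | (g.1 ∈ R ∧ g.2 = 1) ∨ (g.1 = 1 ∧ g.2 ∈ R')}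

/-- The reflections of a direct product of a family of Coxeter groups. -/
def piRefl {ι : Type} {M : ι → Type} [∀ i, Group (M i)] (R : ∀ i, Set (M i)) :
    Set (∀ i, M i) :=
  {g | ∃ i, g i ∈ R i ∧ ∀ j, j ≠ i → g j = 1}

/-- The reflections of `W(B_a)`. -/
def reflB (a : ℕ) : Set (WB a) := {g | IsRefl (g : O a)}

/-- The reflections of `W(D_a)`. -/
def reflD (a : ℕ) : Set (WD a) := {g | IsRefl (g : O a)}

/-- The reflections of the symmetric group on `k` points, a Coxeter group of type `A_{k-1}`. -/
def reflS (k : ℕ) : Set (Equiv.Perm (Fin k)) := {g | g.IsSwap}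

/-! ### Partitions, standard parabolic subgroups, and generators

The parts `λ_0 ≥ λ_1 ≥ …` and the points of `Fin n` are numbered from `0`. -/

variable {n : ℕ}

/-- The `i`-th part of a partition in weakly decreasing order, and `0` beyond the last part. -/
def part (lam : n.Partition) (i : ℕ) : ℕ := (lam.parts.sort (· ≥ ·)).getD i 0

/-- The number `ℓ(λ)` of parts. -/
def len (lam : n.Partition) : ℕ := Multiset.card lam.parts

/-- The multiplicity `a_k` of the part `k`. -/
def mult (lam : n.Partition) (k : ℕ) : ℕ := lam.parts.count k

/-- The sum of the parts that precede the `i`-th part. -/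
def offset (lam : n.Partition) (i : ℕ) : ℕ := ∑ j ∈ Finset.range i, part lam j

/-- The point `v` belongs to the `i`-th block. -/
def InBlock (lam : n.Partition) (i : ℕ) (v : Fin n) : Prop :=
  offset lam i ≤ v ∧ (v : ℕ) < offset lam i + part lam i

instance (lam : n.Partition) (i : ℕ) (v : Fin n) : Decidable (InBlock lam i v) :=
  inferInstanceAs (Decidable (_ ∧ _))

/-- The standard parabolic subgroup `∏ S_{λ_i}` of `W(D_n)`: the permutations (without signs)
that leave every block invariant. -/
def young (lam : n.Partition) : Subgroup (O n) where
  carrier := {g | ∃ σ : Equiv.Perm (Fin n), (∀ i v, InBlock lam i (σ v) ↔ InBlock lam i v) ∧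
    g = signedPerm σ (fun _ => 1)}
  mul_mem' := by
    rintro _ _ ⟨σ, hσ, rfl⟩ ⟨τ, hτ, rfl⟩
    refine ⟨σ * τ, fun i v => ?_, ?_⟩
    · rw [Equiv.Perm.mul_apply, hσ, hτ]
    · rw [signedPerm_mul]
      simp
  one_mem' := ⟨1, fun _ _ => Iff.rfl, signedPerm_one.symm⟩
  inv_mem' := by
    rintro _ ⟨σ, hσ, rfl⟩
    refine ⟨σ⁻¹, fun i v => ?_, signedPerm_inv σ _⟩
    rw [← hσ i (σ⁻¹ v), ← Equiv.Perm.mul_apply, mul_inv_cancel, Equiv.Perm.one_apply]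

/-- `P` is a parabolic subgroup of `W(D_n)` with label `lam` (where `lam` is a partition of `n`
that is not even): it is conjugate in `W(D_n)` to the standard one. -/
def HasLabel (P : Subgroup (O n)) (lam : n.Partition) : Prop :=
  IsParabolic P ∧ ∃ w ∈ WD n, P = (young lam).map (MulAut.conj w).toMonoidHom

/-- The permutation that exchanges the adjacent blocks `[u, u + k)` and `[u + k, u + 2k)` by
`v ↔ v + k` (and the identity if they do not fit into `Fin n`). -/
def blockSwap (n u k : ℕ) : Equiv.Perm (Fin n) :=
  if h : u + 2 * k ≤ n then
    Function.Involutive.toPerm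
      (fun v : Fin n =>
        (⟨if u ≤ v ∧ (v : ℕ) < u + k then v + k
          else if u + k ≤ v ∧ (v : ℕ) < u + 2 * k then v - k else v, by
            have := v.isLt
            split_ifs <;> omega⟩ : Fin n))
      (by
        intro v
        apply Fin.ext
        dsimp only
        split_ifs <;> omega)
  else 1

/-- The permutation that reverses the block `[u, u + k)` (and the identity if it does not fit
into `Fin n`). -/
def blockRev (n u k : ℕ) : Equiv.Perm (Fin n) :=
  if h : u + k ≤ n then
    Function.Involutive.toPerm
      (fun v : Fin n =>
        (⟨if u ≤ v ∧ (v : ℕ) < u + k then 2 * u + k - 1 - v else v, by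
            have := v.isLt
            split_ifs <;> omega⟩ : Fin n))
      (by
        intro v
        apply Fin.ext
        dsimp only
        split_ifs <;> omega)
  else 1

/-- `x_i`, used when `λ_i = λ_{i+1}`: it exchanges the `i`-th and the next block. -/
def x (lam : n.Partition) (i : ℕ) : O n :=
  signedPerm (blockSwap n (offset lam i) (part lam i)) (fun _ => 1)

/-- `y_i`: it reverses the `i`-th block and changes all signs in it. -/
def y (lam : n.Partition) (i : ℕ) : O n :=
  signedPerm (blockRev n (offset lam i) (part lam i)) (fun v => if InBlock lam i v then -1 else 1)

/-- `y'_i = x_i y_i y_{i+1}`, used when `λ_i = λ_{i+1}`. -/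
def y' (lam : n.Partition) (i : ℕ) : O n := x lam i * y lam i * y lam (i + 1)

/-- `z'_{ij} = y_i y_j`, used when `λ_i` and `λ_j` are distinct and odd. -/
def z' (lam : n.Partition) (i j : ℕ) : O n := y lam i * y lam j

/-- The group `∏_{k ∈ S} W(B_{a_k})`. -/
abbrev prodB (lam : n.Partition) (S : Finset ℕ) : Type := ∀ k : S, WB (mult lam k)

/-- The reflections of `∏_{k ∈ S} W(B_{a_k})`. -/
def reflProdB (lam : n.Partition) (S : Finset ℕ) : Set (prodB lam S) :=
  piRefl fun k : S => reflB (mult lam k)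

/-- `∏_{k > 2} (S_k)^{a_k}`, a Coxeter group of type `A₂^{a₃} A₃^{a₄} ⋯ A_{n-1}^{a_n}`. -/
abbrev prodA (lam : n.Partition) : Type :=
  ∀ k : Finset.Icc 3 n, Fin (mult lam k) → Equiv.Perm (Fin k)

/-- The reflections of `∏_{k > 2} (S_k)^{a_k}`. -/
def reflProdA (lam : n.Partition) : Set (prodA lam) :=
  piRefl fun k : Finset.Icc 3 n => piRefl fun _ : Fin (mult lam k) => reflS k

/-! ### The subgroups attached to the standard parabolic subgroup -/

/-- `N = N_W(P)` for the standard parabolic subgroup `P` with label `lam`. -/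
def N (lam : n.Partition) : Subgroup (O n) := normalizerIn (WD n) (young lam)

/-- `Q`, the orthogonal complement of `P` in `W`. -/
def Q (lam : n.Partition) : Subgroup (O n) := orthComplement (young lam)

/-- `X = Fix(P)`. -/
def X (lam : n.Partition) : Submodule ℝ (E n) := fixedSpace (young lam)

/-- `Y = Fix(Q)`. -/
def Y (lam : n.Partition) : Submodule ℝ (E n) := fixedSpace (Q lam)

/-- `D`, the Howlett complement of the reflection subgroup `PQ` in `N`. -/
def D (lam : n.Partition) : Subgroup (O n) :=
  howlett (N lam) (posRoots (young lam ⊔ Q lam) (stdRho n))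

/-- `A`, the pointwise stabilizer of `Yᗮ` in `D`. -/
def A (lam : n.Partition) : Subgroup (O n) := pointwiseStab (D lam) (Y lam)ᗮ

/-- `B`, the pointwise stabilizer of `X ∩ Y` in `D`. -/
def B (lam : n.Partition) : Subgroup (O n) := pointwiseStab (D lam) (X lam ⊓ Y lam)

/-- `A₀`, generated by the `x_i` and the `y_j` of the blocks of even size greater than `2`. -/
def A0 (lam : n.Partition) : Subgroup (O n) :=
  Subgroup.closure
    ({g | ∃ i, part lam i = part lam (i + 1) ∧ 2 < part lam i ∧ Even (part lam i) ∧ g = x lam i} ∪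
     {g | ∃ j, 2 < part lam j ∧ Even (part lam j) ∧ g = y lam j})

/-- `A₁`, generated by the `x_i` and the `y'_i` of the blocks of odd size greater than `2` and the
`z'_{pq}` for the blocks of distinct odd sizes greater than `m`. -/
def A1 (lam : n.Partition) (m : ℕ) : Subgroup (O n) :=
  Subgroup.closure
    ({g | ∃ i, part lam i = part lam (i + 1) ∧ 2 < part lam i ∧ Odd (part lam i) ∧
        (g = x lam i ∨ g = y' lam i)} ∪
     {g | ∃ p q, part lam q < part lam p ∧ m < part lam q ∧ Odd (part lam p) ∧
        Odd (part lam q) ∧ g = z' lam p q})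

end ParabolicD

end

/-!
Everything is reduced to signed permutations of the *blocks* of `λ`. A size-preserving signed
permutation of the blocks (the group `Gam`) acts on `ℝⁿ` through `bO`: the permutation part moves
blocks, keeping the order inside each, and a sign `-1` at a block reverses it and changes its signs.
So `x_i` is a transposition, `y_i` a single sign, and `bO t` lies in `W(D_n)` if and only if the
character `chi t = ∏ sgn_i ^ λ_i` is `1`. A signed permutation of the points that preserves the
standard positive roots of `P` is of the form `bO t`, so the Howlett complement of `P` is the kernel
of `chi` on all of `Gam ≅ ∏ W(B_{a_k})` (`howlett_young_eq`), of index `2` as there is an odd part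
(`exists_index_two`). Any other parabolic subgroup with label `λ` and any other positive system are
moved to the standard ones by an element of `W(D_n)`, because a reflection group acts transitively
on its positive systems (`exists_image_posRoots_eq`, `nonempty_howlett_equiv`).

The subgroups in question are described in the same way: `Q_eq` (signs on the blocks of size `1` and
`2`, permutations of the blocks of size `1`, `chi = 1`), `D_eq`, `A_eq_of_le`, `A_eq_of_lt`, `B_eq`,
`A0_eq`, `A1_eq`. That a set of the `x_i`, `y_j`, `y'_i`, `z'_ij` generates such a group is the
statement that the kernel of `chi` on signed permutations is generated by adjacent transpositions,
signs of even blocks and pairs of signs of odd blocks (`KS_le`). The decompositions into products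
then become elementary: an element is split according to the sizes of the blocks (`restr`), and the
only obstruction is the parity condition `chi = 1`, which couples the odd blocks. It is the reason
for the factor `C`: it may be carried by the last block, of size `1`, together with an odd block of
size greater than `1` (`isSemidirect_zpowers`). The factorization `N = (P × Q) ⋊ D` is again
transitivity on positive systems, now for `P × Q` (`isSemidirect_D`).

For the actions, the normalized sums of the blocks (`bvec`) are an orthonormal basis of `X`, on
which `bO t` acts through the signed permutation `t` itself. A signed permutation of an orthonormal
family acts on its span as a reflection exactly if it is a transposition with equal signs or a
single sign (`Acts.actsAsRefl_iff`), so that types on `X` can be read off from an isomorphism of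
groups of signed permutations (`hasTypeOn_span`). Types are carried over to other subspaces by
`hasTypeOn_iff_of_le`: the type of a group does not change if the space is enlarged or shrunk by
vectors that the group fixes. For `Xᗮ`, which has no orthonormal basis permuted up to signs by
`P ⋊ B`, the enlarged space is the span of `mvec`, made of the `(e_u - e_v) / √2` for the blocks
`{u, v}` of size `2` and of the `e_v` for the points `v` of the larger blocks.
-/

noncomputable section

namespace ParabolicD

open scoped InnerProductSpace

/-! ### Abstract signed permutations -/

/-- A signed permutation of `κ`: it stands for the linear map `b_i ↦ sgn i • b_{perm i}` of a
space with basis `b` indexed by `κ`. -/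
@[ext] structure SP (κ : Type*) where
  /-- the underlying permutation -/
  perm : Equiv.Perm κ
  /-- the signs -/
  sgn : κ → ℤˣ

namespace SP
variable {κ : Type*}

instance : Mul (SP κ) := ⟨fun s t => ⟨s.perm * t.perm, fun i => s.sgn (t.perm i) * t.sgn i⟩⟩
instance : One (SP κ) := ⟨⟨1, fun _ => 1⟩⟩
instance : Inv (SP κ) := ⟨fun s => ⟨s.perm⁻¹, fun i => s.sgn (s.perm⁻¹ i)⟩⟩

@[simp] theorem mul_perm (s t : SP κ) : (s * t).perm = s.perm * t.perm := rfl
@[simp] theorem mul_sgn (s t : SP κ) (i : κ) : (s * t).sgn i = s.sgn (t.perm i) * t.sgn i := rfl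
@[simp] theorem one_perm : (1 : SP κ).perm = 1 := rfl
@[simp] theorem one_sgn (i : κ) : (1 : SP κ).sgn i = 1 := rfl
@[simp] theorem inv_perm (s : SP κ) : s⁻¹.perm = s.perm⁻¹ := rfl
@[simp] theorem inv_sgn (s : SP κ) (i : κ) : s⁻¹.sgn i = s.sgn (s.perm⁻¹ i) := rfl

theorem ext' {s t : SP κ} (h : ∀ i, s.perm i = t.perm i) (h' : ∀ i, s.sgn i = t.sgn i) : s = t :=
  SP.ext (Equiv.ext h) (funext h')

theorem ext_iff' {s t : SP κ} : s = t ↔ ∀ i, s.perm i = t.perm i ∧ s.sgn i = t.sgn i :=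
  ⟨by rintro rfl; simp, fun h => ext' (fun i => (h i).1) fun i => (h i).2⟩

instance : Group (SP κ) :=
  Group.ofLeftAxioms
    (fun s t u => ext' (fun _ => rfl) fun i => by simp [mul_assoc])
    (fun s => ext' (fun _ => rfl) fun i => by simp)
    (fun s => ext' (fun i => by simp) fun i => by simp)

/-- A permutation, as a signed permutation without signs. -/
def ofPerm : Equiv.Perm κ →* SP κ where
  toFun σ := ⟨σ, fun _ => 1⟩
  map_one' := rfl
  map_mul' σ τ := ext' (fun _ => rfl) fun i => by simp

/-- A family of signs, as a signed permutation. -/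
def ofSign : (κ → ℤˣ) →* SP κ where
  toFun ε := ⟨1, ε⟩
  map_one' := rfl
  map_mul' ε δ := ext' (fun _ => rfl) fun i => by simp

/-- The underlying permutation, as a homomorphism. -/
def permHom : SP κ →* Equiv.Perm κ where
  toFun s := s.perm
  map_one' := rfl
  map_mul' _ _ := rfl

@[simp] theorem ofPerm_perm (σ : Equiv.Perm κ) : (ofPerm σ).perm = σ := rfl
@[simp] theorem ofPerm_sgn (σ : Equiv.Perm κ) (i : κ) : (ofPerm σ).sgn i = 1 := rfl
@[simp] theorem ofSign_perm (ε : κ → ℤˣ) : (ofSign ε).perm = 1 := rfl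
@[simp] theorem ofSign_sgn (ε : κ → ℤˣ) (i : κ) : (ofSign ε).sgn i = ε i := rfl

/-- `s` acts on the span of an orthonormal family as a reflection: either in `b_i ∓ b_j`, or in
`b_i`. -/
def IsRefl (s : SP κ) : Prop :=
  (∃ i j, i ≠ j ∧ s.perm i = j ∧ s.perm j = i ∧ s.sgn i = s.sgn j ∧
    ∀ k, k ≠ i → k ≠ j → s.perm k = k ∧ s.sgn k = 1) ∨
  ∃ i, s.perm i = i ∧ s.sgn i = -1 ∧ ∀ k, k ≠ i → s.perm k = k ∧ s.sgn k = 1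

/-- Signed permutations with disjoint supports commute. -/
theorem commute_of_disjoint {s t : SP κ} (p : κ → Prop)
    (hs : ∀ i, p i → s.perm i = i ∧ s.sgn i = 1) (ht : ∀ i, ¬ p i → t.perm i = i ∧ t.sgn i = 1) :
    s * t = t * s := by
  have hs' : ∀ i, ¬ p i → ¬ p (s.perm i) := fun i hi h =>
    hi (by rwa [← s.perm.injective (hs _ h).1])
  have ht' : ∀ i, p i → p (t.perm i) := fun i hi => by
    by_contra h
    exact h (by rwa [t.perm.injective (ht _ h).1])
  refine ext_iff'.2 fun i => ?_
  by_cases h : p i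
  · simp [(hs _ h).1, (hs _ h).2, (hs _ (ht' _ h)).1, (hs _ (ht' _ h)).2]
  · simp [(ht _ h).1, (ht _ h).2, (ht _ (hs' _ h)).1, (ht _ (hs' _ h)).2]

end SP

theorem refl_apply {n : ℕ} (α v : E n) : refl α v = v - (2 * ⟪α, v⟫_ℝ / ‖α‖ ^ 2) • α := by
  rw [refl, Submodule.reflection_orthogonal_apply, Submodule.reflection_singleton_apply]
  simp only [RCLike.ofReal_real_eq_id, id_eq, neg_sub, two_smul, ← add_smul]
  ring_nf

theorem refl_self {n : ℕ} (α : E n) : refl α α = -α :=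
  Submodule.reflection_orthogonalComplement_singleton_eq_neg α

theorem refl_of_inner_eq_zero {n : ℕ} {α v : E n} (h : ⟪α, v⟫_ℝ = 0) : refl α v = v := by
  simp [refl_apply, h]

theorem inner_eq_zero_of_refl {n : ℕ} {α v : E n} (h : refl α v = v) : ⟪α, v⟫_ℝ = 0 := by
  by_cases hα : α = 0
  · simp [hα]
  rw [refl_apply, sub_eq_self, smul_eq_zero] at h
  rcases h with h | h
  · have : ‖α‖ ^ 2 ≠ 0 := by positivity
    field_simp at h
    linarith
  · exact absurd h hα

theorem refl_smul {n : ℕ} (α : E n) {c : ℝ} (hc : c ≠ 0) : refl (c • α) = refl α := by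
  unfold refl
  congr 2
  exact Submodule.span_singleton_smul_eq (IsUnit.mk0 c hc) α

theorem conj_refl {n : ℕ} (g : O n) (α : E n) : g * refl α * g⁻¹ = refl (g α) := by
  ext1 v
  change g (refl α (g⁻¹ v)) = _
  have h : ⟪α, g⁻¹ v⟫_ℝ = ⟪g α, v⟫_ℝ := by
    rw [← g.inner_map_map]
    congr 1
    exact g.apply_symm_apply v
  have h' : g (g⁻¹ v) = v := g.apply_symm_apply v
  rw [refl_apply, refl_apply, map_sub, map_smul, h, h', g.norm_map]

/-- `g` acts on the family `b` through the signed permutation `s`. -/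
def Acts {n : ℕ} {κ : Type*} (g : O n) (b : κ → E n) (s : SP κ) : Prop :=
  ∀ i, g (b i) = ((s.sgn i : ℤ) : ℝ) • b (s.perm i)

section Orthonormal
variable {n : ℕ} {κ : Type*} {b : κ → E n}

theorem Acts.apply_mem_span {g : O n} {s : SP κ} (hg : Acts g b s) {v : E n}
    (hv : v ∈ Submodule.span ℝ (Set.range b)) : g v ∈ Submodule.span ℝ (Set.range b) := by
  induction hv using Submodule.span_induction with
  | mem v hv =>
    obtain ⟨i, rfl⟩ := hv
    rw [hg i]
    exact Submodule.smul_mem _ _ (Submodule.subset_span ⟨_, rfl⟩)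
  | zero => simp
  | add v w _ _ hv hw => rw [map_add]; exact add_mem hv hw
  | smul c v _ hv => rw [map_smul]; exact Submodule.smul_mem _ _ hv

/-- Two isometries that agree on a family agree on its span. -/
theorem eq_on_span {g h : O n} (H : ∀ i, g (b i) = h (b i)) {v : E n}
    (hv : v ∈ Submodule.span ℝ (Set.range b)) : g v = h v := by
  induction hv using Submodule.span_induction with
  | mem v hv => obtain ⟨i, rfl⟩ := hv; exact H i
  | zero => simp
  | add v w _ _ hv hw => rw [map_add, map_add, hv, hw]
  | smul c v _ hv => rw [map_smul, map_smul, hv]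

variable (hb : Orthonormal ℝ b)
include hb

theorem sgn_smul_inj {u v : ℤˣ} {i j : κ} (h : ((u : ℤ) : ℝ) • b i = ((v : ℤ) : ℝ) • b j) :
    i = j ∧ u = v := by
  classical
  have h1 : ⟪b j, ((u : ℤ) : ℝ) • b i⟫_ℝ = ((v : ℤ) : ℝ) := by
    rw [h, inner_smul_right, orthonormal_iff_ite.1 hb]
    simp
  rw [inner_smul_right, orthonormal_iff_ite.1 hb] at h1
  by_cases hij : j = i
  · rw [if_pos hij, mul_one] at h1
    exact ⟨hij.symm, Units.ext (by exact_mod_cast h1)⟩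
  · rw [if_neg hij, mul_zero] at h1
    exact absurd h1.symm (by exact_mod_cast v.ne_zero)

theorem Acts.eq_one {g : O n} {s : SP κ} (hg : Acts g b s) (h : ∀ i, g (b i) = b i) : s = 1 := by
  refine SP.ext_iff'.2 fun i => ?_
  have := sgn_smul_inj hb (u := s.sgn i) (v := 1) (i := s.perm i) (j := i)
    (by rw [← hg i, h i]; simp)
  simpa using this

/-- A signed permutation of an orthonormal family acts on its span as a reflection if and only if
it is a signed transposition with equal signs, or a single change of sign. -/
theorem Acts.actsAsRefl_iff {g : O n} {s : SP κ} (hg : Acts g b s) :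
    ActsAsRefl g (Submodule.span ℝ (Set.range b)) ↔ s.IsRefl := by
  classical
  have hin := orthonormal_iff_ite.1 hb
  have hne := hb.ne_zero
  constructor
  · rintro ⟨α, hα, hα0, H⟩
    have Hb : ∀ i, ((s.sgn i : ℤ) : ℝ) • b (s.perm i) = refl α (b i) := fun i => by
      rw [← hg i, H _ (Submodule.subset_span ⟨i, rfl⟩)]
    by_cases hp : ∃ i, s.perm i ≠ i
    · obtain ⟨i, hi⟩ := hp
      left
      have h1 := Hb i
      rw [refl_apply] at h1
      set c := 2 * ⟪α, b i⟫_ℝ / ‖α‖ ^ 2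
      -- `α` is a multiple of `b_i - ε b_j`
      have h2 : c • α = b i - ((s.sgn i : ℤ) : ℝ) • b (s.perm i) := by rw [h1]; abel
      have hc : c ≠ 0 := by
        rintro h0
        rw [h0, zero_smul, eq_comm, sub_eq_zero] at h2
        exact hi (sgn_smul_inj hb (u := s.sgn i) (v := 1) (by rw [← h2]; simp)).1
      have h3 : refl α = refl (b i - ((s.sgn i : ℤ) : ℝ) • b (s.perm i)) := by
        rw [← h2, refl_smul _ hc]
      have hn : ‖b i - ((s.sgn i : ℤ) : ℝ) • b (s.perm i)‖ ^ 2 = 2 := by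
        rw [← real_inner_self_eq_norm_sq]
        simp only [inner_sub_left, inner_sub_right, inner_smul_left, inner_smul_right, hin,
          if_neg hi, if_neg (Ne.symm hi)]
        rcases Int.units_eq_one_or (s.sgn i) with h | h <;> rw [h] <;> norm_num
      rw [h3] at Hb
      have hj := Hb (s.perm i)
      rw [refl_apply, hn, inner_sub_left, inner_smul_left, hin, hin, if_neg (Ne.symm hi)] at hj
      have hj' : ((s.sgn (s.perm i) : ℤ) : ℝ) • b (s.perm (s.perm i))
          = ((s.sgn i : ℤ) : ℝ) • b i := by
        rw [hj]
        rcases Int.units_eq_one_or (s.sgn i) with h | h <;> rw [h] <;> simp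
      obtain ⟨e1, e2⟩ := sgn_smul_inj hb hj'
      refine ⟨i, s.perm i, Ne.symm hi, rfl, e1, e2.symm, fun k hk hk' => ?_⟩
      have := Hb k
      rw [refl_of_inner_eq_zero (by
        simp [inner_sub_left, inner_smul_left, hin, Ne.symm hk, Ne.symm hk'])] at this
      exact sgn_smul_inj hb (v := 1) (by rw [this]; simp)
    · push Not at hp
      right
      have hex : ∃ i, s.sgn i = -1 := by
        by_contra hcon
        push Not at hcon
        have h1 : ∀ v ∈ Submodule.span ℝ (Set.range b), g v = (1 : O n) v := fun v hv =>
          eq_on_span (fun i => by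
            rw [hg i, hp, (Int.units_eq_one_or _).resolve_right (hcon i)]; simp) hv
        have h2 := H α hα
        rw [h1 α hα, refl_self] at h2
        have h3 : (2 : ℝ) • α = 0 := by rw [two_smul]; exact eq_neg_iff_add_eq_zero.1 h2
        exact hα0 ((smul_eq_zero.1 h3).resolve_left two_ne_zero)
      obtain ⟨i, hi⟩ := hex
      have h1 := Hb i
      rw [refl_apply, hi, hp] at h1
      set c := 2 * ⟪α, b i⟫_ℝ / ‖α‖ ^ 2
      have h2 : c • α = (2 : ℝ) • b i := by
        have : c • α = b i - (b i - c • α) := by abel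
        rw [this, ← h1, two_smul]; simp
      have hc : c ≠ 0 := by
        rintro h0
        rw [h0, zero_smul, eq_comm, smul_eq_zero] at h2
        exact h2.elim (by norm_num) (hne i)
      have h3 : refl α = refl (b i) := by
        rw [← refl_smul α hc, h2, refl_smul _ two_ne_zero]
      refine ⟨i, hp i, hi, fun k hk => ⟨hp k, ?_⟩⟩
      have := Hb k
      rw [h3, refl_of_inner_eq_zero (by simp [hin, Ne.symm hk])] at this
      exact (sgn_smul_inj hb (v := 1) (j := k) (by rw [this]; simp)).2
  · rintro (⟨i, j, hij, h1, h2, h3, h4⟩ | ⟨i, h1, h2, h3⟩)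
    · refine ⟨b i - ((s.sgn i : ℤ) : ℝ) • b j, sub_mem (Submodule.subset_span ⟨i, rfl⟩)
        (Submodule.smul_mem _ _ (Submodule.subset_span ⟨j, rfl⟩)), fun h0 => ?_,
        fun v hv => eq_on_span (fun k => ?_) hv⟩
      · rw [sub_eq_zero] at h0
        exact hij (sgn_smul_inj hb (u := 1) (by rw [← h0]; simp)).1
      · have hn : ‖b i - ((s.sgn i : ℤ) : ℝ) • b j‖ ^ 2 = 2 := by
          rw [← real_inner_self_eq_norm_sq]
          simp only [inner_sub_left, inner_sub_right, inner_smul_left, inner_smul_right, hin,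
            if_neg hij, if_neg (Ne.symm hij)]
          rcases Int.units_eq_one_or (s.sgn i) with h | h <;> rw [h] <;> norm_num
        rw [hg k, refl_apply, hn, inner_sub_left, inner_smul_left, hin, hin]
        by_cases hki : k = i
        · subst hki
          rw [h1]; simp [Ne.symm hij]
        by_cases hkj : k = j
        · subst hkj
          rw [h2, ← h3]
          rcases Int.units_eq_one_or (s.sgn i) with h | h <;> rw [h] <;> simp [hij]
        · simp [h4 k hki hkj, Ne.symm hki, Ne.symm hkj]
    · refine ⟨b i, Submodule.subset_span ⟨i, rfl⟩, hne i, fun v hv => eq_on_span (fun k => ?_) hv⟩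
      rw [hg k]
      by_cases hki : k = i
      · subst hki
        rw [refl_self, h1, h2]; simp
      · rw [refl_of_inner_eq_zero (by simp [hin, Ne.symm hki]), (h3 k hki).1, (h3 k hki).2]
        simp

end Orthonormal

/-! ### Changing the space on which a group acts -/

section Transfer
variable {n : ℕ} {U V : Submodule ℝ (E n)}

theorem exists_add_of_le (h : U ≤ V) {v : E n} (hv : v ∈ V) :
    ∃ u ∈ U, ∃ w ∈ V ⊓ Uᗮ, v = u + w := by
  obtain ⟨u, hu, w, hw, rfl⟩ := U.exists_add_mem_mem_orthogonal v
  exact ⟨u, hu, w, ⟨(Submodule.add_mem_iff_right V (h hu)).1 hv, hw⟩, rfl⟩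

/-- If `g` fixes the complement of `U` in `V`, then it acts on `U` as a reflection if and only if
it does so on `V`. -/
theorem actsAsRefl_iff_of_le (h : U ≤ V) {g : O n} (hg : ∀ v ∈ V ⊓ Uᗮ, g v = v) :
    ActsAsRefl g U ↔ ActsAsRefl g V := by
  constructor
  · rintro ⟨α, hα, h0, H⟩
    refine ⟨α, h hα, h0, fun v hv => ?_⟩
    obtain ⟨u, hu, w, hw, rfl⟩ := exists_add_of_le h hv
    rw [map_add, map_add, H u hu, hg w hw, refl_of_inner_eq_zero (hw.2 α hα)]
  · rintro ⟨α, hα, h0, H⟩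
    refine ⟨α, ?_, h0, fun v hv => H v (h hv)⟩
    obtain ⟨u, hu, w, hw, rfl⟩ := exists_add_of_le h hα
    have h1 := H w hw.1
    rw [hg w hw] at h1
    have h2 := inner_eq_zero_of_refl h1.symm
    rw [inner_add_left, hw.2 u hu, zero_add, inner_self_eq_zero] at h2
    rwa [h2, add_zero]

theorem apply_mem_of_le (h : U ≤ V) {g : O n} (hg : ∀ v ∈ V ⊓ Uᗮ, g v = v)
    (hV : ∀ v ∈ V, g v ∈ V) {u : E n} (hu : u ∈ U) : g u ∈ U := by
  obtain ⟨u', hu', w, hw, he⟩ := exists_add_of_le h (hV u (h hu))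
  have h1 : ⟪g u, g w⟫_ℝ = 0 := by rw [g.inner_map_map]; exact hw.2 u hu
  rw [hg w hw, he, inner_add_left, hw.2 u' hu', zero_add, inner_self_eq_zero] at h1
  rwa [he, h1, add_zero]

variable {G : Subgroup (O n)} {M : Type} [Group M] {R : Set M}

/-- If `G` fixes the complement of `U` in the `G`-stable space `V`, then the Coxeter types of `G`
on `U` and on `V` agree. -/
theorem hasTypeOn_iff_of_le (h : U ≤ V) (hV : ∀ g ∈ G, ∀ v ∈ V, g v ∈ V)
    (hG : ∀ g ∈ G, ∀ v ∈ V ⊓ Uᗮ, g v = v) : HasTypeOn G U R ↔ HasTypeOn G V R := by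
  have hset : {s | s ∈ G ∧ ActsAsRefl s U} = {s | s ∈ G ∧ ActsAsRefl s V} :=
    Set.ext fun s => and_congr_right fun hs => actsAsRefl_iff_of_le h (hG s hs)
  have hle : Subgroup.closure {s | s ∈ G ∧ ActsAsRefl s V} ≤ G :=
    (Subgroup.closure_le G).2 fun s hs => hs.1
  have hext : ∀ g ∈ G, ∀ g' ∈ G, (∀ v ∈ U, g v = g' v) ↔ ∀ v ∈ V, g v = g' v := by
    refine fun g hg g' hg' => ⟨fun H v hv => ?_, fun H v hv => H v (h hv)⟩
    obtain ⟨u, hu, w, hw, rfl⟩ := exists_add_of_le h hv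
    rw [map_add, map_add, H u hu, hG g hg w hw, hG g' hg' w hw]
  unfold HasTypeOn ActsAsReflGroup
  rw [hset]
  refine and_congr (and_congr ⟨fun _ => hV, fun _ g hg v hv =>
    apply_mem_of_le h (hG g hg) (hV g hg) hv⟩ ?_) (and_congr ?_ ?_)
  · exact forall₂_congr fun g hg => exists_congr fun g' => and_congr_right fun hg' =>
      hext g hg g' (hle hg')
  · exact forall₂_congr fun g hg => imp_congr_left (hext g hg 1 (one_mem _))
  · exact exists_congr fun φ => forall_congr' fun g => by
      rw [actsAsRefl_iff_of_le h (hG g g.2)]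

/-- A criterion for a group that acts on an orthonormal family through signed permutations. -/
theorem hasTypeOn_span {κ : Type*} {b : κ → E n} (hb : Orthonormal ℝ b) (ψ : M →* O n)
    (θ : M →* SP κ) (hθ : Function.Injective θ) (hψ : ∀ m, Acts (ψ m) b (θ m))
    (hR : ∀ m, (θ m).IsRefl ↔ m ∈ R) (hG : ψ.range = G)
    (hgen : G ≤ Subgroup.closure {s | s ∈ G ∧ ActsAsRefl s (Submodule.span ℝ (Set.range b))}) :
    HasTypeOn G (Submodule.span ℝ (Set.range b)) R := by
  subst hG
  have h1 : ∀ m, (∀ i, ψ m (b i) = b i) → m = 1 := fun m h =>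
    hθ (by rw [(hψ m).eq_one hb h, map_one])
  have hinj : Function.Injective ψ := (injective_iff_map_eq_one ψ).2 fun m hm =>
    h1 m fun i => by rw [hm]; rfl
  refine ⟨⟨?_, fun g hg => ⟨g, hgen hg, fun _ _ => rfl⟩⟩, ?_, ψ.ofInjective hinj |>.symm, ?_⟩
  · rintro _ ⟨m, rfl⟩ v hv
    exact (hψ m).apply_mem_span hv
  · rintro _ ⟨m, rfl⟩ h
    rw [h1 m fun i => h _ (Submodule.subset_span ⟨i, rfl⟩), map_one]
  · intro g
    obtain ⟨m, rfl⟩ := (ψ.ofInjective hinj).surjective g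
    rw [MulEquiv.symm_apply_apply, MonoidHom.ofInjective_apply, (hψ m).actsAsRefl_iff hb, hR]

end Transfer

/-! ### Signed permutations of the standard basis -/

section Std
variable {n : ℕ}

/-- The realization of signed permutations of `Fin n` on `ℝⁿ`. -/
def toO : SP (Fin n) →* O n where
  toFun s := signedPerm s.perm s.sgn
  map_one' := signedPerm_one
  map_mul' _ _ := (signedPerm_mul _ _ _ _).symm

theorem toO_apply (s : SP (Fin n)) : toO s = signedPerm s.perm s.sgn := rfl

theorem orthonormal_e : Orthonormal ℝ (e : Fin n → E n) := EuclideanSpace.orthonormal_single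

theorem acts_toO (s : SP (Fin n)) : Acts (toO s) e s := fun i => signedPerm_e _ _ i

theorem span_e : Submodule.span ℝ (Set.range (e : Fin n → E n)) = ⊤ := by
  have h := (EuclideanSpace.basisFun (Fin n) ℝ).toBasis.span_eq
  rw [← h]
  congr 2
  funext i
  simp [e]

theorem toO_injective : Function.Injective (toO : SP (Fin n) →* O n) :=
  (injective_iff_map_eq_one toO).2 fun s hs =>
    (acts_toO s).eq_one orthonormal_e fun i => by rw [hs]; rfl

theorem isRefl_toO {s : SP (Fin n)} : IsRefl (toO s) ↔ s.IsRefl := by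
  rw [← (acts_toO s).actsAsRefl_iff orthonormal_e, span_e]
  constructor
  · rintro ⟨α, h0, h⟩
    exact ⟨α, trivial, h0, fun v _ => by rw [h]⟩
  · rintro ⟨α, -, h0, h⟩
    exact ⟨α, h0, LinearIsometryEquiv.ext fun v => h v trivial⟩

/-- The product of the signs. -/
def detSgn {κ : Type*} [Fintype κ] : SP κ →* ℤˣ where
  toFun s := ∏ i, s.sgn i
  map_one' := by simp
  map_mul' s t := by
    simp only [SP.mul_sgn, Finset.prod_mul_distrib]
    rw [Equiv.prod_comp t.perm s.sgn]

theorem WD_eq : WD n = (detSgn.ker).map toO := by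
  ext g
  constructor
  · rintro ⟨σ, ε, h, rfl⟩
    exact ⟨⟨σ, ε⟩, h, rfl⟩
  · rintro ⟨s, h, rfl⟩
    exact ⟨_, _, h, rfl⟩

theorem toO_mem_WD {s : SP (Fin n)} : toO s ∈ WD n ↔ ∏ i, s.sgn i = 1 := by
  rw [WD_eq, Subgroup.mem_map_iff_mem toO_injective]
  rfl

theorem exists_of_mem_WD {g : O n} (h : g ∈ WD n) : ∃ s, ∏ i, s.sgn i = 1 ∧ toO s = g := by
  rw [WD_eq] at h
  exact h

/-- `W(B_n)` as the abstract group of signed permutations. -/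
def equivWB (n : ℕ) : SP (Fin n) ≃* WB n :=
  (toO.ofInjective toO_injective).trans (MulEquiv.subgroupCongr (by
    ext g
    exact ⟨fun ⟨s, h⟩ => ⟨_, _, h.symm⟩, fun ⟨σ, ε, h⟩ => ⟨⟨σ, ε⟩, h.symm⟩⟩))

end Std

/-! ### Blocks of a partition -/

section Blocks
variable {n : ℕ} (lam : n.Partition)

theorem length_sort : (lam.parts.sort (· ≥ ·)).length = len lam := Multiset.length_sort _

theorem part_eq_getElem {i : ℕ} (h : i < len lam) :
    part lam i = (lam.parts.sort (· ≥ ·))[i]'(by rwa [length_sort]) := by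
  rw [part, List.getD_eq_getElem]

theorem part_pos_iff {i : ℕ} : 0 < part lam i ↔ i < len lam := by
  constructor
  · intro h
    by_contra hi
    rw [part, List.getD_eq_default _ _ (by rw [length_sort]; omega)] at h
    omega
  · intro h
    rw [part_eq_getElem lam h]
    exact lam.parts_pos ((Multiset.mem_sort (· ≥ ·)).1 (List.getElem_mem _))

theorem part_pos (i : Fin (len lam)) : 0 < part lam i := (part_pos_iff lam).2 i.2

theorem part_anti {i j : ℕ} (h : i ≤ j) : part lam j ≤ part lam i := by
  by_cases hj : j < len lam
  · rcases h.eq_or_lt with rfl | h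
    · rfl
    rw [part_eq_getElem lam hj, part_eq_getElem lam (h.trans hj)]
    exact (List.pairwise_iff_getElem.1 (Multiset.pairwise_sort lam.parts (· ≥ ·))) i j _ _ h
  · have := (part_pos_iff lam (i := j)).not.2 hj
    omega

theorem parts_eq : lam.parts = Finset.univ.val.map fun i : Fin (len lam) => part lam i := by
  have h : (lam.parts.sort (· ≥ ·)) = List.ofFn fun i : Fin (len lam) => part lam i := by
    apply List.ext_getElem
    · rw [length_sort, List.length_ofFn]
    · intro i h1 h2
      rw [List.getElem_ofFn, part_eq_getElem lam (by rwa [length_sort] at h1)]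
  rw [← Multiset.sort_eq lam.parts (· ≥ ·), h]
  simp [List.ofFn_eq_map, Fin.univ_def]

theorem mult_eq_card (k : ℕ) : mult lam k = Fintype.card {i : Fin (len lam) // part lam i = k} := by
  rw [mult]
  conv_lhs => rw [parts_eq]
  rw [Multiset.count_map, Fintype.card_subtype]
  simp only [eq_comm (a := k)]
  rfl

theorem offset_succ (i : ℕ) : offset lam (i + 1) = offset lam i + part lam i :=
  Finset.sum_range_succ _ _

theorem offset_mono : Monotone (offset lam) :=
  monotone_nat_of_le_succ fun i => by rw [offset_succ]; omega

theorem offset_len : offset lam (len lam) = n := by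
  rw [offset, Finset.sum_range]
  conv_rhs => rw [← lam.parts_sum, parts_eq]
  rfl

theorem part_le (i : ℕ) : part lam i ≤ n := by
  by_cases h : i < len lam
  · have := offset_mono lam (Nat.succ_le_of_lt h)
    rw [offset_succ, offset_len] at this
    omega
  · have := (part_pos_iff lam (i := i)).not.2 h
    omega

theorem part_mem_Icc (i : Fin (len lam)) : part lam i ∈ Finset.Icc 1 n :=
  Finset.mem_Icc.2 ⟨part_pos lam i, part_le lam i⟩

theorem exists_lt_offset (v : Fin n) : ∃ i, (v : ℕ) < offset lam (i + 1) :=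
  ⟨len lam, by
    have := offset_succ lam (len lam)
    rw [offset_len] at this
    omega⟩

theorem find_lt_len (v : Fin n) : Nat.find (exists_lt_offset lam v) < len lam := by
  have hpos : 0 < len lam := by
    by_contra h
    have h0 : len lam = 0 := by omega
    have := offset_len lam
    rw [h0] at this
    have : n = 0 := by rw [← this]; simp [offset]
    exact absurd v.2 (by omega)
  refine lt_of_le_of_lt (Nat.find_min' _ (m := len lam - 1) ?_) (by omega)
  rw [Nat.sub_add_cancel hpos, offset_len]
  exact v.2

/-- The block of a point. -/
def bl (v : Fin n) : Fin (len lam) := ⟨Nat.find (exists_lt_offset lam v), find_lt_len lam v⟩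

/-- The position of a point in its block. -/
def ps (v : Fin n) : ℕ := v - offset lam (bl lam v)

theorem offset_bl_le (v : Fin n) : offset lam (bl lam v) ≤ v := by
  change offset lam (Nat.find (exists_lt_offset lam v)) ≤ v
  rcases h : Nat.find (exists_lt_offset lam v) with _ | i
  · simp [offset]
  · have := Nat.find_min (exists_lt_offset lam v) (m := i) (by omega)
    omega

theorem val_eq (v : Fin n) : (v : ℕ) = offset lam (bl lam v) + ps lam v := by
  have := offset_bl_le lam v
  unfold ps
  omega

theorem ps_lt (v : Fin n) : ps lam v < part lam (bl lam v) := by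
  have h : (v : ℕ) < offset lam (bl lam v + 1) := Nat.find_spec (exists_lt_offset lam v)
  rw [offset_succ] at h
  have := val_eq lam v
  omega

variable {lam}

theorem block_ext {v w : Fin n} (h : bl lam v = bl lam w) (h' : ps lam v = ps lam w) : v = w := by
  ext
  rw [val_eq lam v, val_eq lam w, h, h']

theorem offset_add_part_le {i j : ℕ} (h : i < j) : offset lam i + part lam i ≤ offset lam j := by
  rw [← offset_succ]
  exact offset_mono lam h

theorem offset_inj_aux {i j p q : ℕ} (hp : p < part lam i) (hq : q < part lam j)
    (h : offset lam i + p = offset lam j + q) : i = j ∧ p = q := by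
  rcases lt_trichotomy i j with hij | rfl | hij
  · have := offset_add_part_le (lam := lam) hij
    omega
  · exact ⟨rfl, by omega⟩
  · have := offset_add_part_le (lam := lam) hij
    omega

theorem inBlock_iff {i : ℕ} {v : Fin n} : InBlock lam i v ↔ (bl lam v : ℕ) = i := by
  unfold InBlock
  have h1 := val_eq lam v
  have h2 := ps_lt lam v
  constructor
  · rintro ⟨h3, h4⟩
    exact (offset_inj_aux h2 (q := v - offset lam i) (by omega) (by omega)).1
  · rintro rfl
    omega

/-- Points are ordered by their blocks, then by their positions. -/
theorem lt_of_bl_lt {v w : Fin n} (h : bl lam v < bl lam w) : v < w := by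
  have := offset_add_part_le (lam := lam) h
  have h1 := val_eq lam v
  have h2 := ps_lt lam v
  have h3 := val_eq lam w
  exact Fin.lt_def.2 (by omega)

theorem lt_iff_of_bl_eq {v w : Fin n} (h : bl lam v = bl lam w) :
    v < w ↔ ps lam v < ps lam w := by
  have h1 := val_eq lam v
  have h3 := val_eq lam w
  rw [h] at h1
  rw [Fin.lt_def]
  omega

variable (lam) in
/-- The point in position `p` of the block `i`. -/
def pt (i : Fin (len lam)) (p : ℕ) (h : p < part lam i) : Fin n :=
  ⟨offset lam i + p, by
    have := offset_add_part_le (lam := lam) i.2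
    rw [offset_len] at this
    omega⟩

theorem pt_aux (i : Fin (len lam)) (p : ℕ) (h : p < part lam i) :
    ((bl lam (pt lam i p h) : ℕ)) = i ∧ ps lam (pt lam i p h) = p :=
  offset_inj_aux (ps_lt lam _) h (val_eq lam (pt lam i p h)).symm

@[simp] theorem bl_pt (i : Fin (len lam)) (p : ℕ) (h : p < part lam i) :
    bl lam (pt lam i p h) = i := Fin.ext (pt_aux i p h).1

@[simp] theorem ps_pt (i : Fin (len lam)) (p : ℕ) (h : p < part lam i) :
    ps lam (pt lam i p h) = p := (pt_aux i p h).2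

theorem card_block (i : Fin (len lam)) :
    (Finset.univ.filter fun v : Fin n => bl lam v = i).card = part lam i := by
  rw [← Finset.card_range (part lam i)]
  symm
  refine Finset.card_bij (fun p hp => pt lam i p (Finset.mem_range.1 hp)) ?_ ?_ ?_
  · intro p hp
    simp
  · intro p hp q hq h
    rw [← ps_pt i p (Finset.mem_range.1 hp), h, ps_pt]
  · intro v hv
    rw [Finset.mem_filter] at hv
    obtain ⟨-, rfl⟩ := hv
    exact ⟨ps lam v, Finset.mem_range.2 (ps_lt lam v), block_ext (bl_pt _ _ _) (ps_pt _ _ _)⟩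

/-- Reversal of the positions in a block of size `k` if the sign `u` is negative. -/
def flp (u : ℤˣ) (k p : ℕ) : ℕ := if u = 1 then p else k - 1 - p

@[simp] theorem flp_one (k p : ℕ) : flp 1 k p = p := rfl

theorem flp_lt {u : ℤˣ} {k p : ℕ} (h : p < k) : flp u k p < k := by
  unfold flp
  split_ifs <;> omega

theorem flp_flp {u v : ℤˣ} {k p : ℕ} (h : p < k) : flp u k (flp v k p) = flp (u * v) k p := by
  rcases Int.units_eq_one_or u with rfl | rfl <;> rcases Int.units_eq_one_or v with rfl | rfl <;>
    simp [flp]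
  omega

/-! ### Signed permutations of the blocks -/

variable (lam) in
/-- The signed permutations of the blocks that preserve the sizes of the blocks. -/
def Gam : Subgroup (SP (Fin (len lam))) where
  carrier := {s | ∀ i, part lam (s.perm i) = part lam i}
  mul_mem' {s t} hs ht i := (hs _).trans (ht i)
  one_mem' _ := rfl
  inv_mem' {s} hs i := by
    rw [← hs, SP.inv_perm, ← Equiv.Perm.mul_apply, mul_inv_cancel, Equiv.Perm.one_apply]

theorem part_perm (s : Gam lam) (i : Fin (len lam)) : part lam (s.1.perm i) = part lam i :=
  s.2 i

/-- The action of `Gam` on points. -/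
def blkFun (s : Gam lam) (v : Fin n) : Fin n :=
  pt lam (s.1.perm (bl lam v)) (flp (s.1.sgn (bl lam v)) (part lam (bl lam v)) (ps lam v))
    (by rw [part_perm s]; exact flp_lt (ps_lt lam v))

@[simp] theorem bl_blkFun (s : Gam lam) (v : Fin n) :
    bl lam (blkFun s v) = s.1.perm (bl lam v) := bl_pt _ _ _

@[simp] theorem ps_blkFun (s : Gam lam) (v : Fin n) : ps lam (blkFun s v)
    = flp (s.1.sgn (bl lam v)) (part lam (bl lam v)) (ps lam v) := ps_pt _ _ _

theorem blkFun_mul (s t : Gam lam) (v : Fin n) : blkFun (s * t) v = blkFun s (blkFun t v) :=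
  block_ext (lam := lam) (by simp) (by simp [part_perm t, flp_flp (ps_lt lam v)])

theorem blkFun_one (v : Fin n) : blkFun (1 : Gam lam) v = v :=
  block_ext (lam := lam) (by simp) (by simp)

/-- A size-preserving signed permutation of the blocks, as a signed permutation of the points: it
moves blocks and keeps the order inside a block if the sign is positive; it reverses the order
and changes all signs in the block otherwise. -/
def blk : Gam lam →* SP (Fin n) where
  toFun s := ⟨⟨blkFun s, blkFun s⁻¹, fun v => by rw [← blkFun_mul, inv_mul_cancel, blkFun_one],
    fun v => by rw [← blkFun_mul, mul_inv_cancel, blkFun_one]⟩, fun v => s.1.sgn (bl lam v)⟩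
  map_one' := SP.ext' (fun v => blkFun_one v) fun v => rfl
  map_mul' s t := SP.ext' (fun v => blkFun_mul s t v) fun v => by
    simp only [SP.mul_sgn, Subgroup.coe_mul]
    exact congrArg (fun i => s.1.sgn i * _) (bl_blkFun t v).symm

@[simp] theorem blk_sgn (s : Gam lam) (v : Fin n) : (blk s).sgn v = s.1.sgn (bl lam v) := rfl

@[simp] theorem bl_blk (s : Gam lam) (v : Fin n) :
    bl lam ((blk s).perm v) = s.1.perm (bl lam v) := bl_blkFun s v

@[simp] theorem ps_blk (s : Gam lam) (v : Fin n) : ps lam ((blk s).perm v)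
    = flp (s.1.sgn (bl lam v)) (part lam (bl lam v)) (ps lam v) := ps_blkFun s v

/-- The realization on `ℝⁿ` of the size-preserving signed permutations of the blocks. -/
def bO : Gam lam →* O n := toO.comp blk

theorem bO_apply (s : Gam lam) : bO s = toO (blk s) := rfl

theorem exists_bl_eq (i : Fin (len lam)) : ∃ v : Fin n, bl lam v = i :=
  ⟨pt lam i 0 (part_pos lam i), bl_pt _ _ _⟩

theorem blk_injective : Function.Injective (blk : Gam lam →* SP (Fin n)) := by
  refine (injective_iff_map_eq_one _).2 fun s hs => Subtype.ext (SP.ext_iff'.2 fun i => ?_)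
  obtain ⟨v, rfl⟩ := exists_bl_eq i
  rw [← bl_blk, ← blk_sgn, hs]
  simp

theorem bO_injective : Function.Injective (bO : Gam lam →* O n) :=
  toO_injective.comp blk_injective

variable (lam) in
/-- The character of `Gam` whose kernel corresponds to `W(D_n)`. -/
def chi : Gam lam →* ℤˣ := detSgn.comp blk

theorem chi_eq (s : Gam lam) : chi lam s = ∏ i, s.1.sgn i ^ part lam i := by
  change ∏ v, s.1.sgn (bl lam v) = _
  rw [← Finset.prod_fiberwise (s := Finset.univ) (g := bl lam)]
  refine Finset.prod_congr rfl fun i _ => ?_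
  rw [Finset.prod_congr rfl (g := fun _ => s.1.sgn i)
    fun v hv => by rw [(Finset.mem_filter.1 hv).2], Finset.prod_const, card_block]

theorem bO_mem_WD {s : Gam lam} : bO s ∈ WD n ↔ chi lam s = 1 := toO_mem_WD

/-- The normalized sum of the basis vectors of a block. -/
def bvec (i : Fin (len lam)) : E n :=
  WithLp.toLp 2 fun v => if bl lam v = i then (√(part lam i))⁻¹ else 0

theorem bvec_apply (i : Fin (len lam)) (v : Fin n) :
    bvec i v = if bl lam v = i then (√(part lam i))⁻¹ else 0 := rfl

theorem toO_apply_coord (s : SP (Fin n)) (w : E n) (v : Fin n) :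
    toO s w (s.perm v) = ((s.sgn v : ℤ) : ℝ) * w v := by
  rw [toO_apply, signedPerm_apply, Equiv.symm_apply_apply]

theorem acts_bO (s : Gam lam) : Acts (bO s) bvec s.1 := by
  intro i
  ext w
  obtain ⟨v, rfl⟩ := (blk s).perm.surjective w
  rw [bO_apply, toO_apply_coord, blk_sgn, PiLp.smul_apply, bvec_apply, bvec_apply, bl_blk,
    part_perm s, smul_eq_mul]
  by_cases h : bl lam v = i
  · rw [if_pos h, if_pos (by rw [h]), h]
  · rw [if_neg h, if_neg fun h' => h (s.1.perm.injective h')]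
    simp

theorem orthonormal_bvec : Orthonormal ℝ (bvec : Fin (len lam) → E n) := by
  rw [orthonormal_iff_ite]
  intro i j
  rw [PiLp.inner_apply]
  simp only [bvec_apply]
  split_ifs with h
  · subst h
    have h1 : ∀ v : Fin n, ⟪if bl lam v = i then (√(part lam i))⁻¹ else 0,
        if bl lam v = i then (√(part lam i))⁻¹ else 0⟫_ℝ
        = if bl lam v = i then (part lam i : ℝ)⁻¹ else 0 := by
      intro v
      split_ifs
      · simp only [RCLike.inner_apply, conj_trivial]
        rw [← mul_inv, Real.mul_self_sqrt (by positivity)]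
      · simp
    rw [Finset.sum_congr rfl fun v _ => h1 v, ← Finset.sum_filter, Finset.sum_const, card_block,
      nsmul_eq_mul, mul_inv_cancel₀ (by have := part_pos lam i; positivity)]
  · refine Finset.sum_eq_zero fun v _ => ?_
    by_cases h1 : bl lam v = i
    · rw [if_neg (c := bl lam v = j) (by rw [h1]; exact h)]
      simp
    · simp [h1]

/-! ### Generators of the group of signed permutations of the blocks -/

variable (lam) in
/-- The exchange of two blocks of the same size. -/
def sw (i j : Fin (len lam)) (h : part lam i = part lam j) : Gam lam :=
  ⟨SP.ofPerm (Equiv.swap i j), fun k => by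
    rw [SP.ofPerm_perm, Equiv.swap_apply_def]
    split_ifs with h1 h2
    · rw [h1, h]
    · rw [h2, h]
    · rfl⟩

variable (lam) in
/-- Changes of signs of blocks. -/
def ngs : (Fin (len lam) → ℤˣ) →* Gam lam where
  toFun ε := ⟨SP.ofSign ε, fun _ => rfl⟩
  map_one' := rfl
  map_mul' _ _ := Subtype.ext (map_mul _ _ _)

variable (lam) in
/-- The change of sign of a block. -/
def ng (i : Fin (len lam)) : Gam lam := ngs lam (Pi.mulSingle i (-1))

theorem coe_sw (i j : Fin (len lam)) (h : part lam i = part lam j) :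
    (sw lam i j h : SP (Fin (len lam))) = SP.ofPerm (Equiv.swap i j) := rfl

theorem coe_ngs (ε : Fin (len lam) → ℤˣ) :
    (ngs lam ε : SP (Fin (len lam))) = SP.ofSign ε := rfl

@[simp] theorem sw_perm (i j : Fin (len lam)) (h : part lam i = part lam j) :
    (sw lam i j h).1.perm = Equiv.swap i j := rfl
@[simp] theorem sw_sgn (i j : Fin (len lam)) (h : part lam i = part lam j) (k) :
    (sw lam i j h).1.sgn k = 1 := rfl
@[simp] theorem ngs_perm (ε : Fin (len lam) → ℤˣ) : (ngs lam ε).1.perm = 1 := rfl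
@[simp] theorem ngs_sgn (ε : Fin (len lam) → ℤˣ) (k) : (ngs lam ε).1.sgn k = ε k := rfl
@[simp] theorem ng_perm (i : Fin (len lam)) : (ng lam i).1.perm = 1 := rfl
theorem ng_sgn (i k : Fin (len lam)) : (ng lam i).1.sgn k = if k = i then -1 else 1 := by
  rw [ng, ngs_sgn, Pi.mulSingle_apply]

theorem ng_mul_self (i : Fin (len lam)) : ng lam i * ng lam i = 1 := by
  rw [ng, ← map_mul, ← Pi.mulSingle_mul]
  simp

theorem ng_comm (i j : Fin (len lam)) : ng lam i * ng lam j = ng lam j * ng lam i := by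
  rw [ng, ng, ← map_mul, ← map_mul, mul_comm]

theorem chi_ng (i : Fin (len lam)) : chi lam (ng lam i) = (-1) ^ part lam i := by
  rw [chi_eq, Finset.prod_eq_single i]
  · simp [ng_sgn]
  · intro j _ h
    simp [ng_sgn, h]
  · simp

theorem chi_sw (i j : Fin (len lam)) (h) : chi lam (sw lam i j h) = 1 := by
  rw [chi_eq]
  simp

theorem blockSwap_apply {n u k : ℕ} (h : u + 2 * k ≤ n) (v : Fin n) :
    (blockSwap n u k v : ℕ) = if u ≤ v ∧ (v : ℕ) < u + k then (v : ℕ) + k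
      else if u + k ≤ v ∧ (v : ℕ) < u + 2 * k then v - k else v := by
  rw [blockSwap, dif_pos h]
  rfl

theorem blockRev_apply {n u k : ℕ} (h : u + k ≤ n) (v : Fin n) :
    (blockRev n u k v : ℕ) = if u ≤ v ∧ (v : ℕ) < u + k then 2 * u + k - 1 - v else v := by
  rw [blockRev, dif_pos h]
  rfl

theorem x_eq (i : ℕ) (h : i + 1 < len lam) (hp : part lam i = part lam (i + 1)) :
    x lam i = bO (sw lam ⟨i, by omega⟩ ⟨i + 1, h⟩ hp) := by
  rw [bO_apply, toO_apply, x]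
  congr 1
  ext v
  have hn : offset lam i + 2 * part lam i ≤ n := by
    have := offset_add_part_le (lam := lam) h
    rw [offset_len, offset_succ] at this
    omega
  rw [blockSwap_apply hn, val_eq lam ((blk _).perm v), bl_blk, ps_blk, sw_perm, sw_sgn, flp_one]
  have h1 := inBlock_iff (lam := lam) (i := i) (v := v)
  have h2 := inBlock_iff (lam := lam) (i := i + 1) (v := v)
  unfold InBlock at h1 h2
  rw [offset_succ, ← hp] at h2
  have h3 := val_eq lam v
  by_cases c1 : (bl lam v : ℕ) = i
  · rw [if_pos (h1.2 c1), show bl lam v = ⟨i, by omega⟩ from Fin.ext c1, Equiv.swap_apply_left,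
      offset_succ, h3, c1]
    omega
  · by_cases c2 : (bl lam v : ℕ) = i + 1
    · rw [if_neg (h1.not.2 c1), if_pos (by have := h2.2 c2; omega),
        show bl lam v = ⟨i + 1, by omega⟩ from Fin.ext c2, Equiv.swap_apply_right, h3, c2,
        offset_succ]
      dsimp only
      omega
    · rw [if_neg (h1.not.2 c1), if_neg (by have := h2.not.2 c2; omega),
        Equiv.swap_apply_of_ne_of_ne (by simpa [Fin.ext_iff] using c1)
          (by simpa [Fin.ext_iff] using c2), h3]

theorem y_eq (i : ℕ) (h : i < len lam) : y lam i = bO (ng lam ⟨i, h⟩) := by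
  rw [bO_apply, toO_apply, y]
  have hn : offset lam i + part lam i ≤ n := by
    have := offset_add_part_le (lam := lam) h
    rwa [offset_len] at this
  congr 1
  · ext v
    rw [blockRev_apply hn, val_eq lam ((blk _).perm v), bl_blk, ps_blk, ng_perm, ng_sgn]
    have h1 := inBlock_iff (lam := lam) (i := i) (v := v)
    unfold InBlock at h1
    have h3 := val_eq lam v
    have h4 := ps_lt lam v
    by_cases c1 : (bl lam v : ℕ) = i
    · rw [if_pos (h1.2 c1), if_pos (Fin.ext c1)]
      rw [c1] at h3 h4
      simp only [flp, Equiv.Perm.one_apply, c1]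
      rw [if_neg (by decide)]
      omega
    · rw [if_neg (h1.not.2 c1), if_neg (by simpa [Fin.ext_iff] using c1)]
      exact h3
  · funext v
    rw [blk_sgn, ng_sgn]
    simp only [inBlock_iff, Fin.ext_iff]

end Blocks

/-! ### Subgroups of the group of signed permutations of the blocks -/

section Subgroups
variable {n : ℕ} {lam : n.Partition}

variable (lam) in
/-- The elements of `Gam` that are trivial on the blocks whose size does not satisfy `p`. -/
def Gsub (p : ℕ → Prop) : Subgroup (Gam lam) where
  carrier := {s | ∀ i : Fin (len lam), ¬ p (part lam i) → s.1.perm i = i ∧ s.1.sgn i = 1}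
  mul_mem' {s t} hs ht i hi := by simp [hs i hi, ht i hi]
  one_mem' i _ := by simp
  inv_mem' {s} hs i hi := by
    have h : s.1.perm⁻¹ i = i := Equiv.Perm.inv_eq_iff_eq.2 (hs i hi).1.symm
    simp [h, hs i hi]

variable (lam) in
/-- The elements of `Gam` that belong to `W(D_n)` and are trivial on the blocks whose size does
not satisfy `p`. -/
def KS (p : ℕ → Prop) : Subgroup (Gam lam) := Gsub lam p ⊓ (chi lam).ker

variable (lam) in
/-- The permutations of the blocks of size `2`. -/
def Bsub : Subgroup (Gam lam) where
  carrier := {s | s ∈ Gsub lam (· = 2) ∧ ∀ i, s.1.sgn i = 1}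
  mul_mem' {s t} hs ht := ⟨mul_mem hs.1 ht.1, fun i => by simp [hs.2, ht.2]⟩
  one_mem' := ⟨one_mem _, fun i => by simp⟩
  inv_mem' {s} hs := ⟨inv_mem hs.1, fun i => by simp [hs.2]⟩

variable (lam) in
/-- The signed permutations of the blocks of size `1` and the changes of signs of the blocks of
size `2` that belong to `W(D_n)`. -/
def Qsub : Subgroup (Gam lam) where
  carrier := {s | chi lam s = 1 ∧ ∀ i : Fin (len lam), (part lam i ≠ 1 → s.1.perm i = i) ∧
    (2 < part lam i → s.1.sgn i = 1)}
  mul_mem' {s t} hs ht := ⟨by rw [map_mul, hs.1, ht.1, one_mul], fun i =>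
    ⟨fun h => by simp [(hs.2 i).1 h, (ht.2 i).1 h],
      fun h => by simp [(hs.2 i).2 h, (ht.2 i).1 (by omega), (ht.2 i).2 h]⟩⟩
  one_mem' := ⟨map_one _, fun i => by simp⟩
  inv_mem' {s} hs := by
    have h : ∀ i : Fin (len lam), part lam i ≠ 1 → s.1.perm⁻¹ i = i := fun i hi =>
      Equiv.Perm.inv_eq_iff_eq.2 ((hs.2 i).1 hi).symm
    exact ⟨by rw [map_inv, hs.1, inv_one], fun i => ⟨h i, fun h' => by
      simp [h i (by omega), (hs.2 i).2 h']⟩⟩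

variable (lam) in
/-- The elements of `Gam` in `W(D_n)` that do not change the signs of the blocks of size `2`, fix
the blocks of size `1`, and change at most the sign of the last of these. -/
def Dsub : Subgroup (Gam lam) where
  carrier := {s | chi lam s = 1 ∧ ∀ i : Fin (len lam), (part lam i = 2 → s.1.sgn i = 1) ∧
    (part lam i = 1 → s.1.perm i = i ∧ ((i : ℕ) + 1 < len lam → s.1.sgn i = 1))}
  mul_mem' {s t} hs ht := ⟨by rw [map_mul, hs.1, ht.1, one_mul], fun i =>
    ⟨fun h => by simp [(hs.2 (t.1.perm i)).1 (by rw [part_perm, h]), (ht.2 i).1 h],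
      fun h => ⟨by simp [((hs.2 i).2 h).1, ((ht.2 i).2 h).1],
        fun h' => by simp [((hs.2 i).2 h).2 h', ((ht.2 i).2 h).1, ((ht.2 i).2 h).2 h']⟩⟩⟩
  one_mem' := ⟨map_one _, fun i => by simp⟩
  inv_mem' {s} hs := by
    have h : ∀ i : Fin (len lam), part lam i = 1 → s.1.perm⁻¹ i = i := fun i hi =>
      Equiv.Perm.inv_eq_iff_eq.2 ((hs.2 i).2 hi).1.symm
    refine ⟨by rw [map_inv, hs.1, inv_one], fun i =>
      ⟨fun h' => ?_, fun h' => ⟨h i h', fun h'' => ?_⟩⟩⟩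
    · simpa using (hs.2 (s.1.perm⁻¹ i)).1 (by
        rw [← h']; exact part_perm s⁻¹ i)
    · simp [h i h', ((hs.2 i).2 h').2 h'']

theorem mem_Gsub {p : ℕ → Prop} {s : Gam lam} : s ∈ Gsub lam p ↔
    ∀ i : Fin (len lam), ¬ p (part lam i) → s.1.perm i = i ∧ s.1.sgn i = 1 := Iff.rfl

theorem mem_Qsub {s : Gam lam} : s ∈ Qsub lam ↔ chi lam s = 1 ∧
    ∀ i : Fin (len lam), (part lam i ≠ 1 → s.1.perm i = i) ∧ (2 < part lam i → s.1.sgn i = 1) :=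
  Iff.rfl

theorem Gam.eq_one {s : Gam lam} (h : ∀ i, s.1.perm i = i ∧ s.1.sgn i = 1) : s = 1 :=
  Subtype.ext (SP.ext_iff'.2 fun i => by simpa using h i)

theorem Gsub_mono {p q : ℕ → Prop} (h : ∀ k, p k → q k) : Gsub lam p ≤ Gsub lam q :=
  fun _ hs i hi => hs i (mt (h _) hi)

theorem Gsub_congr {p q : ℕ → Prop} (h : ∀ i : Fin (len lam), p (part lam i) ↔ q (part lam i)) :
    Gsub lam p = Gsub lam q := by
  ext s
  simp only [mem_Gsub, h]

theorem Gam.conj_apply (g s : Gam lam) (i : Fin (len lam))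
    (h : s.1.perm (g.1.perm⁻¹ i) = g.1.perm⁻¹ i) (h' : s.1.sgn (g.1.perm⁻¹ i) = 1) :
    (g * s * g⁻¹).1.perm i = i ∧ (g * s * g⁻¹).1.sgn i = 1 := by
  have h1 : g.1.perm (g.1.perm⁻¹ i) = i := g.1.perm.apply_symm_apply i
  constructor
  · change g.1.perm (s.1.perm (g.1.perm⁻¹ i)) = i
    rw [h, h1]
  · change g.1.sgn (s.1.perm (g.1.perm⁻¹ i)) * s.1.sgn (g.1.perm⁻¹ i) * g.1.sgn (g.1.perm⁻¹ i) = 1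
    rw [h, h', mul_one, Int.units_mul_self]

instance Gsub_normal (p : ℕ → Prop) : (Gsub lam p).Normal where
  conj_mem s hs g i hi := by
    have h := hs (g.1.perm⁻¹ i) (by rwa [show part lam (g.1.perm⁻¹ i) = part lam i from
      part_perm g⁻¹ i])
    exact Gam.conj_apply g s i h.1 h.2

instance KS_normal (p : ℕ → Prop) : (KS lam p).Normal := by unfold KS; infer_instance

theorem Gam.commute {p : ℕ → Prop} {s t : Gam lam} (hs : s ∈ Gsub lam p)
    (ht : t ∈ Gsub lam fun k => ¬ p k) : s * t = t * s :=
  Subtype.ext (SP.commute_of_disjoint (fun i => ¬ p (part lam i)) hs ht)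

theorem chi_eq_one_of_even {s : Gam lam} (hs : s ∈ Gsub lam Even) : chi lam s = 1 := by
  rw [chi_eq]
  refine Finset.prod_eq_one fun i _ => ?_
  by_cases h : Even (part lam i)
  · obtain ⟨k, hk⟩ := h
    rw [hk, ← two_mul, pow_mul, Int.units_sq, one_pow]
  · rw [(hs i h).2, one_pow]

theorem chi_eq_one_of_sgn {s : Gam lam} (hs : ∀ i, s.1.sgn i = 1) : chi lam s = 1 := by
  rw [chi_eq]
  exact Finset.prod_eq_one fun i _ => by rw [hs, one_pow]

open Classical in
/-- The restriction of a signed permutation of the blocks to the blocks whose size satisfies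
`p`. -/
def restr (p : ℕ → Prop) (s : Gam lam) : Gam lam where
  val :=
    { perm :=
        { toFun := fun i => if p (part lam i) then s.1.perm i else i
          invFun := fun i => if p (part lam i) then s.1.perm⁻¹ i else i
          left_inv := fun i => by
            by_cases h : p (part lam i)
            · simp [h, part_perm]
            · simp [h]
          right_inv := fun i => by
            have h' : part lam (s.1.perm⁻¹ i) = part lam i := part_perm s⁻¹ i
            by_cases h : p (part lam i)
            · simp only [h, if_true, h']
              exact s.1.perm.apply_symm_apply i
            · simp [h] }
      sgn := fun i => if p (part lam i) then s.1.sgn i else 1 }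
  property i := by
    by_cases h : p (part lam i)
    · simp [h, part_perm]
    · simp [h]

theorem restr_pos {p : ℕ → Prop} (s : Gam lam) {i : Fin (len lam)} (h : p (part lam i)) :
    (restr p s).1.perm i = s.1.perm i ∧ (restr p s).1.sgn i = s.1.sgn i := by
  simp [restr, h]

theorem restr_neg {p : ℕ → Prop} (s : Gam lam) {i : Fin (len lam)} (h : ¬ p (part lam i)) :
    (restr p s).1.perm i = i ∧ (restr p s).1.sgn i = 1 := by
  simp [restr, h]

theorem restr_mem (p : ℕ → Prop) (s : Gam lam) : restr p s ∈ Gsub lam p :=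
  fun _ h => restr_neg s h

theorem restr_mul_restr (p : ℕ → Prop) (s : Gam lam) :
    restr p s * restr (fun k => ¬ p k) s = s := by
  refine Subtype.ext (SP.ext_iff'.2 fun i => ?_)
  by_cases h : p (part lam i)
  · have h1 := restr_neg (p := fun k => ¬ p k) s (i := i) (not_not.2 h)
    simp [h1, restr_pos s h]
  · have h1 := restr_pos (p := fun k => ¬ p k) s (i := i) h
    have h2 := restr_neg (p := p) s (i := s.1.perm i) (by rwa [part_perm])
    simp [h1, h2]

/-! ### Generation -/

theorem ngs_mem {C : Subgroup (Gam lam)} {ε : Fin (len lam) → ℤˣ}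
    (h : ∀ i, ε i ≠ 1 → ng lam i ∈ C) : ngs lam ε ∈ C := by
  change ε ∈ C.comap (ngs lam)
  rw [← Finset.univ_prod_mulSingle ε]
  refine Subgroup.prod_mem _ fun i _ => ?_
  rcases Int.units_eq_one_or (ε i) with h1 | h1
  · rw [h1, Pi.mulSingle_one]
    exact one_mem _
  · rw [h1]
    exact h i (by rw [h1]; decide)

theorem sw_comm (i j : Fin (len lam)) (h : part lam i = part lam j) :
    sw lam i j h = sw lam j i h.symm :=
  Subtype.ext (by rw [coe_sw, coe_sw, Equiv.swap_comm])

/-- The parts are weakly decreasing, so between two blocks of the same size all blocks have that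
size. -/
theorem part_eq_of_between {i j k : ℕ} (hij : i ≤ j) (hjk : j ≤ k) (h : part lam i = part lam k) :
    part lam i = part lam j :=
  le_antisymm (h.le.trans (part_anti lam hjk)) (part_anti lam hij)

theorem sw_mem {C : Subgroup (Gam lam)} {p : ℕ → Prop}
    (hx : ∀ (i : ℕ) (hi : i + 1 < len lam) (hp : part lam i = part lam (i + 1)), p (part lam i) →
      sw lam ⟨i, by omega⟩ ⟨i + 1, hi⟩ hp ∈ C)
    (i j : Fin (len lam)) (h : part lam i = part lam j) (hp : p (part lam i)) :
    sw lam i j h ∈ C := by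
  -- induction on the distance of the blocks, by `(i j) = (k j) (i k) (k j)` for `k = j - 1`
  have key : ∀ (d : ℕ) (i j : Fin (len lam)) (h : part lam i = part lam j), (j : ℕ) = i + d →
      p (part lam i) → sw lam i j h ∈ C := by
    intro d
    induction d with
    | zero =>
      intro i j h hd _
      obtain rfl : i = j := Fin.ext hd.symm
      have : sw lam i i h = 1 := Subtype.ext (by rw [coe_sw, Equiv.swap_self]; rfl)
      rw [this]
      exact one_mem _
    | succ d ih =>
      intro i j h hd hp
      let k : Fin (len lam) := ⟨i + d, by omega⟩
      have hk : part lam i = part lam k := part_eq_of_between (by simp [k]) (by simp [k]; omega) h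
      have h1 := ih i k hk rfl hp
      have h2 : sw lam k j (hk.symm.trans h) ∈ C := by
        have := hx k (by simp [k]; omega) (by
          rw [← hk, h, hd]; simp [k, add_assoc]) (by rwa [← hk])
        convert this
        simp [k, hd, add_assoc]
      by_cases hd0 : d = 0
      · have : k = i := Fin.ext (by simp [k, hd0])
        convert h2
        exact this.symm
      · have h3 : sw lam i j h = sw lam k j (hk.symm.trans h) * sw lam i k hk *
            sw lam k j (hk.symm.trans h) := Subtype.ext (by
          have hik : i ≠ k := fun e => hd0 (by have := congrArg Fin.val e; simp [k] at this; omega)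
          have hij : i ≠ j := fun e => by have := congrArg Fin.val e; omega
          simp only [Subgroup.coe_mul, coe_sw, ← map_mul]
          rw [Equiv.swap_mul_swap_mul_swap hik hij, Equiv.swap_comm])
        rw [h3]
        exact mul_mem (mul_mem h2 h1) h2
  rcases le_total i j with hij | hij
  · exact key (j - i) i j h (by have := Fin.le_def.1 hij; omega) hp
  · rw [sw_comm]
    exact key (i - j) j i h.symm (by have := Fin.le_def.1 hij; omega) (h ▸ hp)

/-- The permutations of blocks of equal size are generated by the exchanges of adjacent blocks of
equal size. -/
theorem mem_of_sgn_eq_one {C : Subgroup (Gam lam)} {p : ℕ → Prop}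
    (hx : ∀ (i : ℕ) (hi : i + 1 < len lam) (hp : part lam i = part lam (i + 1)), p (part lam i) →
      sw lam ⟨i, by omega⟩ ⟨i + 1, hi⟩ hp ∈ C)
    {s : Gam lam} (hs : s ∈ Gsub lam p) (hs' : ∀ i, s.1.sgn i = 1) : s ∈ C := by
  let S : Set (Equiv.Perm (Fin (len lam))) :=
    {σ | ∃ i j : Fin (len lam), i ≠ j ∧ part lam i = part lam j ∧ p (part lam i) ∧
      σ = Equiv.swap i j}
  have h1 : s.1.perm ∈ Subgroup.closure S := by
    rw [mem_closure_isSwap (by rintro _ ⟨i, j, h, -, -, rfl⟩; exact ⟨i, j, h, rfl⟩)]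
    refine ⟨Set.toFinite _, fun i => ?_⟩
    by_cases h : s.1.perm i = i
    · rw [h]
      exact MulAction.mem_orbit_self i
    · refine MulAction.mem_orbit_iff.2 ⟨⟨Equiv.swap i (s.1.perm i), Subgroup.subset_closure
        ⟨i, _, Ne.symm h, (part_perm s i).symm, ?_, rfl⟩⟩, Equiv.swap_apply_left _ _⟩
      by_contra hp
      exact h (hs i hp).1
  have h2 : ∀ σ ∈ Subgroup.closure S, ∃ h : ∀ i, part lam (σ i) = part lam i,
      (⟨SP.ofPerm σ, h⟩ : Gam lam) ∈ C := by
    intro σ hσ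
    induction hσ using Subgroup.closure_induction with
    | mem σ hσ =>
      obtain ⟨i, j, hij, h, hp, rfl⟩ := hσ
      exact ⟨(sw lam i j h).2, sw_mem hx i j h hp⟩
    | one => exact ⟨fun _ => rfl, one_mem C⟩
    | mul σ τ _ _ hσ hτ =>
      obtain ⟨h, hσ⟩ := hσ
      obtain ⟨h', hτ⟩ := hτ
      refine ⟨fun i => (h _).trans (h' i), ?_⟩
      convert mul_mem hσ hτ using 1
      exact Subtype.ext (map_mul SP.ofPerm σ τ)
    | inv σ _ hσ =>
      obtain ⟨h, hσ⟩ := hσ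
      exact ⟨((⟨SP.ofPerm σ, h⟩ : Gam lam)⁻¹).2, inv_mem hσ⟩
  obtain ⟨h, h3⟩ := h2 _ h1
  convert h3
  exact Subtype.ext (SP.ext_iff'.2 fun i => by simp [hs'])

/-- The elements of `Gam` in `W(D_n)` that are trivial on the blocks whose size does not satisfy
`p` are generated by exchanges of adjacent blocks of equal size, changes of sign of a block of
even size, and changes of sign of two blocks of odd sizes. A family of signs is reduced to these by
comparing each block of odd size with a fixed one. -/
theorem KS_le {C : Subgroup (Gam lam)} {p : ℕ → Prop}
    (hx : ∀ (i : ℕ) (hi : i + 1 < len lam) (hp : part lam i = part lam (i + 1)), p (part lam i) →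
      sw lam ⟨i, by omega⟩ ⟨i + 1, hi⟩ hp ∈ C)
    (hy : ∀ i : Fin (len lam), p (part lam i) → Even (part lam i) → ng lam i ∈ C)
    (hy' : ∀ (i : ℕ) (hi : i + 1 < len lam) (hp : part lam i = part lam (i + 1)), p (part lam i) →
      Odd (part lam i) →
      sw lam ⟨i, by omega⟩ ⟨i + 1, hi⟩ hp * ng lam ⟨i, by omega⟩ * ng lam ⟨i + 1, hi⟩ ∈ C)
    (hz : ∀ i j : Fin (len lam), part lam j < part lam i → p (part lam i) → p (part lam j) →
      Odd (part lam i) → Odd (part lam j) → ng lam i * ng lam j ∈ C) :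
    KS lam p ≤ C := by
  -- two blocks of the same odd size, by induction on their distance: for adjacent blocks the pair
  -- of signs is `x_i⁻¹ y'_i`, and a pair `i, j` is the product of `i, j - 1` and `j - 1, j`
  have h1 : ∀ (d : ℕ) (i j : Fin (len lam)), part lam i = part lam j → (j : ℕ) = i + d →
      p (part lam i) → Odd (part lam i) → ng lam i * ng lam j ∈ C := by
    intro d
    induction d with
    | zero =>
      intro i j h hd _ _
      obtain rfl : i = j := Fin.ext hd.symm
      rw [ng_mul_self]
      exact one_mem _
    | succ d ih =>
      intro i j h hd hp ho
      let k : Fin (len lam) := ⟨i + d, by omega⟩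
      have hk : part lam i = part lam k := part_eq_of_between (by simp [k]) (by simp [k]; omega) h
      have hk1 : part lam k = part lam (k + 1) := by rw [← hk, h, hd]; simp [k, add_assoc]
      have hj : j = ⟨k + 1, by simp [k]; omega⟩ := Fin.ext (by simp [k]; omega)
      have h2 := hy' k (by simp [k]; omega) hk1 (by rwa [← hk]) (by rwa [← hk])
      rw [mul_assoc] at h2
      have h3 := (mul_mem_cancel_left (hx k (by simp [k]; omega) hk1 (by rwa [← hk]))).1 h2
      have h4 := mul_mem (ih i k hk rfl hp ho) h3
      rw [mul_assoc, ← mul_assoc (ng lam k), show (⟨(k : ℕ), _⟩ : Fin (len lam)) = k from rfl,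
        ng_mul_self, one_mul, ← hj] at h4
      exact h4
  have h2 : ∀ i j : Fin (len lam), p (part lam i) → p (part lam j) →
      Odd (part lam i) → Odd (part lam j) → ng lam i * ng lam j ∈ C := by
    intro i j hi hj oi oj
    rcases lt_trichotomy (part lam i) (part lam j) with h | h | h
    · rw [ng_comm]
      exact hz j i h hj hi oj oi
    · rcases le_total i j with hij | hij
      · exact h1 (j - i) i j h (by have := Fin.le_def.1 hij; omega) hi oi
      · rw [ng_comm]
        exact h1 (i - j) j i h.symm (by have := Fin.le_def.1 hij; omega) hj oj
    · exact hz i j h hi hj oi oj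
  intro s hs
  obtain ⟨hs, hchi⟩ := hs
  -- `t` is the sign part of `s`, and `s t⁻¹` is a permutation without signs
  let t : Gam lam := ngs lam s.1.sgn
  have h3 : s * t⁻¹ ∈ C := by
    refine mem_of_sgn_eq_one hx (s := s * t⁻¹) (p := p) (fun i hi => ?_) fun i => ?_
    · have h := hs i hi
      simp [t, h]
    · simp [t]
  have h4 : t ∈ C := by
    by_cases ho : ∃ i : Fin (len lam), p (part lam i) ∧ Odd (part lam i)
    · obtain ⟨i₀, hp₀, ho₀⟩ := ho
      -- fix a block `i₀` of odd size: each sign at a block `i` of odd size is paired with a sign at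
      -- `i₀`, and the signs at `i₀` cancel because `chi s = 1`
      have h5 : s.1.sgn = ∏ i, (Pi.mulSingle i (s.1.sgn i) *
          Pi.mulSingle i₀ (s.1.sgn i ^ part lam i)) := by
        have h6 : ∏ i : Fin (len lam), (Pi.mulSingle i₀ (s.1.sgn i ^ part lam i) :
            Fin (len lam) → ℤˣ) = Pi.mulSingle i₀ (∏ i, s.1.sgn i ^ part lam i) :=
          (map_prod (MonoidHom.mulSingle (fun _ => ℤˣ) i₀) _ _).symm
        rw [Finset.prod_mul_distrib, Finset.univ_prod_mulSingle, h6, ← chi_eq,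
          show chi lam s = 1 from hchi, Pi.mulSingle_one, mul_one]
      change s.1.sgn ∈ C.comap (ngs lam)
      rw [h5]
      refine Subgroup.prod_mem _ fun i _ => ?_
      rcases Int.units_eq_one_or (s.1.sgn i) with h7 | h7
      · simp [h7]
      · rw [h7, Subgroup.mem_comap]
        have hpi : p (part lam i) := by
          by_contra hpi
          rw [(hs i hpi).2] at h7
          exact absurd h7 (by decide)
        rcases Nat.even_or_odd (part lam i) with h8 | h8
        · rw [h8.neg_one_pow, Pi.mulSingle_one, mul_one]
          exact hy i hpi h8
        · rw [h8.neg_one_pow, map_mul]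
          exact h2 i i₀ hpi hp₀ h8 ho₀
    · push Not at ho
      refine ngs_mem fun i hi => ?_
      have hpi : p (part lam i) := by
        by_contra hpi
        exact hi (hs i hpi).2
      exact hy i hpi (Nat.not_odd_iff_even.1 (ho i hpi))
  simpa using mul_mem h3 h4

theorem sw_mem_Gsub {p : ℕ → Prop} (i j : Fin (len lam)) (h : part lam i = part lam j)
    (hp : p (part lam i)) : sw lam i j h ∈ Gsub lam p := fun k hk =>
  ⟨Equiv.swap_apply_of_ne_of_ne (by rintro rfl; exact hk hp) (by rintro rfl; exact hk (h ▸ hp)),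
    rfl⟩

theorem ng_mem_Gsub {p : ℕ → Prop} (i : Fin (len lam)) (hp : p (part lam i)) :
    ng lam i ∈ Gsub lam p := fun k hk =>
  ⟨rfl, by rw [ng_sgn, if_neg (by rintro rfl; exact hk hp)]⟩

theorem sw_mem_KS {p : ℕ → Prop} (i j : Fin (len lam)) (h : part lam i = part lam j)
    (hp : p (part lam i)) : sw lam i j h ∈ KS lam p := ⟨sw_mem_Gsub i j h hp, chi_sw i j h⟩

theorem ng_mem_KS {p : ℕ → Prop} (i : Fin (len lam)) (hp : p (part lam i))
    (h : Even (part lam i)) : ng lam i ∈ KS lam p :=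
  ⟨ng_mem_Gsub i hp, (chi_ng i).trans h.neg_one_pow⟩

theorem ng_mul_ng_mem_KS {p : ℕ → Prop} (i j : Fin (len lam)) (hp : p (part lam i))
    (hq : p (part lam j)) (h : Odd (part lam i)) (h' : Odd (part lam j)) :
    ng lam i * ng lam j ∈ KS lam p :=
  ⟨mul_mem (ng_mem_Gsub i hp) (ng_mem_Gsub j hq), by
    change chi lam _ = 1
    rw [map_mul, chi_ng, chi_ng, h.neg_one_pow, h'.neg_one_pow]; rfl⟩

/-! ### The generators as isometries -/

theorem y'_eq (i : ℕ) (h : i + 1 < len lam) (hp : part lam i = part lam (i + 1)) :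
    y' lam i = bO (sw lam ⟨i, by omega⟩ ⟨i + 1, h⟩ hp * ng lam ⟨i, by omega⟩ *
      ng lam ⟨i + 1, h⟩) := by
  rw [y', x_eq i h hp, y_eq i (by omega), y_eq (i + 1) h, map_mul, map_mul]

theorem z'_eq (i j : ℕ) (hi : i < len lam) (hj : j < len lam) :
    z' lam i j = bO (ng lam ⟨i, hi⟩ * ng lam ⟨j, hj⟩) := by
  rw [z', y_eq i hi, y_eq j hj, map_mul]

theorem lt_len_of_pos {i : ℕ} (h : 0 < part lam i) : i < len lam := (part_pos_iff lam).1 h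

theorem x_mem_KS {p : ℕ → Prop} {i : ℕ} (h : part lam i = part lam (i + 1)) (h0 : 0 < part lam i)
    (hp : p (part lam i)) : x lam i ∈ (KS lam p).map bO := by
  rw [x_eq i (lt_len_of_pos (h ▸ h0)) h]
  exact Subgroup.mem_map_of_mem _ (sw_mem_KS _ _ h hp)

theorem y_mem_KS {p : ℕ → Prop} {i : ℕ} (h0 : 0 < part lam i) (he : Even (part lam i))
    (hp : p (part lam i)) : y lam i ∈ (KS lam p).map bO := by
  rw [y_eq i (lt_len_of_pos h0)]
  exact Subgroup.mem_map_of_mem _ (ng_mem_KS _ hp he)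

theorem y'_mem_KS {p : ℕ → Prop} {i : ℕ} (h : part lam i = part lam (i + 1))
    (h0 : Odd (part lam i)) (hp : p (part lam i)) : y' lam i ∈ (KS lam p).map bO := by
  rw [y'_eq i (lt_len_of_pos (h ▸ h0.pos)) h, mul_assoc]
  exact Subgroup.mem_map_of_mem _ (mul_mem (sw_mem_KS _ _ h hp)
    (ng_mul_ng_mem_KS _ _ hp (by rwa [← h]) h0 (by rwa [← h])))

theorem z'_mem_KS {p : ℕ → Prop} {i j : ℕ} (hi : Odd (part lam i)) (hj : Odd (part lam j))
    (hp : p (part lam i)) (hq : p (part lam j)) : z' lam i j ∈ (KS lam p).map bO := by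
  rw [z'_eq i j (lt_len_of_pos hi.pos) (lt_len_of_pos hj.pos)]
  exact Subgroup.mem_map_of_mem _ (ng_mul_ng_mem_KS _ _ hp hq hi hj)

/-- `KS_le` in terms of the isometries `x_i`, `y_j`, `y'_i`, `z'_{ij}`. -/
theorem map_KS_le {C : Subgroup (O n)} {p : ℕ → Prop}
    (hx : ∀ i, part lam i = part lam (i + 1) → 0 < part lam i → p (part lam i) → x lam i ∈ C)
    (hy : ∀ i, 0 < part lam i → p (part lam i) → Even (part lam i) → y lam i ∈ C)
    (hy' : ∀ i, part lam i = part lam (i + 1) → p (part lam i) → Odd (part lam i) → y' lam i ∈ C)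
    (hz : ∀ i j, part lam j < part lam i → p (part lam i) → p (part lam j) →
      Odd (part lam i) → Odd (part lam j) → z' lam i j ∈ C) :
    (KS lam p).map bO ≤ C := by
  rw [Subgroup.map_le_iff_le_comap]
  apply KS_le
  · intro i hi h hp
    rw [Subgroup.mem_comap, ← x_eq i hi h]
    exact hx i h ((part_pos_iff lam).2 (by omega)) hp
  · intro i hp he
    rw [Subgroup.mem_comap, ← y_eq i i.2]
    exact hy i (part_pos lam i) hp he
  · intro i hi h hp ho
    rw [Subgroup.mem_comap, ← y'_eq i hi h]
    exact hy' i h hp ho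
  · intro i j h hp hq hi hj
    rw [Subgroup.mem_comap, ← z'_eq i j i.2 j.2]
    exact hz i j h hp hq hi hj

theorem closure_howlett_eq : (KS lam fun _ => True).map bO = Subgroup.closure
      ({g | ∃ i, part lam i = part lam (i + 1) ∧ 0 < part lam i ∧ g = x lam i} ∪
       {g | ∃ j, 0 < part lam j ∧ Even (part lam j) ∧ g = y lam j} ∪
       {g | ∃ i, part lam i = part lam (i + 1) ∧ Odd (part lam i) ∧ g = y' lam i} ∪
       {g | ∃ i j, i < j ∧ part lam i ≠ part lam j ∧ Odd (part lam i) ∧ Odd (part lam j) ∧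
          g = z' lam i j}) := by
  apply le_antisymm
  · apply map_KS_le
    · exact fun i h h0 _ => Subgroup.subset_closure (.inl (.inl (.inl ⟨i, h, h0, rfl⟩)))
    · exact fun i h0 _ h => Subgroup.subset_closure (.inl (.inl (.inr ⟨i, h0, h, rfl⟩)))
    · exact fun i h _ h' => Subgroup.subset_closure (.inl (.inr ⟨i, h, h', rfl⟩))
    · refine fun i j h _ _ hi hj => Subgroup.subset_closure (.inr ⟨i, j, ?_, h.ne', hi, hj, rfl⟩)
      by_contra hij
      exact absurd (part_anti lam (not_lt.1 hij)) (by omega)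
  · rw [Subgroup.closure_le]
    rintro _ (((⟨i, h, h0, rfl⟩ | ⟨i, h0, h, rfl⟩) | ⟨i, h, h0, rfl⟩) | ⟨i, j, -, -, hi, hj, rfl⟩)
    · exact x_mem_KS h h0 trivial
    · exact y_mem_KS h0 h trivial
    · exact y'_mem_KS h h0 trivial
    · exact z'_mem_KS hi hj trivial trivial

theorem A0_eq : A0 lam = (KS lam fun k => 2 < k ∧ Even k).map bO := by
  apply le_antisymm
  · rw [A0, Subgroup.closure_le]
    rintro _ (⟨i, h, h0, he, rfl⟩ | ⟨i, h0, he, rfl⟩)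
    · exact x_mem_KS h (by omega) ⟨h0, he⟩
    · exact y_mem_KS (by omega) he ⟨h0, he⟩
  · apply map_KS_le
    · exact fun i h _ hp => Subgroup.subset_closure (.inl ⟨i, h, hp.1, hp.2, rfl⟩)
    · exact fun i _ hp _ => Subgroup.subset_closure (.inr ⟨i, hp.1, hp.2, rfl⟩)
    · exact fun i _ hp h => absurd hp.2 (Nat.not_even_iff_odd.2 h)
    · exact fun i j _ hp _ h => absurd hp.2 (Nat.not_even_iff_odd.2 h)

/-- `A₁`, provided that no two blocks of size at most `2` satisfy the condition on the size. -/
theorem A1_eq {m : ℕ} (hm : m ≤ 2) (h1 : 0 < m ∨ mult lam 1 ≤ 1) :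
    A1 lam m = (KS lam fun k => m < k ∧ Odd k).map bO := by
  have key : ∀ i, part lam i = part lam (i + 1) → m < part lam i → Odd (part lam i) →
      2 < part lam i := by
    intro i h hmi ho
    by_contra hlt
    have h3 : part lam i = 1 := by
      obtain ⟨k, hk⟩ := ho
      omega
    rcases h1 with h1 | h1
    · omega
    rw [mult_eq_card, Fintype.card_le_one_iff] at h1
    have := h1 ⟨⟨i, lt_len_of_pos (by omega)⟩, h3⟩
      ⟨⟨i + 1, lt_len_of_pos (by omega)⟩, h.symm.trans h3⟩
    simp at this
  apply le_antisymm
  · rw [A1, Subgroup.closure_le]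
    rintro _ (⟨i, h, h0, he, rfl | rfl⟩ | ⟨i, j, h, h0, hi, hj, rfl⟩)
    · exact x_mem_KS h (by omega) ⟨by omega, he⟩
    · exact y'_mem_KS h he ⟨by omega, he⟩
    · exact z'_mem_KS hi hj ⟨by omega, hi⟩ ⟨h0, hj⟩
  · apply map_KS_le
    · exact fun i h _ hp => Subgroup.subset_closure (.inl ⟨i, h, key i h hp.1 hp.2, hp.2, .inl rfl⟩)
    · exact fun i _ hp h => absurd h (Nat.not_even_iff_odd.2 hp.2)
    · exact fun i h hp _ => Subgroup.subset_closure (.inl ⟨i, h, key i h hp.1 hp.2, hp.2, .inr rfl⟩)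
    · exact fun i j h hp hq hi hj => Subgroup.subset_closure (.inr ⟨i, j, h, hq.1, hi, hj, rfl⟩)

theorem map_Bsub_eq : (Bsub lam).map bO = Subgroup.closure
      {g | ∃ i, part lam i = part lam (i + 1) ∧ part lam i = 2 ∧ g = x lam i} := by
  apply le_antisymm
  · rw [Subgroup.map_le_iff_le_comap]
    refine fun s hs => mem_of_sgn_eq_one (p := (· = 2)) (fun i hi h hp => ?_) hs.1 hs.2
    rw [Subgroup.mem_comap, ← x_eq i hi h]
    exact Subgroup.subset_closure ⟨i, h, hp, rfl⟩
  · rw [Subgroup.closure_le]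
    rintro _ ⟨i, h, h2, rfl⟩
    rw [x_eq i (lt_len_of_pos (by omega)) h]
    exact Subgroup.mem_map_of_mem _ ⟨sw_mem_Gsub _ _ h h2, fun _ => rfl⟩

theorem map_Qsub_le {C : Subgroup (O n)}
    (hx : ∀ i, part lam i = part lam (i + 1) → part lam i = 1 → x lam i ∈ C)
    (hy' : ∀ i, part lam i = part lam (i + 1) → part lam i = 1 → y' lam i ∈ C)
    (hy : ∀ i, part lam i = 2 → y lam i ∈ C) : (Qsub lam).map bO ≤ C := by
  rw [Subgroup.map_le_iff_le_comap]
  intro s hs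
  -- split off the signs at the blocks of size `2`
  let t : Gam lam := ngs lam fun i => if part lam i = 2 then s.1.sgn i else 1
  have h1 : t ∈ Gsub lam Even := fun i hi => ⟨rfl, if_neg (by rintro h; rw [h] at hi; simp at hi)⟩
  have h2 : t ∈ C.comap bO := by
    refine ngs_mem fun i hi => ?_
    rw [Subgroup.mem_comap, ← y_eq i i.2]
    exact hy i (by by_contra h; simp [h] at hi)
  have h3 : s * t⁻¹ ∈ KS lam (· = 1) := by
    refine ⟨fun i hi => ?_, ?_⟩
    · have := hs.2 i
      simp only [t, Subgroup.coe_mul, Subgroup.coe_inv, coe_ngs, SP.mul_perm, SP.inv_perm,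
        SP.ofSign_perm, inv_one, mul_one, SP.mul_sgn, Equiv.Perm.one_apply, SP.inv_sgn,
        SP.ofSign_sgn]
      refine ⟨this.1 hi, ?_⟩
      split_ifs with h
      · exact Int.units_mul_self _
      · rw [mul_one]
        have := part_pos lam i
        exact (hs.2 i).2 (by omega)
    · change chi lam _ = 1
      rw [map_mul, map_inv, hs.1, chi_eq_one_of_even h1]; rfl
  have h4 : (KS lam (· = 1)).map bO ≤ C := by
    apply map_KS_le
    · exact fun i h _ => hx i h
    · exact fun i _ h h' => by rw [h] at h'; simp at h'
    · exact fun i h h' _ => hy' i h h'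
    · exact fun i j h h1 h2 => by omega
  have h5 := mul_mem (Subgroup.map_le_iff_le_comap.1 h4 h3) h2
  simpa using h5

theorem map_Qsub_eq : (Qsub lam).map bO = Subgroup.closure
        ({g | ∃ i, part lam i = part lam (i + 1) ∧ part lam i = 1 ∧ (g = x lam i ∨ g = y' lam i)} ∪
         {g | ∃ j, part lam j = 2 ∧ g = y lam j}) := by
  have hK : ∀ i (s : Gam lam), s ∈ KS lam (· = 1) → part lam i = 1 → s ∈ Qsub lam := by
    intro i s hs h
    exact ⟨hs.2, fun j => ⟨fun h => (hs.1 j h).1, fun h => (hs.1 j (by omega)).2⟩⟩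
  apply le_antisymm
  · apply map_Qsub_le
    · exact fun i h h' => Subgroup.subset_closure (.inl ⟨i, h, h', .inl rfl⟩)
    · exact fun i h h' => Subgroup.subset_closure (.inl ⟨i, h, h', .inr rfl⟩)
    · exact fun i h => Subgroup.subset_closure (.inr ⟨i, h, rfl⟩)
  · rw [Subgroup.closure_le]
    rintro _ (⟨i, h, h1, rfl | rfl⟩ | ⟨i, h, rfl⟩)
    · exact Subgroup.map_mono (fun s hs => hK i s hs h1) (x_mem_KS h (by omega) h1)
    · exact Subgroup.map_mono (fun s hs => hK i s hs h1) (y'_mem_KS h (by rw [h1]; simp) h1)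
    · rw [y_eq i (lt_len_of_pos (by omega))]
      refine Subgroup.mem_map_of_mem _ ⟨by rw [chi_ng]; simp [h], fun j =>
        ⟨fun _ => rfl, fun h' => ?_⟩⟩
      rw [ng_sgn, if_neg (by rintro rfl; dsimp only at h'; omega)]

end Subgroups

/-! ### Positive systems of reflection subgroups -/

section Positive
variable {n : ℕ}

theorem inv_apply_apply (g : O n) (v : E n) : g⁻¹ (g v) = v := g.symm_apply_apply v

theorem apply_inv_apply (g : O n) (v : E n) : g (g⁻¹ v) = v := g.apply_symm_apply v

theorem inner_inv (g : O n) (v w : E n) : ⟪g⁻¹ v, w⟫_ℝ = ⟪v, g w⟫_ℝ := by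
  rw [← g.inner_map_map, apply_inv_apply]

theorem inner_inv' (g : O n) (v w : E n) : ⟪v, g⁻¹ w⟫_ℝ = ⟪g v, w⟫_ℝ := by
  rw [← g.inner_map_map, apply_inv_apply]

theorem refl_neg (α : E n) : refl (-α) = refl α := by
  rw [← neg_one_smul ℝ, refl_smul _ (by norm_num)]

theorem neg_mem_rootsD {α : E n} (h : α ∈ rootsD n) : -α ∈ rootsD n := by
  obtain ⟨i, j, ε, δ, hij, rfl⟩ := h
  exact ⟨i, j, -ε, -δ, hij, by push_cast; module⟩

theorem ne_zero_of_mem_rootsD {α : E n} (h : α ∈ rootsD n) : α ≠ 0 := by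
  obtain ⟨i, j, ε, δ, hij, rfl⟩ := h
  intro h0
  have := congrArg (fun v : E n => v i) h0
  simp [e, hij] at this

theorem apply_mem_rootsD {g : O n} (hg : g ∈ WD n) {α : E n} (h : α ∈ rootsD n) :
    g α ∈ rootsD n := by
  obtain ⟨s, -, rfl⟩ := exists_of_mem_WD hg
  obtain ⟨i, j, ε, δ, hij, rfl⟩ := h
  refine ⟨s.perm i, s.perm j, ε * s.sgn i, δ * s.sgn j, fun h => hij (s.perm.injective h), ?_⟩
  rw [map_add, map_smul, map_smul, acts_toO, acts_toO, smul_smul, smul_smul]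
  push_cast
  rfl

theorem neg_mem_rootsOf {U : Subgroup (O n)} {α : E n} (h : α ∈ rootsOf U) : -α ∈ rootsOf U :=
  ⟨neg_mem_rootsD h.1, by rw [refl_neg]; exact h.2⟩

/-- An element of `W(D_n)` maps the positive system of `U` given by `ρ` to the positive system of
the conjugate of `U` given by the image of `ρ`. -/
theorem image_posRoots {g : O n} (hg : g ∈ WD n) (U : Subgroup (O n)) (ρ : E n) :
    (fun v => g v) '' posRoots U ρ = posRoots (U.map (MulAut.conj g).toMonoidHom) (g ρ) := by
  ext α
  constructor
  · rintro ⟨β, ⟨⟨h1, h2⟩, h3⟩, rfl⟩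
    refine ⟨⟨apply_mem_rootsD hg h1, ?_⟩, by rwa [g.inner_map_map]⟩
    rw [← conj_refl]
    exact ⟨_, h2, rfl⟩
  · rintro ⟨⟨h1, t, ht, h2⟩, h3⟩
    refine ⟨g⁻¹ α, ⟨⟨apply_mem_rootsD (inv_mem hg) h1, ?_⟩, by rwa [inner_inv']⟩,
      apply_inv_apply g α⟩
    rw [← conj_refl, ← h2]
    have h4 : g⁻¹ * (g * t * g⁻¹) * g⁻¹⁻¹ = t := by group
    exact (congrArg (· ∈ U) h4).mpr ht

theorem map_conj_eq_of_mem_normalizer {g : O n} {U : Subgroup (O n)}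
    (hg : g ∈ Subgroup.normalizer (U : Set (O n))) : U.map (MulAut.conj g).toMonoidHom = U := by
  ext t
  constructor
  · rintro ⟨s, hs, rfl⟩
    exact (Subgroup.mem_normalizer_iff.1 hg s).1 hs
  · intro ht
    refine ⟨g⁻¹ * t * g, (Subgroup.mem_normalizer_iff.1 hg _).2 ?_, ?_⟩
    · convert ht using 1; group
    · change g * (g⁻¹ * t * g) * g⁻¹ = t
      group

theorem finite_WD : (WD n : Set (O n)).Finite := by
  rw [WD_eq]
  have : Finite (SP (Fin n)) := Finite.of_injective (fun s : SP (Fin n) => (s.perm, s.sgn))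
    fun s t h => SP.ext (congrArg Prod.fst h) (congrArg Prod.snd h)
  exact Set.Finite.image _ (Set.toFinite _)

/-- A reflection subgroup is transitive on its positive systems: if `w ∈ U` maximizes
`⟪w μ, ρ⟫`, then `w μ` lies in the chamber of `ρ`. -/
theorem exists_image_posRoots_eq {U : Subgroup (O n)} (hU : U ≤ WD n) {ρ μ : E n}
    (hρ : IsRegular U ρ) (hμ : IsRegular U μ) :
    ∃ w ∈ U, (fun v => w v) '' posRoots U μ = posRoots U ρ := by
  obtain ⟨w, hw, hmax⟩ := Set.exists_max_image (U : Set (O n)) (fun w => ⟪w μ, ρ⟫_ℝ)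
    (finite_WD.subset hU) ⟨1, one_mem U⟩
  refine ⟨w, hw, ?_⟩
  have hroot : ∀ g ∈ U, ∀ α ∈ rootsOf U, g α ∈ rootsOf U := fun g hg α hα =>
    ⟨apply_mem_rootsD (hU hg) hα.1, by
      rw [← conj_refl]; exact mul_mem (mul_mem hg hα.2) (inv_mem hg)⟩
  -- compare `w` with `refl α * w`; equality is excluded because `μ` is regular
  have h1 : ∀ α ∈ posRoots U ρ, 0 < ⟪w μ, α⟫_ℝ := by
    rintro α ⟨hα, hpos⟩
    have h2 := hmax (refl α * w) (mul_mem hα.2 hw)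
    have h3 : (refl α * w) μ = refl α (w μ) := rfl
    rw [h3, refl_apply, inner_sub_left, inner_smul_left, real_inner_comm] at h2
    rw [real_inner_comm] at hpos
    have hn : 0 < ‖α‖ ^ 2 := by
      have := norm_pos_iff.2 (ne_zero_of_mem_rootsD hα.1)
      positivity
    have h5 : 0 ≤ 2 * ⟪α, w μ⟫_ℝ / ‖α‖ ^ 2 := by
      by_contra hneg
      push Not at hneg
      have := mul_neg_of_neg_of_pos hneg hpos
      simp only [conj_trivial] at h2
      rw [real_inner_comm (w μ) ρ] at h2
      linarith
    have h6 : 0 ≤ ⟪w μ, α⟫_ℝ := by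
      rw [real_inner_comm]
      have := mul_nonneg h5 hn.le
      rw [div_mul_cancel₀ _ hn.ne'] at this
      linarith
    refine lt_of_le_of_ne h6 (Ne.symm ?_)
    rw [← inner_inv']
    exact hμ _ (hroot _ (inv_mem hw) _ hα)
  ext α
  constructor
  · rintro ⟨β, ⟨hβ, hpos⟩, rfl⟩
    refine ⟨hroot w hw β hβ, ?_⟩
    by_contra hneg
    have h2 : 0 < ⟪w μ, -(w β)⟫_ℝ := h1 _ ⟨neg_mem_rootsOf (hroot w hw β hβ), by
      have := hρ _ (hroot w hw β hβ)
      rw [inner_neg_right]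
      push Not at hneg
      linarith [lt_of_le_of_ne hneg this]⟩
    rw [inner_neg_right, w.inner_map_map] at h2
    linarith
  · intro hα
    refine ⟨w⁻¹ α, ⟨hroot _ (inv_mem hw) _ hα.1, ?_⟩, apply_inv_apply w α⟩
    rw [inner_inv']
    exact h1 α hα

/-- For all elements of a group, stability of `Φ` amounts to an inclusion. -/
theorem le_howlett {G K : Subgroup (O n)} {Φ : Set (E n)} (h : K ≤ G)
    (h' : ∀ g ∈ K, ∀ α ∈ Φ, g α ∈ Φ) : K ≤ howlett G Φ := fun g hg =>
  ⟨h hg, Set.Subset.antisymm (Set.image_subset_iff.2 (h' g hg)) fun α hα =>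
    ⟨g⁻¹ α, h' _ (inv_mem hg) α hα, apply_inv_apply g α⟩⟩

theorem le_normalizer_of_conj {K P : Subgroup (O n)} (h : ∀ g ∈ K, ∀ p ∈ P, g * p * g⁻¹ ∈ P) :
    K ≤ Subgroup.normalizer (P : Set (O n)) := fun g hg =>
  Subgroup.mem_normalizer_iff.2 fun p => ⟨h g hg p, fun hp => by
    have := h _ (inv_mem hg) _ hp
    convert this using 1
    group⟩

/-- Howlett complements are compatible with conjugation in `W(D_n)`. -/
theorem howlett_map {g : O n} (hg : g ∈ WD n) (U : Subgroup (O n)) (Φ : Set (E n)) :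
    howlett (normalizerIn (WD n) (U.map (MulAut.conj g).toMonoidHom)) ((fun v => g v) '' Φ) =
      (howlett (normalizerIn (WD n) U) Φ).map (MulAut.conj g).toMonoidHom := by
  have key : ∀ (g : O n) (_ : g ∈ WD n) (U : Subgroup (O n)) (Φ : Set (E n)) (a : O n),
      a ∈ howlett (normalizerIn (WD n) U) Φ → g * a * g⁻¹ ∈
        howlett (normalizerIn (WD n) (U.map (MulAut.conj g).toMonoidHom))
          ((fun v => g v) '' Φ) := by
    rintro g hg U Φ a ⟨h12, h3⟩
    obtain ⟨h1, h2⟩ := Subgroup.mem_inf.1 h12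
    refine ⟨Subgroup.mem_inf.2 ⟨mul_mem (mul_mem hg h1) (inv_mem hg), ?_⟩, ?_⟩
    · refine Subgroup.mem_normalizer_iff.2 fun p => ?_
      have h4 : ∀ p, p ∈ U.map (MulAut.conj g).toMonoidHom ↔ g⁻¹ * p * g ∈ U := by
        intro p
        constructor
        · rintro ⟨q, hq, rfl⟩
          have h5 : g⁻¹ * (g * q * g⁻¹) * g = q := by group
          exact (congrArg (· ∈ U) h5).mpr hq
        · intro hp
          refine ⟨_, hp, ?_⟩
          change g * (g⁻¹ * p * g) * g⁻¹ = p
          group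
      rw [h4, h4, Subgroup.mem_normalizer_iff.1 h2]
      refine iff_of_eq (congrArg (· ∈ U) ?_)
      group
    · conv_rhs => rw [← h3]
      rw [Set.image_image, Set.image_image]
      refine Set.image_congr fun v _ => ?_
      change g (a (g⁻¹ (g v))) = _
      rw [inv_apply_apply]
  apply le_antisymm
  · intro a ha
    have h1 := key g⁻¹ (inv_mem hg) _ _ a ha
    have h2 : (U.map (MulAut.conj g).toMonoidHom).map (MulAut.conj g⁻¹).toMonoidHom = U := by
      rw [Subgroup.map_map]
      convert Subgroup.map_id U
      ext1 t
      change g⁻¹ * (g * t * g⁻¹) * g⁻¹⁻¹ = t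
      group
    rw [h2, Set.image_image] at h1
    simp only [inv_apply_apply, Set.image_id'] at h1
    refine ⟨_, h1, ?_⟩
    change g * (g⁻¹ * a * g⁻¹⁻¹) * g⁻¹ = a
    group
  · rintro _ ⟨a, ha, rfl⟩
    exact key g hg U Φ a ha

/-- If `P` is conjugate to `U` in `W(D_n)`, then all Howlett complements of `P` are isomorphic to
all Howlett complements of `U`. -/
theorem nonempty_howlett_equiv {U P : Subgroup (O n)} (hU : U ≤ WD n) {ρ μ : E n}
    (hμ : IsRegular U μ) (hρ : IsRegular P ρ) {w : O n} (hw : w ∈ WD n)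
    (hP : P = U.map (MulAut.conj w).toMonoidHom) :
    Nonempty (howlett (normalizerIn (WD n) P) (posRoots P ρ) ≃*
      howlett (normalizerIn (WD n) U) (posRoots U μ)) := by
  have hρ' : IsRegular U (w⁻¹ ρ) := by
    intro α hα
    rw [inner_inv]
    refine hρ _ ⟨apply_mem_rootsD hw hα.1, ?_⟩
    rw [← conj_refl, hP]
    exact ⟨_, hα.2, rfl⟩
  obtain ⟨u, hu, h1⟩ := exists_image_posRoots_eq hU hρ' hμ
  have h2 := image_posRoots hw U (w⁻¹ ρ)
  rw [apply_inv_apply, ← hP, ← h1, Set.image_image] at h2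
  have hwu : w * u ∈ WD n := mul_mem hw (hU hu)
  have h3 : U.map (MulAut.conj (w * u)).toMonoidHom = P := by
    rw [hP]
    conv_rhs => rw [← map_conj_eq_of_mem_normalizer (Subgroup.le_normalizer hu)]
    rw [Subgroup.map_map, map_mul]
    rfl
  have h4 := howlett_map hwu U (posRoots U μ)
  rw [h3, show (fun v => (w * u) v) '' posRoots U μ = posRoots P ρ from h2] at h4
  rw [h4]
  exact ⟨(Subgroup.equivMapOfInjective _ _ (MulAut.conj (w * u)).injective).symm⟩

theorem orthComplement_le (U : Subgroup (O n)) : orthComplement U ≤ WD n :=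
  (Subgroup.closure_le _).2 fun _ ht => ht.1

/-- The normalizer of `U` normalizes the orthogonal complement of `U`. -/
theorem conj_mem_orthComplement {U : Subgroup (O n)} {g : O n} (hg : g ∈ normalizerIn (WD n) U)
    {q : O n} (hq : q ∈ orthComplement U) : g * q * g⁻¹ ∈ orthComplement U := by
  have h : orthComplement U ≤ (orthComplement U).comap (MulAut.conj g).toMonoidHom := by
    conv_lhs => rw [orthComplement]
    rw [Subgroup.closure_le]
    rintro t ⟨ht, α, h0, rfl, h1⟩
    refine Subgroup.subset_closure ⟨mul_mem (mul_mem hg.1 ht) (inv_mem hg.1), g α,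
      fun h => h0 ((map_eq_zero_iff _ g.injective).1 h), conj_refl g α, fun β hβ hβU => ?_⟩
    rw [← inner_inv']
    refine h1 _ (fun h => hβ ((map_eq_zero_iff _ (g⁻¹ : O n).injective).1 h)) ?_
    rw [← conj_refl]
    exact (Subgroup.mem_normalizer_iff.1 (inv_mem hg.2) _).1 hβU
  exact h hq

/-! ### Roots and reflections of `W(D_n)` -/

/-- The reflection in `e_u - η e_v`, as a signed permutation. -/
def sgnSwap {κ : Type*} [DecidableEq κ] (u v : κ) (η : ℤˣ) : SP κ :=
  ⟨Equiv.swap u v, fun k => if k = u ∨ k = v then η else 1⟩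

theorem eq_of_e {g h : O n} (H : ∀ i, g (e i) = h (e i)) : g = h :=
  LinearIsometryEquiv.ext fun v => eq_on_span (b := e) H (by rw [span_e]; trivial)

theorem inner_e (i j : Fin n) : ⟪e i, (e j : E n)⟫_ℝ = if i = j then 1 else 0 :=
  orthonormal_iff_ite.1 orthonormal_e i j

theorem toO_sgnSwap {u v : Fin n} (h : u ≠ v) (η : ℤˣ) :
    toO (sgnSwap u v η) = refl (e u - ((η : ℤ) : ℝ) • e v) := by
  refine eq_of_e fun k => ?_
  have hn : ‖e u - ((η : ℤ) : ℝ) • (e v : E n)‖ ^ 2 = 2 := by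
    rw [← real_inner_self_eq_norm_sq]
    simp only [inner_sub_left, inner_sub_right, inner_smul_left, inner_smul_right, inner_e,
      if_neg h, if_neg (Ne.symm h)]
    rcases Int.units_eq_one_or η with h | h <;> rw [h] <;> norm_num
  rw [acts_toO, refl_apply, hn, inner_sub_left, inner_smul_left, inner_e, inner_e]
  by_cases hku : k = u
  · subst hku
    simp [sgnSwap, Ne.symm h]
  by_cases hkv : k = v
  · subst hkv
    rcases Int.units_eq_one_or η with h' | h' <;> simp [sgnSwap, h, h']
  · simp [sgnSwap, hku, hkv, Ne.symm hku, Ne.symm hkv, Equiv.swap_apply_of_ne_of_ne hku hkv]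

theorem sub_smul_ne_zero {u v : Fin n} (h : u ≠ v) (η : ℤˣ) :
    e u - ((η : ℤ) : ℝ) • (e v : E n) ≠ 0 := by
  intro h0
  have := congrArg (fun w : E n => w u) h0
  simp [e, h] at this

theorem prod_sgnSwap {u v : Fin n} (h : u ≠ v) (η : ℤˣ) : ∏ k, (sgnSwap u v η).sgn k = 1 := by
  have : ∀ k, (sgnSwap u v η).sgn k = (if k = u then η else 1) * (if k = v then η else 1) := by
    intro k
    simp only [sgnSwap]
    by_cases hu : k = u
    · subst hu; simp [h]
    · simp [hu]
  rw [Finset.prod_congr rfl fun k _ => this k, Finset.prod_mul_distrib]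
  simp

theorem exists_smul_of_refl_eq {α β : E n} (h : refl α = refl β) (hβ : β ≠ 0) :
    ∃ c : ℝ, c ≠ 0 ∧ β = c • α := by
  have h1 : refl α β = -β := by rw [h, refl_self]
  rw [refl_apply] at h1
  set c := 2 * ⟪α, β⟫_ℝ / ‖α‖ ^ 2
  have h2 : β = (c / 2) • α := by
    have : (2 : ℝ) • β = c • α := by
      rw [two_smul]
      rw [sub_eq_iff_eq_add] at h1
      nth_rw 1 [h1]
      abel
    rw [div_eq_inv_mul, ← smul_smul, ← this, smul_smul]
    norm_num
  refine ⟨c / 2, fun h0 => hβ ?_, h2⟩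
  rw [h2, h0, zero_smul]

/-- The reflections of `W(D_n)` are the reflections in the vectors `e_u - η e_v`. -/
theorem exists_of_refl_mem_WD {α : E n} (h0 : α ≠ 0) (h : refl α ∈ WD n) :
    ∃ (u v : Fin n) (η : ℤˣ), u ≠ v ∧ refl α = toO (sgnSwap u v η) ∧
      ∃ c : ℝ, c ≠ 0 ∧ e u - ((η : ℤ) : ℝ) • e v = c • α := by
  obtain ⟨s, hs, hα⟩ := exists_of_mem_WD h
  have h1 : s.IsRefl := isRefl_toO.1 ⟨α, h0, hα⟩
  rcases h1 with ⟨u, v, huv, h1, h2, h3, h4⟩ | ⟨i, h1, h2, h3⟩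
  · have h5 : s = sgnSwap u v (s.sgn u) := by
      refine SP.ext_iff'.2 fun k => ?_
      by_cases hku : k = u
      · subst hku; simp [sgnSwap, h1]
      by_cases hkv : k = v
      · subst hkv; simp [sgnSwap, h2, h3]
      · simp [sgnSwap, hku, hkv, h4 k hku hkv, Equiv.swap_apply_of_ne_of_ne hku hkv]
    refine ⟨u, v, s.sgn u, huv, by rw [← h5, hα], ?_⟩
    refine exists_smul_of_refl_eq ?_ (sub_smul_ne_zero huv _)
    rw [← toO_sgnSwap huv, ← h5, hα]
  · rw [Finset.prod_eq_single i (fun k _ hk => (h3 k hk).2) (by simp), h2] at hs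
    exact absurd hs (by decide)

theorem stdRho_apply (i : Fin n) : stdRho n i = (n : ℝ) - (i : ℕ) := rfl

theorem inner_stdRho_e (i : Fin n) : ⟪stdRho n, e i⟫_ℝ = (n : ℝ) - (i : ℕ) := by
  rw [e, EuclideanSpace.inner_single_right, stdRho_apply]
  simp

theorem inner_stdRho (u v : Fin n) (η : ℤˣ) (h : u < v) :
    0 < ⟪stdRho n, e u - ((η : ℤ) : ℝ) • e v⟫_ℝ := by
  rw [inner_sub_right, inner_smul_right, inner_stdRho_e, inner_stdRho_e]
  have h1 : ((u : ℕ) : ℝ) < (v : ℕ) := by exact_mod_cast h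
  have h2 : ((v : ℕ) : ℝ) < n := by exact_mod_cast v.2
  rcases Int.units_eq_one_or η with h | h <;> rw [h] <;> push_cast <;> linarith

theorem exists_root_form {α : E n} (h : α ∈ rootsD n) :
    ∃ (u v : Fin n) (η : ℤˣ), u < v ∧
      (α = e u - ((η : ℤ) : ℝ) • e v ∨ α = -(e u - ((η : ℤ) : ℝ) • e v)) := by
  obtain ⟨i, j, ε, δ, hij, rfl⟩ := h
  rcases lt_or_gt_of_ne hij with hij | hij
  · refine ⟨i, j, -(ε * δ), hij, ?_⟩
    rcases Int.units_eq_one_or ε with rfl | rfl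
    · left; push_cast; module
    · right; push_cast; module
  · refine ⟨j, i, -(ε * δ), hij, ?_⟩
    rcases Int.units_eq_one_or δ with rfl | rfl
    · left; push_cast; module
    · right; push_cast; module

theorem root_form_mem (u v : Fin n) (η : ℤˣ) (h : u ≠ v) :
    e u - ((η : ℤ) : ℝ) • e v ∈ rootsD n := ⟨u, v, 1, -η, h, by push_cast; module⟩

/-- The standard positive roots of `U` are the `e_u - η e_v`, `u < v`, whose reflection lies in
`U`. -/
theorem mem_posRoots_std {U : Subgroup (O n)} {α : E n} : α ∈ posRoots U (stdRho n) ↔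
    ∃ (u v : Fin n) (η : ℤˣ), u < v ∧ α = e u - ((η : ℤ) : ℝ) • e v ∧ toO (sgnSwap u v η) ∈ U := by
  constructor
  · rintro ⟨⟨h1, h2⟩, h3⟩
    obtain ⟨u, v, η, huv, rfl | rfl⟩ := exists_root_form h1
    · exact ⟨u, v, η, huv, rfl, by rwa [toO_sgnSwap huv.ne]⟩
    · rw [inner_neg_right] at h3
      linarith [inner_stdRho u v η huv]
  · rintro ⟨u, v, η, huv, rfl, h⟩
    exact ⟨⟨root_form_mem u v η huv.ne, by rwa [← toO_sgnSwap huv.ne]⟩, inner_stdRho u v η huv⟩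

theorem isRegular_stdRho (U : Subgroup (O n)) : IsRegular U (stdRho n) := by
  rintro α ⟨h1, -⟩
  obtain ⟨u, v, η, huv, rfl | rfl⟩ := exists_root_form h1
  · exact (inner_stdRho u v η huv).ne'
  · rw [inner_neg_right]
    exact neg_ne_zero.2 (inner_stdRho u v η huv).ne'

theorem toO_root_form (s : SP (Fin n)) (u v : Fin n) (η : ℤˣ) :
    toO s (e u - ((η : ℤ) : ℝ) • e v) = ((s.sgn u : ℤ) : ℝ) • e (s.perm u) -
      (((η * s.sgn v : ℤˣ) : ℤ) : ℝ) • e (s.perm v) := by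
  rw [map_sub, map_smul, acts_toO, acts_toO, smul_smul]
  push_cast
  rfl

/-- Uniqueness of the form `e_u - η e_v`, `u < v`, of a positive root. -/
theorem root_form_unique {a b u v : Fin n} {ε δ η : ℤˣ} (hab : a ≠ b) (huv : u < v)
    (h : ((ε : ℤ) : ℝ) • e a - ((δ : ℤ) : ℝ) • e b = e u - ((η : ℤ) : ℝ) • (e v : E n)) :
    (a = u ∧ b = v ∧ ε = 1 ∧ δ = η) ∨ (a = v ∧ b = u ∧ δ = -1 ∧ ε = -η) := by
  have hc : ∀ k, ((ε : ℤ) : ℝ) * (if k = a then 1 else 0) - ((δ : ℤ) : ℝ) * (if k = b then 1 else 0)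
      = (if k = u then 1 else 0) - ((η : ℤ) : ℝ) * (if k = v then 1 else 0) := by
    intro k
    simpa [e, Pi.single_apply] using congrArg (fun w : E n => w k) h
  have h1 := hc u
  have h2 := hc v
  have hvu := huv.ne'
  by_cases hua : u = a
  · subst hua
    by_cases hvb : v = b
    · subst hvb
      left
      simp [huv.ne] at h1
      simp [hvu] at h2
      exact ⟨rfl, rfl, h1, Units.ext h2⟩
    · simp [hvu, hvb] at h2
  · by_cases hub : u = b
    · subst hub
      by_cases hva : v = a
      · subst hva
        right
        simp [huv.ne] at h1
        simp [hvu] at h2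
        refine ⟨rfl, rfl, ?_, ?_⟩
        · rcases Int.units_eq_one_or δ with h' | h'
          · rw [h'] at h1; norm_num at h1
          · exact h'
        · exact Units.ext (by push_cast; exact_mod_cast h2)
      · simp [hvu, hva] at h2
    · simp [hua, hub, huv.ne] at h1

end Positive

/-! ### The standard parabolic subgroup and its Howlett complement -/

section Young
variable {n : ℕ} {lam : n.Partition}

theorem toO_mem_young {s : SP (Fin n)} :
    toO s ∈ young lam ↔ ∀ v, bl lam (s.perm v) = bl lam v ∧ s.sgn v = 1 := by
  constructor
  · rintro ⟨σ, h, h'⟩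
    have h1 : s = SP.ofPerm σ := toO_injective h'
    subst h1
    refine fun v => ⟨?_, rfl⟩
    have := h (bl lam v) v
    rw [inBlock_iff, inBlock_iff] at this
    exact Fin.ext (this.2 rfl)
  · intro h
    refine ⟨s.perm, fun i v => by rw [inBlock_iff, inBlock_iff, (h v).1], ?_⟩
    rw [toO_apply]
    congr 1
    funext v
    exact (h v).2

theorem young_le : young lam ≤ WD n := by
  rintro _ ⟨σ, -, rfl⟩
  exact ⟨σ, _, by simp, rfl⟩

theorem exists_of_mem_young {g : O n} (h : g ∈ young lam) :
    ∃ s, toO s = g ∧ ∀ v, bl lam (s.perm v) = bl lam v ∧ s.sgn v = 1 := by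
  obtain ⟨s, -, rfl⟩ := exists_of_mem_WD (young_le h)
  exact ⟨s, rfl, toO_mem_young.1 h⟩

theorem toO_sgnSwap_mem_young {u v : Fin n} {η : ℤˣ} :
    toO (sgnSwap u v η) ∈ young lam ↔ bl lam u = bl lam v ∧ η = 1 := by
  rw [toO_mem_young]
  constructor
  · intro H
    have := H u
    simp only [sgnSwap, Equiv.swap_apply_left, true_or, if_true] at this
    exact ⟨this.1.symm, this.2⟩
  · rintro ⟨h1, rfl⟩ k
    simp only [sgnSwap, ite_self, and_true]
    rw [Equiv.swap_apply_def]
    split_ifs with h2 h3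
    · rw [h2, h1]
    · rw [h3, h1]
    · rfl

theorem sgnSwap_one (u v : Fin n) : sgnSwap u v 1 = SP.ofPerm (Equiv.swap u v) :=
  SP.ext_iff'.2 fun k => by simp [sgnSwap]

/-- The standard parabolic subgroup is generated by the transpositions inside the blocks. -/
theorem young_le_of_swap {C : Subgroup (O n)}
    (h : ∀ u v, u ≠ v → bl lam u = bl lam v → toO (SP.ofPerm (Equiv.swap u v)) ∈ C) :
    young lam ≤ C := by
  intro g hg
  obtain ⟨s, rfl, hs⟩ := exists_of_mem_young hg
  let S : Set (Equiv.Perm (Fin n)) := {σ | ∃ u v, u ≠ v ∧ bl lam u = bl lam v ∧ σ = Equiv.swap u v}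
  have h1 : s.perm ∈ Subgroup.closure S := by
    rw [mem_closure_isSwap (by rintro _ ⟨i, j, h, -, rfl⟩; exact ⟨i, j, h, rfl⟩)]
    refine ⟨Set.toFinite _, fun i => ?_⟩
    by_cases h : s.perm i = i
    · rw [h]
      exact MulAction.mem_orbit_self i
    · exact MulAction.mem_orbit_iff.2 ⟨⟨Equiv.swap i (s.perm i), Subgroup.subset_closure
        ⟨i, _, Ne.symm h, (hs i).1.symm, rfl⟩⟩, Equiv.swap_apply_left _ _⟩
  have h2 : Subgroup.closure S ≤ C.comap (toO.comp SP.ofPerm) := by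
    rw [Subgroup.closure_le]
    rintro _ ⟨u, v, huv, hb, rfl⟩
    exact h u v huv hb
  have h3 : s = SP.ofPerm s.perm := SP.ext_iff'.2 fun v => by simp [(hs v).2]
  rw [h3]
  exact h2 h1

theorem isParabolic_young : IsParabolic (young lam) := by
  -- a vector with distinct positive coordinates on distinct blocks
  let w : E n := WithLp.toLp 2 fun v => ((bl lam v : ℕ) : ℝ) + 1
  have hw : ∀ v, w v = ((bl lam v : ℕ) : ℝ) + 1 := fun v => rfl
  have key : ∀ s : SP (Fin n), toO s w = w ↔ ∀ v, bl lam (s.perm v) = bl lam v ∧ s.sgn v = 1 := by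
    intro s
    have h1 : toO s w = w ↔ ∀ v, w (s.perm v) = ((s.sgn v : ℤ) : ℝ) * w v := by
      constructor
      · intro h v
        rw [← toO_apply_coord, h]
      · intro h
        ext k
        obtain ⟨v, rfl⟩ := s.perm.surjective k
        rw [toO_apply_coord, h]
    rw [h1]
    refine forall_congr' fun v => ?_
    rw [hw, hw]
    rcases Int.units_eq_one_or (s.sgn v) with h | h
    · rw [h]
      simp [Fin.ext_iff]
    · rw [h]
      have h2 : ¬ ((-1 : ℤˣ) = 1) := by decide
      simp only [h2, and_false, iff_false]
      push_cast
      intro h3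
      have : (0 : ℝ) ≤ ((bl lam (s.perm v) : ℕ) : ℝ) := Nat.cast_nonneg _
      have : (0 : ℝ) ≤ ((bl lam v : ℕ) : ℝ) := Nat.cast_nonneg _
      linarith
  refine ⟨ℝ ∙ w, ?_⟩
  ext g
  constructor
  · intro hg
    refine ⟨young_le hg, fun v hv => ?_⟩
    obtain ⟨s, rfl, hs⟩ := exists_of_mem_young hg
    obtain ⟨c, rfl⟩ := Submodule.mem_span_singleton.1 hv
    rw [map_smul, (key s).2 hs]
  · rintro ⟨hg, h⟩
    obtain ⟨s, -, rfl⟩ := exists_of_mem_WD hg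
    exact toO_mem_young.2 ((key s).1 (h w (Submodule.mem_span_singleton_self w)))

theorem hasLabel_young : HasLabel (young lam) lam := by
  refine ⟨isParabolic_young, 1, one_mem _, ?_⟩
  rw [map_one]
  exact (Subgroup.map_id _).symm

theorem mem_posRoots_young {α : E n} : α ∈ posRoots (young lam) (stdRho n) ↔
    ∃ u v, u < v ∧ bl lam u = bl lam v ∧ α = e u - (((1 : ℤˣ) : ℤ) : ℝ) • e v := by
  rw [mem_posRoots_std]
  constructor
  · rintro ⟨u, v, η, huv, rfl, h⟩
    rw [toO_sgnSwap_mem_young] at h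
    obtain ⟨h, rfl⟩ := h
    exact ⟨u, v, huv, h, rfl⟩
  · rintro ⟨u, v, huv, h, rfl⟩
    exact ⟨u, v, 1, huv, rfl, (toO_sgnSwap_mem_young).2 ⟨h, rfl⟩⟩

theorem bO_conj_mem_young (t : Gam lam) {p : O n} (hp : p ∈ young lam) :
    bO t * p * (bO t)⁻¹ ∈ young lam := by
  obtain ⟨s, rfl, hs⟩ := exists_of_mem_young hp
  rw [bO_apply, ← map_inv, ← map_mul, ← map_mul, toO_mem_young]
  intro v
  obtain ⟨v, rfl⟩ := (blk t).perm.surjective v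
  have h := (blk t).perm.symm_apply_apply v
  have h' : (blk t).perm⁻¹ ((blk t).perm v) = v := h
  simp only [SP.mul_perm, SP.inv_perm, Equiv.Perm.mul_apply, SP.mul_sgn, SP.inv_sgn, h', bl_blk,
    (hs v).1, (hs v).2, blk_sgn, mul_one, Int.units_mul_self, and_self]

/-- `s` preserves or reverses the order of two points of a block according to the sign. -/
def OrderSgn (lam : n.Partition) (s : SP (Fin n)) : Prop :=
  ∀ u v, u < v → bl lam u = bl lam v → bl lam (s.perm u) = bl lam (s.perm v) ∧
    ((s.perm u < s.perm v ∧ s.sgn u = 1 ∧ s.sgn v = 1) ∨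
      (s.perm v < s.perm u ∧ s.sgn u = -1 ∧ s.sgn v = -1))

theorem orderSgn_iff {s : SP (Fin n)} : OrderSgn lam s ↔
    ∀ α ∈ posRoots (young lam) (stdRho n), toO s α ∈ posRoots (young lam) (stdRho n) := by
  constructor
  · intro h α hα
    obtain ⟨u, v, huv, hb, rfl⟩ := mem_posRoots_young.1 hα
    rw [toO_root_form, mem_posRoots_young]
    obtain ⟨h1, ⟨h2, h3, h4⟩ | ⟨h2, h3, h4⟩⟩ := h u v huv hb
    · exact ⟨_, _, h2, h1, by rw [h3, h4]; simp⟩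
    · exact ⟨_, _, h2, h1.symm, by rw [h3, h4]; simp; abel⟩
  · intro h u v huv hb
    have h1 := h _ (mem_posRoots_young.2 ⟨u, v, huv, hb, rfl⟩)
    rw [toO_root_form, mem_posRoots_young] at h1
    obtain ⟨u', v', huv', hb', h2⟩ := h1
    rw [one_mul] at h2
    rcases root_form_unique (fun h => huv.ne (s.perm.injective h)) huv' h2 with
      ⟨rfl, rfl, h3, h4⟩ | ⟨rfl, rfl, h3, h4⟩
    · exact ⟨hb', .inl ⟨huv', h3, h4⟩⟩
    · exact ⟨hb'.symm, .inr ⟨huv', h4, h3⟩⟩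

theorem orderSgn_blk (t : Gam lam) : OrderSgn lam (blk t) := by
  intro u v huv hb
  refine ⟨by rw [bl_blk, bl_blk, hb], ?_⟩
  have h1 : bl lam ((blk t).perm u) = bl lam ((blk t).perm v) := by rw [bl_blk, bl_blk, hb]
  rw [lt_iff_of_bl_eq h1, lt_iff_of_bl_eq h1.symm, ps_blk, ps_blk, blk_sgn, blk_sgn, hb]
  have h2 := (lt_iff_of_bl_eq hb).1 huv
  have h3 := ps_lt lam v
  rcases Int.units_eq_one_or (t.1.sgn (bl lam v)) with h | h
  · left
    simp [h, h2]
  · right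
    have : ¬ ((-1 : ℤˣ) = 1) := by decide
    simp only [h, flp, this, if_false, and_self, and_true]
    omega

theorem card_lt (v : Fin n) :
    (Finset.univ.filter fun w : Fin n => bl lam w = bl lam v ∧ w < v).card = ps lam v := by
  rw [← Finset.card_range (ps lam v)]
  refine Finset.card_bij (fun w _ => ps lam w) ?_ ?_ ?_
  · intro w hw
    obtain ⟨-, h1, h2⟩ := Finset.mem_filter.1 hw
    exact Finset.mem_range.2 ((lt_iff_of_bl_eq h1).1 h2)
  · intro w hw w' hw' h
    exact block_ext ((Finset.mem_filter.1 hw).2.1.trans (Finset.mem_filter.1 hw').2.1.symm) h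
  · intro p hp
    have hp' := Finset.mem_range.1 hp
    refine ⟨pt lam (bl lam v) p (hp'.trans (ps_lt lam v)), Finset.mem_filter.2
      ⟨Finset.mem_univ _, bl_pt _ _ _, ?_⟩, ps_pt _ _ _⟩
    rw [lt_iff_of_bl_eq (bl_pt _ _ _), ps_pt]
    exact hp'

theorem card_gt (v : Fin n) :
    (Finset.univ.filter fun w : Fin n => bl lam w = bl lam v ∧ v < w).card =
      part lam (bl lam v) - 1 - ps lam v := by
  have h1 := card_block (bl lam v)
  have h2 : (Finset.univ.filter fun w : Fin n => bl lam w = bl lam v) =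
      insert v ((Finset.univ.filter fun w : Fin n => bl lam w = bl lam v ∧ w < v) ∪
        Finset.univ.filter fun w : Fin n => bl lam w = bl lam v ∧ v < w) := by
    ext w
    simp only [Finset.mem_filter, Finset.mem_univ, true_and, Finset.mem_insert, Finset.mem_union]
    rcases lt_trichotomy w v with h | h | h
    · simp [h, h.ne, not_lt.2 h.le]
    · simp [h]
    · simp [h, h.ne', not_lt.2 h.le]
  rw [h2, Finset.card_insert_of_notMem (by simp), Finset.card_union_of_disjoint, card_lt] at h1
  · omega
  · rw [Finset.disjoint_filter]
    rintro w - ⟨-, h⟩ ⟨-, h'⟩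
    exact absurd h' (not_lt.2 h.le)

/-- A signed permutation which, like its inverse, maps positive roots of the standard parabolic
subgroup to positive roots is a signed permutation of the blocks: the position of a point in its
block is the number of preceding points, so it is preserved or reversed. -/
theorem exists_blk_eq {s : SP (Fin n)} (h : OrderSgn lam s) (h' : OrderSgn lam s⁻¹) :
    ∃ t : Gam lam, blk t = s := by
  have hb : ∀ {s : SP (Fin n)}, OrderSgn lam s → ∀ u v, bl lam u = bl lam v →
      bl lam (s.perm u) = bl lam (s.perm v) := by
    intro s h u v huv
    rcases lt_trichotomy u v with h1 | rfl | h1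
    · exact (h u v h1 huv).1
    · rfl
    · exact (h v u h1 huv.symm).1.symm
  have hinv : ∀ v, s⁻¹.perm (s.perm v) = v := fun v => s.perm.symm_apply_apply v
  have hinv' : ∀ v, s.perm (s⁻¹.perm v) = v := fun v => s.perm.apply_symm_apply v
  have hb' : ∀ u v, bl lam (s.perm u) = bl lam (s.perm v) ↔ bl lam u = bl lam v := fun u v =>
    ⟨fun h1 => by simpa [hinv] using hb h' _ _ h1, hb h u v⟩
  have hsgn : ∀ u v, bl lam u = bl lam v → s.sgn u = s.sgn v := by
    intro u v huv
    rcases lt_trichotomy u v with h1 | rfl | h1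
    · rcases (h u v h1 huv).2 with ⟨-, h2, h3⟩ | ⟨-, h2, h3⟩ <;> rw [h2, h3]
    · rfl
    · rcases (h v u h1 huv.symm).2 with ⟨-, h2, h3⟩ | ⟨-, h2, h3⟩ <;> rw [h2, h3]
  -- sizes are preserved because `s.perm` is a bijection between a block and its image
  have hpart : ∀ v, part lam (bl lam (s.perm v)) = part lam (bl lam v) := by
    intro v
    rw [← card_block, ← card_block]
    symm
    refine Finset.card_bij (fun w _ => s.perm w) ?_ (fun _ _ _ _ h => s.perm.injective h) ?_
    · intro w hw
      simpa [hb'] using hw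
    · intro w hw
      refine ⟨s⁻¹.perm w, ?_, hinv' w⟩
      rw [Finset.mem_filter] at hw ⊢
      rw [← hb', hinv']
      exact ⟨Finset.mem_univ _, hw.2⟩
  -- the position is the number of preceding points; a sign `-1` turns them into the following ones
  have hps : ∀ v, ps lam (s.perm v) = flp (s.sgn v) (part lam (bl lam v)) (ps lam v) := by
    intro v
    rw [← card_lt]
    rcases Int.units_eq_one_or (s.sgn v) with hv | hv
    · rw [hv, flp_one, ← card_lt]
      symm
      refine Finset.card_bij (fun w _ => s.perm w) ?_ (fun _ _ _ _ h => s.perm.injective h) ?_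
      · intro w hw
        obtain ⟨-, h1, h2⟩ := Finset.mem_filter.1 hw
        refine Finset.mem_filter.2 ⟨Finset.mem_univ _, (hb' _ _).2 h1, ?_⟩
        rcases (h w v h2 h1).2 with h3 | h3
        · exact h3.1
        · rw [hv] at h3; exact absurd h3.2.2 (by decide)
      · intro w hw
        obtain ⟨-, h1, h2⟩ := Finset.mem_filter.1 hw
        obtain ⟨w, rfl⟩ := s.perm.surjective w
        rw [hb'] at h1
        refine ⟨w, Finset.mem_filter.2 ⟨Finset.mem_univ _, h1, ?_⟩, rfl⟩
        rcases lt_trichotomy w v with h3 | rfl | h3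
        · exact h3
        · exact absurd h2 (lt_irrefl _)
        · rcases (h v w h3 h1.symm).2 with h4 | h4
          · exact absurd h4.1 (not_lt.2 h2.le)
          · rw [hv] at h4; exact absurd h4.2.1 (by decide)
    · rw [hv, flp, if_neg (by decide), ← card_gt]
      symm
      refine Finset.card_bij (fun w _ => s.perm w) ?_ (fun _ _ _ _ h => s.perm.injective h) ?_
      · intro w hw
        obtain ⟨-, h1, h2⟩ := Finset.mem_filter.1 hw
        refine Finset.mem_filter.2 ⟨Finset.mem_univ _, (hb' _ _).2 h1, ?_⟩
        rcases (h v w h2 h1.symm).2 with h3 | h3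
        · rw [hv] at h3; exact absurd h3.2.1 (by decide)
        · exact h3.1
      · intro w hw
        obtain ⟨-, h1, h2⟩ := Finset.mem_filter.1 hw
        obtain ⟨w, rfl⟩ := s.perm.surjective w
        rw [hb'] at h1
        refine ⟨w, Finset.mem_filter.2 ⟨Finset.mem_univ _, h1, ?_⟩, rfl⟩
        rcases lt_trichotomy v w with h3 | rfl | h3
        · exact h3
        · exact absurd h2 (lt_irrefl _)
        · rcases (h w v h3 h1).2 with h4 | h4
          · rw [hv] at h4; exact absurd h4.2.2 (by decide)
          · exact absurd h4.1 (not_lt.2 h2.le)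
  let f : Fin (len lam) → Fin n := fun i => pt lam i 0 (part_pos lam i)
  have hf : ∀ i, bl lam (f i) = i := fun i => bl_pt _ _ _
  let τ : Equiv.Perm (Fin (len lam)) :=
    { toFun := fun i => bl lam (s.perm (f i))
      invFun := fun i => bl lam (s⁻¹.perm (f i))
      left_inv := fun i => by
        dsimp only
        rw [hb h' (f (bl lam (s.perm (f i)))) (s.perm (f i)) (hf _), hinv, hf]
      right_inv := fun i => by
        dsimp only
        rw [hb h (f (bl lam (s⁻¹.perm (f i)))) (s⁻¹.perm (f i)) (hf _), hinv', hf] }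
  refine ⟨⟨⟨τ, fun i => s.sgn (f i)⟩, fun i => ?_⟩, ?_⟩
  · change part lam (bl lam (s.perm (f i))) = _
    rw [hpart, hf]
  · refine SP.ext_iff'.2 fun v => ⟨block_ext (lam := lam) ?_ ?_, ?_⟩
    · rw [bl_blk]
      exact hb h _ _ (hf _)
    · rw [ps_blk, hps]
      dsimp only
      rw [hsgn _ v (hf _)]
    · rw [blk_sgn]
      exact hsgn _ v (hf _)

theorem map_KS_le_N (p : ℕ → Prop) : (KS lam p).map bO ≤ N lam := by
  rintro _ ⟨t, ht, rfl⟩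
  refine Subgroup.mem_inf.2 ⟨bO_mem_WD.2 ht.2, ?_⟩
  exact le_normalizer_of_conj (K := (bO : Gam lam →* O n).range)
    (by rintro _ ⟨t, rfl⟩ p hp; exact bO_conj_mem_young t hp) ⟨t, rfl⟩

/-- The Howlett complement of the standard parabolic subgroup consists of the elements of
`W(D_n)` that are signed permutations of the blocks. -/
theorem howlett_young_eq :
    howlett (N lam) (posRoots (young lam) (stdRho n)) = (KS lam fun _ => True).map bO := by
  apply le_antisymm
  · intro g hg
    obtain ⟨s, hs, rfl⟩ := exists_of_mem_WD (Subgroup.mem_inf.1 hg.1).1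
    have key : ∀ s : SP (Fin n), toO s ∈ howlett (N lam) (posRoots (young lam) (stdRho n)) →
        OrderSgn lam s := fun s hs => orderSgn_iff.2 fun α hα => by
      rw [← hs.2]
      exact ⟨α, hα, rfl⟩
    obtain ⟨t, rfl⟩ := exists_blk_eq (key s hg) (key s⁻¹ (by rw [map_inv]; exact inv_mem hg))
    exact ⟨t, ⟨fun i hi => absurd trivial hi, hs⟩, rfl⟩
  · apply le_howlett (map_KS_le_N _)
    rintro _ ⟨t, -, rfl⟩
    exact orderSgn_iff.1 (orderSgn_blk t)

end Young

/-! ### The orthogonal complement and the Howlett complement of the product -/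

section Ortho
variable {n : ℕ} {lam : n.Partition}

variable (lam) in
/-- The exchange of two blocks of the same size, with the sign `η` on both. -/
def gsw (i j : Fin (len lam)) (h : part lam i = part lam j) (η : ℤˣ) : Gam lam :=
  ⟨sgnSwap i j η, (sw lam i j h).2⟩

theorem gsw_perm (i j : Fin (len lam)) (h : part lam i = part lam j) (η : ℤˣ) :
    (gsw lam i j h η).1.perm = Equiv.swap i j := rfl

theorem gsw_sgn (i j : Fin (len lam)) (h : part lam i = part lam j) (η : ℤˣ) (k) :
    (gsw lam i j h η).1.sgn k = if k = i ∨ k = j then η else 1 := rfl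

theorem gsw_one (i j : Fin (len lam)) (h : part lam i = part lam j) :
    gsw lam i j h 1 = sw lam i j h :=
  Subtype.ext (SP.ext_iff'.2 fun k => by simp [gsw_perm, gsw_sgn])

theorem gsw_neg_one (i j : Fin (len lam)) (h : part lam i = part lam j) (hij : i ≠ j) :
    gsw lam i j h (-1) = sw lam i j h * ng lam i * ng lam j :=
  Subtype.ext (SP.ext_iff'.2 fun k => by
    simp only [gsw_perm, gsw_sgn, Subgroup.coe_mul, SP.mul_perm, SP.mul_sgn, sw_perm, ng_perm,
      mul_one, sw_sgn, ng_sgn, Equiv.Perm.one_apply, one_mul, true_and]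
    by_cases h1 : k = i
    · subst h1; simp [hij]
    · by_cases h2 : k = j
      · subst h2; simp [h1]
      · simp [h1, h2])

theorem eq_of_bl_eq {v w : Fin n} (h : part lam (bl lam v) = 1) (hb : bl lam v = bl lam w) :
    v = w := by
  have h1 := ps_lt lam v
  have h2 := ps_lt lam w
  rw [← hb] at h2
  exact block_ext hb (by omega)

theorem blk_gsw {u v : Fin n} (hu : part lam (bl lam u) = 1) (hv : part lam (bl lam v) = 1)
    (η : ℤˣ) : blk (gsw lam (bl lam u) (bl lam v) (hu.trans hv.symm) η) = sgnSwap u v η := by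
  refine SP.ext_iff'.2 fun k => ⟨?_, ?_⟩
  · have hbk := bl_blk (gsw lam (bl lam u) (bl lam v) (hu.trans hv.symm) η) k
    rw [gsw_perm] at hbk
    change _ = Equiv.swap u v k
    by_cases hku : k = u
    · subst hku
      rw [Equiv.swap_apply_left] at hbk ⊢
      exact (eq_of_bl_eq hv hbk.symm).symm
    by_cases hkv : k = v
    · subst hkv
      rw [Equiv.swap_apply_right] at hbk ⊢
      exact (eq_of_bl_eq hu hbk.symm).symm
    have h1 : bl lam k ≠ bl lam u := fun h => hku (eq_of_bl_eq hu h.symm).symm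
    have h2 : bl lam k ≠ bl lam v := fun h => hkv (eq_of_bl_eq hv h.symm).symm
    rw [Equiv.swap_apply_of_ne_of_ne h1 h2] at hbk
    rw [Equiv.swap_apply_of_ne_of_ne hku hkv]
    refine block_ext hbk ?_
    rw [ps_blk, gsw_sgn, if_neg (by simp [h1, h2]), flp_one]
  · rw [blk_sgn, gsw_sgn]
    have h1 : bl lam k = bl lam u ↔ k = u :=
      ⟨fun h => (eq_of_bl_eq hu h.symm).symm, fun h => by rw [h]⟩
    have h2 : bl lam k = bl lam v ↔ k = v :=
      ⟨fun h => (eq_of_bl_eq hv h.symm).symm, fun h => by rw [h]⟩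
    simp only [h1, h2, sgnSwap]

theorem eq_or_eq_of_bl_eq {u v w : Fin n} (h : part lam (bl lam u) = 2) (huv : u ≠ v)
    (hb : bl lam u = bl lam v) (hw : bl lam w = bl lam u) : w = u ∨ w = v := by
  have h1 := ps_lt lam u
  have h2 := ps_lt lam v
  have h3 := ps_lt lam w
  rw [← hb] at h2
  rw [hw] at h3
  have h4 : ps lam u ≠ ps lam v := fun h => huv (block_ext hb h)
  by_cases h5 : ps lam w = ps lam u
  · exact .inl (block_ext hw h5)
  · exact .inr (block_ext (hw.trans hb) (by omega))

theorem blk_ng {u v : Fin n} (h : part lam (bl lam u) = 2) (huv : u ≠ v)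
    (hb : bl lam u = bl lam v) : blk (ng lam (bl lam u)) = sgnSwap u v (-1) := by
  have hmove : ∀ k, bl lam k = bl lam u → (blk (ng lam (bl lam u))).perm k ≠ k := by
    intro k hk h0
    have h1 := ps_blk (ng lam (bl lam u)) k
    rw [h0, hk, h, ng_sgn, if_pos rfl, flp, if_neg (by decide)] at h1
    omega
  have hbl : ∀ k, bl lam ((blk (ng lam (bl lam u))).perm k) = bl lam k := fun k => bl_blk _ k
  refine SP.ext_iff'.2 fun k => ?_
  by_cases hk : bl lam k = bl lam u
  · have h1 := eq_or_eq_of_bl_eq h huv hb ((hbl k).trans hk)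
    have h2 := hmove k hk
    rcases eq_or_eq_of_bl_eq h huv hb hk with rfl | rfl
    · exact ⟨by simpa [sgnSwap] using h1.resolve_left h2, by simp [sgnSwap, ng_sgn]⟩
    · exact ⟨by simpa [sgnSwap] using h1.resolve_right h2, by simp [sgnSwap, ng_sgn, hk]⟩
  · have hku : k ≠ u := by rintro rfl; exact hk rfl
    have hkv : k ≠ v := by rintro rfl; exact hk hb.symm
    refine ⟨?_, by simp [sgnSwap, hku, hkv, ng_sgn, hk]⟩
    change _ = Equiv.swap u v k
    rw [Equiv.swap_apply_of_ne_of_ne hku hkv]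
    refine block_ext (hbl k) ?_
    rw [ps_blk, ng_sgn, if_neg hk, flp_one]

theorem inner_root (u v a b : Fin n) (η : ℤˣ) :
    ⟪e u - ((η : ℤ) : ℝ) • e v, (e a - e b : E n)⟫_ℝ = (if u = a then 1 else 0) -
      (if u = b then 1 else 0) - ((η : ℤ) : ℝ) * ((if v = a then 1 else 0) -
      (if v = b then 1 else 0)) := by
  simp only [inner_sub_left, inner_sub_right, inner_smul_left, inner_e, conj_trivial]
  ring

theorem mem_Q_of_orthogonal {u v : Fin n} (huv : u ≠ v) {η : ℤˣ}
    (h : ∀ a b, a ≠ b → bl lam a = bl lam b →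
      ⟪e u - ((η : ℤ) : ℝ) • e v, (e a - e b : E n)⟫_ℝ = 0) : toO (sgnSwap u v η) ∈ Q lam := by
  refine Subgroup.subset_closure ⟨toO_mem_WD.2 (prod_sgnSwap huv η), _, sub_smul_ne_zero huv η,
    toO_sgnSwap huv η, fun β hβ hβP => ?_⟩
  obtain ⟨a, b, θ, hab, h1, c, hc, h2⟩ := exists_of_refl_mem_WD hβ (young_le hβP)
  rw [h1, toO_sgnSwap_mem_young] at hβP
  obtain ⟨h3, rfl⟩ := hβP
  have h4 := h a b hab h3
  have h5 : (e a - e b : E n) = c • β := by rw [← h2]; simp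
  rw [h5, inner_smul_right] at h4
  exact (mul_eq_zero.1 h4).resolve_left hc

theorem sgnSwap_mem_Q_of_part_one {u v : Fin n} (huv : u ≠ v) (hu : part lam (bl lam u) = 1)
    (hv : part lam (bl lam v) = 1) (η : ℤˣ) : toO (sgnSwap u v η) ∈ Q lam := by
  refine mem_Q_of_orthogonal huv fun a b hab hb => ?_
  have h1 : ∀ w, part lam (bl lam w) = 1 → w ≠ a ∧ w ≠ b := by
    intro w hw
    constructor
    · rintro rfl; exact hab (eq_of_bl_eq hw hb)
    · rintro rfl; exact hab (eq_of_bl_eq hw hb.symm).symm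
  rw [inner_root, if_neg (h1 u hu).1, if_neg (h1 u hu).2, if_neg (h1 v hv).1, if_neg (h1 v hv).2]
  ring

theorem sgnSwap_mem_Q_of_part_two {u v : Fin n} (huv : u ≠ v) (hu : part lam (bl lam u) = 2)
    (hb : bl lam u = bl lam v) : toO (sgnSwap u v (-1)) ∈ Q lam := by
  refine mem_Q_of_orthogonal huv fun a b hab hb' => ?_
  rw [inner_root]
  by_cases ha : bl lam a = bl lam u
  · rcases eq_or_eq_of_bl_eq hu huv hb ha with rfl | rfl <;>
      rcases eq_or_eq_of_bl_eq hu huv hb (hb'.symm.trans ha) with rfl | rfl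
    · exact absurd rfl hab
    · simp [hab, Ne.symm hab]
    · simp [hab, Ne.symm hab]
    · exact absurd rfl hab
  · have h1 : u ≠ a := by rintro rfl; exact ha rfl
    have h2 : v ≠ a := by rintro rfl; exact ha hb.symm
    have h3 : u ≠ b := by rintro rfl; exact ha hb'
    have h4 : v ≠ b := by rintro rfl; exact ha (hb'.trans hb.symm)
    simp [h1, h2, h3, h4]

/-- The orthogonal complement of the standard parabolic subgroup: a vector `e_u - η e_v` orthogonal
to all roots of the blocks has `u`, `v` in blocks of size `1`, or it is `e_u + e_v` for a block
`{u, v}`. -/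
theorem Q_eq : Q lam = (Qsub lam).map bO := by
  apply le_antisymm
  · rw [Q, orthComplement, Subgroup.closure_le]
    rintro t ⟨ht, α, h0, rfl, h⟩
    obtain ⟨u, v, η, huv, h1, c, hc, h2⟩ := exists_of_refl_mem_WD h0 ht
    have h3 : ∀ a b, a ≠ b → bl lam a = bl lam b →
        ⟪e u - ((η : ℤ) : ℝ) • e v, (e a - e b : E n)⟫_ℝ = 0 := by
      intro a b hab hb
      rw [h2, inner_smul_left, h _ (by simpa using sub_smul_ne_zero hab 1), mul_zero]
      have := (toO_sgnSwap_mem_young (lam := lam) (u := a) (v := b) (η := 1)).2 ⟨hb, rfl⟩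
      rw [toO_sgnSwap hab] at this
      simpa using this
    rw [h1]
    rw [h1] at ht
    -- if `u`, `v` lie in one block, then `η = -1` and the block has no further point; otherwise
    -- both blocks are singletons
    by_cases hb : bl lam u = bl lam v
    · have hη : η = -1 := by
        have := h3 u v huv hb
        rw [inner_root] at this
        rcases Int.units_eq_one_or η with rfl | rfl
        · simp [huv, Ne.symm huv] at this
        · rfl
      subst hη
      have hall : ∀ w, bl lam w = bl lam u → w = u ∨ w = v := by
        intro w hw
        by_contra hcon
        push Not at hcon
        have := h3 u w hcon.1.symm hw.symm
        rw [inner_root] at this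
        simp [hcon.1.symm, Ne.symm huv, hcon.2.symm] at this
      have hcard : part lam (bl lam u) = 2 := by
        rw [← card_block, ← Finset.card_pair huv]
        congr 1
        ext w
        simp only [Finset.mem_filter, Finset.mem_univ, true_and, Finset.mem_insert,
          Finset.mem_singleton]
        exact ⟨hall w, by rintro (rfl | rfl); exacts [rfl, hb.symm]⟩
      rw [← blk_ng hcard huv hb, ← bO_apply]
      refine Subgroup.mem_map_of_mem _ ⟨by rw [chi_ng, hcard]; rfl, fun i =>
        ⟨fun _ => rfl, fun hi => ?_⟩⟩
      rw [ng_sgn, if_neg (by rintro rfl; omega)]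
    · have hone : ∀ w, (∀ w', w' ≠ w → bl lam w ≠ bl lam w') → part lam (bl lam w) = 1 := by
        intro w hw
        rw [← card_block, Finset.card_eq_one]
        refine ⟨w, ?_⟩
        ext w'
        simp only [Finset.mem_filter, Finset.mem_univ, true_and, Finset.mem_singleton]
        exact ⟨fun h' => by_contra fun h'' => hw w' h'' h'.symm, fun h' => by rw [h']⟩
      have hu : part lam (bl lam u) = 1 := hone u fun w hw hbw => by
        have := h3 u w hw.symm hbw
        have hvw : v ≠ w := by rintro rfl; exact hb hbw
        rw [inner_root] at this
        simp [hw.symm, Ne.symm huv, hvw] at this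
      have hv : part lam (bl lam v) = 1 := hone v fun w hw hbw => by
        have := h3 v w hw.symm hbw
        have huw : u ≠ w := by rintro rfl; exact hb hbw.symm
        rw [inner_root] at this
        simp [hw.symm, huv, huw] at this
      rw [← blk_gsw hu hv, ← bO_apply] at ht ⊢
      refine Subgroup.mem_map_of_mem _ ⟨bO_mem_WD.1 ht, fun i => ⟨fun hi => ?_, fun hi => ?_⟩⟩
      · rw [gsw_perm]
        exact Equiv.swap_apply_of_ne_of_ne (by rintro rfl; exact hi hu) (by rintro rfl; exact hi hv)
      · rw [gsw_sgn, if_neg]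
        rintro (rfl | rfl) <;> omega
  · have hgsw : ∀ (i : ℕ) (hi : i + 1 < len lam) (h : part lam i = part lam (i + 1)) (η : ℤˣ),
        part lam i = 1 → bO (gsw lam ⟨i, by omega⟩ ⟨i + 1, hi⟩ h η) ∈ Q lam := by
      intro i hi h η h1
      obtain ⟨u, hu⟩ := exists_bl_eq (lam := lam) ⟨i, by omega⟩
      obtain ⟨v, hv⟩ := exists_bl_eq (lam := lam) ⟨i + 1, hi⟩
      have hu1 : part lam (bl lam u) = 1 := by rw [hu]; exact h1
      have hv1 : part lam (bl lam v) = 1 := by rw [hv]; exact h.symm.trans h1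
      have := sgnSwap_mem_Q_of_part_one (u := u) (v := v) (by
        rintro rfl
        have := congrArg Fin.val (hu.symm.trans hv)
        simp at this) hu1 hv1 η
      rw [← blk_gsw hu1 hv1, ← bO_apply] at this
      convert this using 4
      · exact (congrArg Fin.val hu).symm
      · exact (congrArg Fin.val hv).symm
    apply map_Qsub_le
    · intro i h h1
      have hi : i + 1 < len lam := lt_len_of_pos (by omega)
      rw [x_eq i hi h, ← gsw_one]
      exact hgsw i hi h 1 h1
    · intro i h h1
      have hi : i + 1 < len lam := lt_len_of_pos (by omega)
      rw [y'_eq i hi h, ← gsw_neg_one _ _ _ (by simp)]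
      exact hgsw i hi h (-1) h1
    · intro i h
      have hi : i < len lam := lt_len_of_pos (by omega)
      rw [y_eq i hi]
      have h0 : bl lam (pt lam ⟨i, hi⟩ 0 (by simp [h])) = ⟨i, hi⟩ := bl_pt _ _ _
      have h1 : bl lam (pt lam ⟨i, hi⟩ 1 (by simp [h])) = ⟨i, hi⟩ := bl_pt _ _ _
      have huv : pt lam ⟨i, hi⟩ 0 (by simp [h]) ≠ pt lam ⟨i, hi⟩ 1 (by simp [h]) := fun h' => by
        have := congrArg (ps lam) h'
        simp at this
      have h2 := sgnSwap_mem_Q_of_part_two (lam := lam) huv (by rw [h0]; exact h) (by rw [h0, h1])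
      rw [← blk_ng (lam := lam) (by rw [h0]; exact h) huv (by rw [h0, h1]), h0] at h2
      exact h2

/-! ### The product of the standard parabolic subgroup with its orthogonal complement -/

theorem Q_le : Q lam ≤ WD n := orthComplement_le _

theorem bO_mem_young {t : Gam lam} (h : bO t ∈ young lam) : t = 1 := by
  rw [bO_apply, toO_mem_young] at h
  refine Gam.eq_one fun i => ?_
  obtain ⟨v, rfl⟩ := exists_bl_eq i
  have := h v
  rwa [bl_blk, blk_sgn] at this

theorem young_comm_Q {p q : O n} (hp : p ∈ young lam) (hq : q ∈ Q lam) : p * q = q * p := by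
  have h : Q lam ≤ Subgroup.centralizer (young lam : Set (O n)) := by
    rw [Q, orthComplement, Subgroup.closure_le]
    rintro t ⟨ht, α, h0, rfl, h⟩
    have h1 : young lam ≤ Subgroup.centralizer {refl α} := by
      refine young_le_of_swap fun u v huv hb => ?_
      have h2 : toO (SP.ofPerm (Equiv.swap u v)) ∈ young lam := by
        rw [← sgnSwap_one]
        exact toO_sgnSwap_mem_young.2 ⟨hb, rfl⟩
      rw [← sgnSwap_one, toO_sgnSwap huv] at h2 ⊢
      rw [Subgroup.mem_centralizer_singleton_iff]
      have h3 := conj_refl (refl (e u - (((1 : ℤˣ) : ℤ) : ℝ) • e v)) α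
      rw [refl_of_inner_eq_zero (v := α) (by
        rw [real_inner_comm]; exact h _ (sub_smul_ne_zero huv 1) h2), mul_inv_eq_iff_eq_mul] at h3
      exact h3
    exact Subgroup.mem_centralizer_iff.2 fun p hp =>
      Subgroup.mem_centralizer_singleton_iff.1 (h1 hp)
  exact Subgroup.mem_centralizer_iff.1 (h hq) p hp

theorem young_inf_Q : young lam ⊓ Q lam = ⊥ := by
  rw [eq_bot_iff]
  rintro g ⟨h1, h2⟩
  rw [Q_eq] at h2
  obtain ⟨t, -, rfl⟩ := h2
  rw [bO_mem_young h1, map_one]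
  exact one_mem _

theorem isDirect_young_Q : IsDirect (young lam) (Q lam) (young lam ⊔ Q lam) :=
  ⟨rfl, young_inf_Q, fun _ hp _ hq => young_comm_Q hp hq⟩

theorem exists_mul_of_mem_sup {H K : Subgroup (O n)}
    (h : K ≤ Subgroup.normalizer (H : Set (O n))) {g : O n} (hg : g ∈ H ⊔ K) :
    ∃ a ∈ H, ∃ b ∈ K, a * b = g := by
  rw [sup_comm] at hg
  have h1 : g ∈ ((K ⊔ H : Subgroup (O n)) : Set (O n)) := hg
  rw [Subgroup.coe_mul_of_left_le_normalizer_right K H h] at h1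
  obtain ⟨k, hk, a, ha, rfl⟩ := Set.mem_mul.1 h1
  exact ⟨k * a * k⁻¹, (Subgroup.mem_normalizer_iff.1 (h hk) a).1 ha, k, hk, by group⟩

theorem Q_le_normalizer_young : Q lam ≤ Subgroup.normalizer (young lam : Set (O n)) :=
  le_normalizer_of_conj fun q hq p hp => by
    rw [← young_comm_Q hp hq, mul_inv_cancel_right]
    exact hp

variable (lam) in
/-- Signed permutations that stabilize the blocks of size at least `2` and the set of the points
in blocks of size `1`, without signs on the blocks of size greater than `2`. -/
def Lsub : Subgroup (SP (Fin n)) where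
  carrier := {s | ∀ v, (part lam (bl lam v) ≠ 1 → bl lam (s.perm v) = bl lam v) ∧
    (part lam (bl lam v) = 1 → part lam (bl lam (s.perm v)) = 1) ∧
    (2 < part lam (bl lam v) → s.sgn v = 1)}
  mul_mem' {s t} hs ht v := by
    refine ⟨fun h => ?_, fun h => ?_, fun h => ?_⟩
    · have h1 := (ht v).1 h
      exact ((hs (t.perm v)).1 (by rwa [h1])).trans h1
    · exact (hs (t.perm v)).2.1 ((ht v).2.1 h)
    · rw [SP.mul_sgn, (ht v).2.2 h, mul_one]
      exact (hs _).2.2 (by rwa [(ht v).1 (by omega)])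
  one_mem' v := ⟨fun _ => rfl, fun h => h, fun _ => rfl⟩
  inv_mem' {s} hs v := by
    obtain ⟨w, rfl⟩ := s.perm.surjective v
    have h1 : s.perm⁻¹ (s.perm w) = w := s.perm.symm_apply_apply w
    have := hs w
    simp only [SP.inv_perm, SP.inv_sgn, h1]
    refine ⟨fun h => ?_, fun h => ?_, fun h => ?_⟩
    · exact (this.1 fun h' => h (this.2.1 h')).symm
    · by_contra h'
      rw [this.1 h'] at h
      exact h' h
    · by_cases h' : part lam (bl lam w) = 1
      · rw [this.2.1 h'] at h
        omega
      · rw [this.1 h'] at h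
        exact this.2.2 h

theorem young_sup_Q_le : young lam ⊔ Q lam ≤ (Lsub lam).map toO := by
  refine sup_le ?_ ?_
  · intro g hg
    obtain ⟨s, rfl, hs⟩ := exists_of_mem_young hg
    exact Subgroup.mem_map_of_mem _ fun v => ⟨fun _ => (hs v).1, fun h => by rwa [(hs v).1],
      fun _ => (hs v).2⟩
  · rw [Q_eq]
    rintro _ ⟨t, ht, rfl⟩
    refine Subgroup.mem_map_of_mem _ fun v => ?_
    rw [bl_blk, blk_sgn]
    exact ⟨(ht.2 _).1, fun h => by rwa [part_perm], (ht.2 _).2⟩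

/-- The reflections in the product of the standard parabolic subgroup with its orthogonal
complement. -/
theorem sgnSwap_mem_young_sup_Q {u v : Fin n} (huv : u ≠ v) {η : ℤˣ} :
    toO (sgnSwap u v η) ∈ young lam ⊔ Q lam ↔
      (bl lam u = bl lam v ∧ (η = 1 ∨ part lam (bl lam u) = 2)) ∨
      (part lam (bl lam u) = 1 ∧ part lam (bl lam v) = 1) := by
  constructor
  · intro h
    have h1 := (Subgroup.mem_map_iff_mem toO_injective).1 (young_sup_Q_le h) u
    simp only [sgnSwap, Equiv.swap_apply_left, true_or, if_true] at h1
    by_cases h2 : part lam (bl lam u) = 1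
    · exact .inr ⟨h2, h1.2.1 h2⟩
    · refine .inl ⟨(h1.1 h2).symm, ?_⟩
      by_cases h3 : part lam (bl lam u) = 2
      · exact .inr h3
      · have := part_pos lam (bl lam u)
        exact .inl (h1.2.2 (by omega))
  · rintro (⟨h1, h2⟩ | ⟨h1, h2⟩)
    · rcases Int.units_eq_one_or η with rfl | rfl
      · exact Subgroup.mem_sup_left (toO_sgnSwap_mem_young.2 ⟨h1, rfl⟩)
      · exact Subgroup.mem_sup_right (sgnSwap_mem_Q_of_part_two huv
          (h2.resolve_left (by decide)) h1)
    · exact Subgroup.mem_sup_right (sgnSwap_mem_Q_of_part_one huv h1 h2 η)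

theorem Dsub_le : Dsub lam ≤ KS lam fun _ => True := fun _ ht =>
  ⟨fun _ hi => absurd trivial hi, ht.1⟩

theorem D_le_N : D lam ≤ N lam := fun _ h => h.1

theorem D_le_howlett : D lam ≤ howlett (N lam) (posRoots (young lam) (stdRho n)) := by
  refine le_howlett D_le_N fun g hg α hα => ?_
  have hα' : α ∈ posRoots (young lam ⊔ Q lam) (stdRho n) :=
    ⟨⟨hα.1.1, Subgroup.mem_sup_left hα.1.2⟩, hα.2⟩
  have h1 : g α ∈ posRoots (young lam ⊔ Q lam) (stdRho n) := by
    rw [← hg.2]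
    exact ⟨α, hα', rfl⟩
  refine ⟨⟨h1.1.1, ?_⟩, h1.2⟩
  rw [← conj_refl]
  exact (Subgroup.mem_normalizer_iff.1 (Subgroup.mem_inf.1 hg.1).2 _).1 hα.1.2

/-- The Howlett complement of the product of the standard parabolic subgroup with its orthogonal
complement. On the blocks of size `1` an element has to preserve all `e_u ± e_v` with `u < v`, so
it can only change the sign of the last one. -/
theorem D_eq : D lam = (Dsub lam).map bO := by
  apply le_antisymm
  · intro g hg
    have hg' := D_le_howlett hg
    rw [howlett_young_eq] at hg'
    obtain ⟨t, ht, rfl⟩ := hg'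
    have key : ∀ u v η, u < v → toO (sgnSwap u v η) ∈ young lam ⊔ Q lam →
        ((blk t).perm u < (blk t).perm v ∧ (blk t).sgn u = 1) ∨
        ((blk t).perm v < (blk t).perm u ∧ η * (blk t).sgn v = -1) := by
      intro u v η huv h
      have h1 : bO t (e u - ((η : ℤ) : ℝ) • e v) ∈
          posRoots (young lam ⊔ Q lam) (stdRho n) := by
        rw [← hg.2]
        exact ⟨_, mem_posRoots_std.2 ⟨u, v, η, huv, rfl, h⟩, rfl⟩
      rw [bO_apply, toO_root_form, mem_posRoots_std] at h1
      obtain ⟨u', v', η', huv', h2, -⟩ := h1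
      rcases root_form_unique (fun h => huv.ne ((blk t).perm.injective h)) huv' h2 with
        ⟨rfl, rfl, h3, h4⟩ | ⟨rfl, rfl, h3, h4⟩
      · exact .inl ⟨huv', h3⟩
      · exact .inr ⟨huv', h3⟩
    -- both `e_u - e_v` and `e_u + e_v` are positive roots of `Q` if `u < v` are blocks of size `1`,
    -- so the order of the two is preserved and the first sign is `1`
    have hone : ∀ i j : Fin (len lam), part lam i = 1 → part lam j = 1 → i < j →
        t.1.perm i < t.1.perm j ∧ t.1.sgn i = 1 := by
      intro i j hi hj hij
      obtain ⟨u, rfl⟩ := exists_bl_eq i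
      obtain ⟨v, rfl⟩ := exists_bl_eq j
      have huv := lt_of_bl_lt hij
      have h1 := key u v 1 huv ((sgnSwap_mem_young_sup_Q huv.ne).2 (.inr ⟨hi, hj⟩))
      have h2 := key u v (-1) huv ((sgnSwap_mem_young_sup_Q huv.ne).2 (.inr ⟨hi, hj⟩))
      have h3 : (blk t).perm u < (blk t).perm v ∧ (blk t).sgn u = 1 := by
        rcases h1 with h1 | h1
        · exact h1
        · rcases h2 with h2 | h2
          · exact h2
          · have h4 := h1.2
            have h5 := h2.2
            rw [one_mul] at h4
            rw [h4] at h5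
            exact absurd h5 (by decide)
      refine ⟨?_, h3.2⟩
      rw [← bl_blk, ← bl_blk]
      by_contra hcon
      rcases (not_lt.1 hcon).eq_or_lt with h4 | h4
      · rw [bl_blk, bl_blk] at h4
        exact hij.ne' (t.1.perm.injective h4)
      · exact absurd h3.1 (not_lt.2 (lt_of_bl_lt h4).le)
    refine Subgroup.mem_map_of_mem _ ⟨ht.2, fun i => ⟨fun hi => ?_, fun hi => ⟨?_, fun hl => ?_⟩⟩⟩
    -- a sign on a block `{u, v}` of size `2` would make the root `e_u + e_v` of `Q` negative
    · have h0 : bl lam (pt lam i 0 (by omega)) = i := bl_pt _ _ _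
      have h1 : bl lam (pt lam i 1 (by omega)) = i := bl_pt _ _ _
      have hlt : pt lam i 0 (by omega) < pt lam i 1 (by omega) := by
        rw [lt_iff_of_bl_eq (h0.trans h1.symm), ps_pt, ps_pt]
        exact Nat.one_pos
      have h2 := key _ _ (-1) hlt ((sgnSwap_mem_young_sup_Q hlt.ne).2
        (.inl ⟨h0.trans h1.symm, .inr (by rw [h0, hi])⟩))
      rw [blk_sgn, blk_sgn, h0, h1] at h2
      rcases h2 with h2 | h2
      · exact h2.2
      · have := h2.2
        rwa [neg_one_mul, neg_inj] at this
    · -- a strictly monotone permutation of a finite linear order is trivial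
      let f : {i : Fin (len lam) // part lam i = 1} → {i : Fin (len lam) // part lam i = 1} :=
        fun i => ⟨t.1.perm i, (part_perm t i).trans i.2⟩
      have hf : StrictMono f := fun i j hij => (hone i j i.2 j.2 hij).1
      have hs : Function.Surjective f := Finite.surjective_of_injective hf.injective
      have h1 : hf.orderIsoOfSurjective f hs = OrderIso.refl _ := Subsingleton.elim _ _
      exact congrArg (fun g : _ ≃o _ => ((g ⟨i, hi⟩ : {i : Fin (len lam) // part lam i = 1}) :
        Fin (len lam))) h1
    · refine (hone i ⟨i + 1, hl⟩ hi ?_ (Fin.lt_def.2 (by simp))).2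
      have h1 : part lam (i + 1) ≤ part lam i := part_anti lam (by omega)
      have h2 : 0 < part lam (i + 1) := (part_pos_iff lam).2 hl
      dsimp only
      omega
  · apply le_howlett ((Subgroup.map_mono Dsub_le).trans (map_KS_le_N _))
    rintro _ ⟨t, ht, rfl⟩ α hα
    obtain ⟨u, v, η, huv, rfl, h⟩ := mem_posRoots_std.1 hα
    rw [sgnSwap_mem_young_sup_Q huv.ne] at h
    rcases h with ⟨hb, h⟩ | ⟨hu, hv⟩
    · by_cases hη : η = 1
      · subst hη
        have := orderSgn_iff.1 (orderSgn_blk t) _ (mem_posRoots_young.2 ⟨u, v, huv, hb, rfl⟩)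
        exact ⟨⟨this.1.1, Subgroup.mem_sup_left this.1.2⟩, this.2⟩
      · have h2 := h.resolve_left hη
        have hsu : (blk t).sgn u = 1 := (ht.2 _).1 h2
        have hsv : (blk t).sgn v = 1 := (ht.2 _).1 (by rw [← hb, h2])
        have h1 : bl lam ((blk t).perm u) = bl lam ((blk t).perm v) := by rw [bl_blk, bl_blk, hb]
        have h3 : (blk t).perm u < (blk t).perm v := by
          rcases (orderSgn_blk t u v huv hb).2 with h4 | h4
          · exact h4.1
          · rw [hsu] at h4; exact absurd h4.2.1 (by decide)
        rw [bO_apply, toO_root_form, hsu, hsv, mem_posRoots_std]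
        refine ⟨_, _, η, h3, by simp, (sgnSwap_mem_young_sup_Q h3.ne).2
          (.inl ⟨h1, .inr ?_⟩)⟩
        rw [bl_blk, part_perm, h2]
    · have hfix : ∀ w, part lam (bl lam w) = 1 → (blk t).perm w = w := fun w hw =>
        (eq_of_bl_eq hw (by rw [bl_blk, ((ht.2 _).2 hw).1])).symm
      have hsu : (blk t).sgn u = 1 := by
        refine ((ht.2 _).2 hu).2 ?_
        have h1 : bl lam u < bl lam v := by
          by_contra hcon
          rcases (not_lt.1 hcon).eq_or_lt with h4 | h4
          · exact huv.ne' (eq_of_bl_eq hv h4)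
          · exact absurd huv (not_lt.2 (lt_of_bl_lt h4).le)
        have := (bl lam v).2
        have := Fin.lt_def.1 h1
        omega
      rw [bO_apply, toO_root_form, hsu, hfix u hu, hfix v hv, mem_posRoots_std]
      exact ⟨u, v, η * (blk t).sgn v, huv, by rw [Units.val_one, Int.cast_one, one_smul],
        (sgnSwap_mem_young_sup_Q huv.ne).2 (.inr ⟨hu, hv⟩)⟩

theorem Dsub_inf_Qsub {t : Gam lam} (h : t ∈ Dsub lam) (h' : t ∈ Qsub lam) : t = 1 := by
  have hsgn : ∀ i : Fin (len lam), (i : ℕ) + 1 < len lam ∨ part lam i ≠ 1 → t.1.sgn i = 1 := by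
    intro i hi
    have h0 := part_pos lam i
    by_cases h1 : part lam i = 1
    · exact ((h.2 i).2 h1).2 (hi.resolve_right (not_not.2 h1))
    by_cases h2 : part lam i = 2
    · exact (h.2 i).1 h2
    · exact (h'.2 i).2 (by omega)
  refine Gam.eq_one fun i => ⟨?_, ?_⟩
  · by_cases h1 : part lam i = 1
    · exact ((h.2 i).2 h1).1
    · exact (h'.2 i).1 h1
  · by_cases hi : (i : ℕ) + 1 < len lam ∨ part lam i ≠ 1
    · exact hsgn i hi
    · push Not at hi
      have h1 := h.1
      rw [chi_eq, Finset.prod_eq_single i, hi.2, pow_one] at h1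
      · exact h1
      · intro j _ hj
        rw [hsgn j, one_pow]
        left
        have := j.2
        have : (j : ℕ) ≠ i := fun h => hj (Fin.ext h)
        omega
      · simp

/-- `N = (P × Q) ⋊ D`: an element of `N` maps the positive roots of `P × Q` to another positive
system, which an element of `P × Q` moves back. -/
theorem isSemidirect_D : IsSemidirect (young lam ⊔ Q lam) (D lam) (N lam) := by
  have hle : young lam ⊔ Q lam ≤ WD n := sup_le young_le Q_le
  have hN : N lam ≤ Subgroup.normalizer ((young lam ⊔ Q lam : Subgroup (O n)) : Set (O n)) := by
    refine le_normalizer_of_conj fun g hg p hp => ?_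
    have h1 : young lam ⊔ Q lam ≤ (young lam ⊔ Q lam).comap (MulAut.conj g).toMonoidHom :=
      sup_le (fun p hp => Subgroup.mem_sup_left
          ((Subgroup.mem_normalizer_iff.1 (Subgroup.mem_inf.1 hg).2 p).1 hp))
        (fun q hq => Subgroup.mem_sup_right (conj_mem_orthComplement hg hq))
    exact h1 hp
  have hPQ : young lam ⊔ Q lam ≤ N lam :=
    le_inf hle (sup_le Subgroup.le_normalizer Q_le_normalizer_young)
  refine ⟨le_antisymm (sup_le hPQ D_le_N) fun g hg => ?_, ?_, D_le_N.trans hN⟩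
  · have hgW : g ∈ WD n := (Subgroup.mem_inf.1 hg).1
    have h1 := image_posRoots hgW (young lam ⊔ Q lam) (stdRho n)
    rw [map_conj_eq_of_mem_normalizer (hN hg)] at h1
    have hreg : IsRegular (young lam ⊔ Q lam) (g (stdRho n)) := by
      intro α hα
      rw [← inner_inv']
      refine isRegular_stdRho (young lam ⊔ Q lam) _ ⟨apply_mem_rootsD (inv_mem hgW) hα.1, ?_⟩
      rw [← conj_refl]
      exact (Subgroup.mem_normalizer_iff.1 (inv_mem (hN hg)) _).1 hα.2
    obtain ⟨w, hw, h2⟩ := exists_image_posRoots_eq hle (isRegular_stdRho _) hreg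
    -- `w` moves the positive system `g Φ⁺` back to `Φ⁺`
    have h3 : w * g ∈ D lam := by
      refine ⟨mul_mem (hPQ hw) hg, ?_⟩
      rw [← h1, Set.image_image] at h2
      exact h2
    have h4 : g = w⁻¹ * (w * g) := by group
    rw [h4]
    exact mul_mem (Subgroup.mem_sup_left (inv_mem hw)) (Subgroup.mem_sup_right h3)
  · rw [eq_bot_iff]
    rintro g ⟨h1, h2⟩
    obtain ⟨p, hp, q, hq, rfl⟩ := exists_mul_of_mem_sup Q_le_normalizer_young h1
    have h3 : p * q ∈ D lam := h2
    rw [D_eq] at h3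
    rw [Q_eq] at hq
    obtain ⟨d, hd, hd'⟩ := h3
    obtain ⟨t, ht, rfl⟩ := hq
    have h4 : p = bO (d * t⁻¹) := by rw [map_mul, map_inv, hd', mul_inv_cancel_right]
    rw [h4] at hp
    have h5 : d = t := mul_inv_eq_one.1 (bO_mem_young hp)
    subst h5
    rw [← hd', Dsub_inf_Qsub hd ht, map_one]
    exact one_mem _

end Ortho

/-! ### Fixed spaces and pointwise stabilizers -/

section Spaces
variable {n : ℕ} {lam : n.Partition}

theorem X_eq : X lam = Submodule.span ℝ (Set.range (bvec : Fin (len lam) → E n)) := by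
  apply le_antisymm
  · intro v hv
    have h1 : ∀ a b, bl lam a = bl lam b → v a = v b := by
      intro a b hab
      have h2 := hv (toO (sgnSwap a b 1)) (toO_sgnSwap_mem_young.2 ⟨hab, rfl⟩)
      have h3 := toO_apply_coord (sgnSwap a b 1) v b
      rw [h2] at h3
      simpa [sgnSwap] using h3
    refine (Submodule.mem_span_range_iff_exists_fun ℝ).2
      ⟨fun i => √(part lam i) * v (pt lam i 0 (part_pos lam i)), ?_⟩
    ext a
    rw [WithLp.ofLp_sum, Finset.sum_apply, Finset.sum_eq_single (bl lam a)]
    · rw [PiLp.smul_apply, bvec_apply, if_pos rfl, smul_eq_mul]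
      dsimp only
      rw [h1 _ a (bl_pt _ _ _)]
      have : (0 : ℝ) < √(part lam (bl lam a)) :=
        Real.sqrt_pos.2 (by exact_mod_cast part_pos lam (bl lam a))
      field_simp
    · intro i _ hi
      rw [PiLp.smul_apply, bvec_apply, if_neg hi.symm, smul_zero]
    · simp
  · rw [Submodule.span_le]
    rintro _ ⟨i, rfl⟩ g hg
    obtain ⟨s, rfl, hs⟩ := exists_of_mem_young hg
    ext a
    obtain ⟨a, rfl⟩ := s.perm.surjective a
    rw [toO_apply_coord, bvec_apply, bvec_apply, (hs a).1, (hs a).2]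
    simp

variable (lam) in
/-- The blocks moved by `Q`: those of size `2`, and those of size `1` if there are several. -/
def Jset : Set (Fin (len lam)) := {i | part lam i = 2 ∨ (part lam i = 1 ∧ 1 < mult lam 1)}

theorem eq_of_part_one (h : mult lam 1 ≤ 1) {i j : Fin (len lam)} (hi : part lam i = 1)
    (hj : part lam j = 1) : i = j := by
  rw [mult_eq_card, Fintype.card_le_one_iff] at h
  exact congrArg Subtype.val (h ⟨i, hi⟩ ⟨j, hj⟩)

theorem exists_ne_of_part_one (h : 1 < mult lam 1) (i : Fin (len lam)) :
    ∃ j, j ≠ i ∧ part lam j = 1 := by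
  rw [mult_eq_card, Fintype.one_lt_card_iff] at h
  obtain ⟨a, b, hab⟩ := h
  by_cases ha : a.1 = i
  · exact ⟨b, fun hb => hab (Subtype.ext (ha.trans hb.symm)), b.2⟩
  · exact ⟨a, ha, a.2⟩

/-- A sign that is the only one at an odd block is `1` in `W(D_n)`. -/
theorem sgn_eq_one_of_chi {t : Gam lam} (h : chi lam t = 1) {i : Fin (len lam)}
    (hi : Odd (part lam i)) (h' : ∀ j, j ≠ i → Odd (part lam j) → t.1.sgn j = 1) :
    t.1.sgn i = 1 := by
  rw [chi_eq, Finset.prod_eq_single i] at h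
  · rcases Int.units_eq_one_or (t.1.sgn i) with h1 | h1
    · exact h1
    · rw [h1, hi.neg_one_pow] at h
      exact absurd h (by decide)
  · intro j _ hj
    rcases Nat.even_or_odd (part lam j) with he | ho
    · rcases Int.units_eq_one_or (t.1.sgn j) with h1 | h1
      · rw [h1, one_pow]
      · rw [h1, he.neg_one_pow]
    · rw [h' j hj ho, one_pow]
  · simp

theorem Qsub_trivial {t : Gam lam} (ht : t ∈ Qsub lam) {i : Fin (len lam)} (hi : i ∉ Jset lam) :
    t.1.perm i = i ∧ t.1.sgn i = 1 := by
  have h0 := part_pos lam i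
  by_cases h1 : part lam i = 1
  · have hm : mult lam 1 ≤ 1 := by
      by_contra h
      exact hi (.inr ⟨h1, by omega⟩)
    refine ⟨eq_of_part_one hm ((part_perm t i).trans h1) h1,
      sgn_eq_one_of_chi ht.1 (by rw [h1]; exact odd_one) fun j hj ho => (ht.2 j).2 ?_⟩
    have h2 : part lam j ≠ 1 := fun h => hj (eq_of_part_one hm h h1)
    obtain ⟨k, hk⟩ := ho
    omega
  · have h2 : part lam i ≠ 2 := fun h => hi (.inl h)
    exact ⟨(ht.2 i).1 h1, (ht.2 i).2 (by omega)⟩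

theorem inner_bvec (i j : Fin (len lam)) : ⟪bvec i, (bvec j : E n)⟫_ℝ = if i = j then 1 else 0 :=
  orthonormal_iff_ite.1 orthonormal_bvec i j

theorem Y_eq : Y lam = (Submodule.span ℝ (bvec '' Jset lam))ᗮ := by
  have hmem : ∀ v : E n, v ∈ (Submodule.span ℝ (bvec '' Jset lam))ᗮ ↔
      ∀ i ∈ Jset lam, ⟪bvec i, v⟫_ℝ = 0 := by
    intro v
    rw [Submodule.mem_orthogonal]
    constructor
    · exact fun h i hi => h _ (Submodule.subset_span ⟨i, hi, rfl⟩)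
    · intro h u hu
      induction hu using Submodule.span_induction with
      | mem u hu => obtain ⟨i, hi, rfl⟩ := hu; exact h i hi
      | zero => simp
      | add u w _ _ hu hw => rw [inner_add_left, hu, hw, add_zero]
      | smul c u _ hu => rw [inner_smul_left, hu, mul_zero]
  ext v
  rw [hmem]
  constructor
  · intro hv i hi
    -- some element of `Q` changes the sign of `bvec i`
    have key : ∃ t ∈ Qsub lam, t.1.perm i = i ∧ t.1.sgn i = -1 := by
      rcases hi with h2 | ⟨h1, hm⟩
      · refine ⟨ng lam i, ⟨by rw [chi_ng, h2]; rfl, fun j => ⟨fun _ => rfl, fun hj => ?_⟩⟩, rfl,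
          by rw [ng_sgn, if_pos rfl]⟩
        rw [ng_sgn, if_neg (by rintro rfl; omega)]
      · obtain ⟨j, hj, hj1⟩ := exists_ne_of_part_one hm i
        refine ⟨ng lam i * ng lam j, ⟨by rw [map_mul, chi_ng, chi_ng, h1, hj1]; rfl,
          fun k => ⟨fun _ => rfl, fun hk => ?_⟩⟩, rfl, ?_⟩
        · simp only [Subgroup.coe_mul, SP.mul_sgn, ng_perm, Equiv.Perm.one_apply, ng_sgn]
          rw [if_neg (by rintro rfl; omega), if_neg (by rintro rfl; omega), mul_one]
        · simp [ng_sgn, hj.symm]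
    obtain ⟨t, ht, h1, h2⟩ := key
    have h3 := hv (bO t) (by rw [Q_eq]; exact Subgroup.mem_map_of_mem _ ht)
    have h4 := (bO t).inner_map_map (bvec i) v
    rw [h3, acts_bO, h1, h2, inner_smul_left] at h4
    push_cast at h4
    simp only [conj_trivial] at h4
    linarith
  · intro hv g hg
    have hQ : Q lam ≤ pointwiseStab ⊤ (ℝ ∙ v) := by
      conv_lhs => rw [Q, orthComplement]
      rw [Subgroup.closure_le]
      intro s hs
      have hsQ : s ∈ Q lam := Subgroup.subset_closure hs
      obtain ⟨-, α, h0, rfl, -⟩ := hs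
      rw [Q_eq] at hsQ
      obtain ⟨t, ht, hα⟩ := hsQ
      have hex : ∃ i, ¬ (t.1.perm i = i ∧ t.1.sgn i = 1) := by
        by_contra hcon
        push Not at hcon
        rw [Gam.eq_one hcon, map_one] at hα
        have h1 : -α = α := by rw [← refl_self, ← hα]; rfl
        have h2 : (2 : ℝ) • α = 0 := by
          rw [two_smul]
          nth_rw 1 [← h1]
          abel
        exact h0 ((smul_eq_zero.1 h2).resolve_left two_ne_zero)
      obtain ⟨i, hi⟩ := hex
      have hiJ : i ∈ Jset lam := by
        by_contra h
        exact hi (Qsub_trivial ht h)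
      have hJ : t.1.perm i ∈ Jset lam := by
        have : part lam (t.1.perm i) = part lam i := part_perm t i
        simp only [Jset, Set.mem_ofPred_eq, this]
        exact hiJ
      have h1 := acts_bO t i
      rw [hα, refl_apply] at h1
      set c := 2 * ⟪α, bvec i⟫_ℝ / ‖α‖ ^ 2
      have h2 : c • α = bvec i - ((t.1.sgn i : ℤ) : ℝ) • bvec (t.1.perm i) := by rw [← h1]; abel
      have hc : c ≠ 0 := by
        intro hc
        rw [hc, zero_smul, eq_comm, sub_eq_zero] at h2
        have := sgn_smul_inj orthonormal_bvec (u := 1) (v := t.1.sgn i) (i := i)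
          (by rw [← h2]; simp)
        exact hi ⟨this.1.symm, this.2.symm⟩
      have h3 : c * ⟪α, v⟫_ℝ = 0 := by
        have : ⟪c • α, v⟫_ℝ = 0 := by
          rw [h2, inner_sub_left, inner_smul_left, hv i hiJ, hv _ hJ]
          simp
        rwa [inner_smul_left] at this
      refine ⟨trivial, fun w hw => ?_⟩
      obtain ⟨d, rfl⟩ := Submodule.mem_span_singleton.1 hw
      rw [map_smul, refl_of_inner_eq_zero ((mul_eq_zero.1 h3).resolve_left hc)]
    exact (hQ hg).2 v (Submodule.mem_span_singleton_self v)

theorem Yperp_eq : (Y lam)ᗮ = Submodule.span ℝ (bvec '' Jset lam) := by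
  rw [Y_eq, Submodule.orthogonal_orthogonal]

theorem X_inf_span_orthogonal (K : Set (Fin (len lam))) :
    X lam ⊓ (Submodule.span ℝ (bvec '' K))ᗮ = Submodule.span ℝ (bvec '' Kᶜ) := by
  apply le_antisymm
  · rintro v ⟨hX, hK⟩
    have hX' : v ∈ X lam := hX
    rw [X_eq] at hX'
    obtain ⟨c, rfl⟩ := (Submodule.mem_span_range_iff_exists_fun ℝ).1 hX'
    refine Submodule.sum_mem _ fun i _ => ?_
    by_cases hi : i ∈ K
    · have h1 := hK (bvec i) (Submodule.subset_span ⟨i, hi, rfl⟩)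
      rw [inner_sum, Finset.sum_eq_single i] at h1
      · rw [inner_smul_right, inner_bvec, if_pos rfl, mul_one] at h1
        rw [h1, zero_smul]
        exact zero_mem _
      · intro j _ hj
        rw [inner_smul_right, inner_bvec, if_neg hj.symm, mul_zero]
      · simp
    · exact Submodule.smul_mem _ _ (Submodule.subset_span ⟨i, hi, rfl⟩)
  · rw [Submodule.span_le]
    rintro _ ⟨i, hi, rfl⟩
    refine ⟨?_, ?_⟩
    · change bvec i ∈ X lam
      rw [X_eq]
      exact Submodule.subset_span ⟨i, rfl⟩
    · intro u hu
      induction hu using Submodule.span_induction with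
      | mem u hu =>
        obtain ⟨j, hj, rfl⟩ := hu
        rw [inner_bvec, if_neg (by rintro rfl; exact hi hj)]
      | zero => simp
      | add u w _ _ hu hw => rw [inner_add_left, hu, hw, add_zero]
      | smul c u _ hu => rw [inner_smul_left, hu, mul_zero]

theorem X_inf_Y_eq : X lam ⊓ Y lam = Submodule.span ℝ (bvec '' (Jset lam)ᶜ) := by
  rw [Y_eq, X_inf_span_orthogonal]

theorem bO_fixes_span_iff {t : Gam lam} {K : Set (Fin (len lam))} :
    (∀ v ∈ Submodule.span ℝ (bvec '' K), bO t v = v) ↔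
      ∀ i ∈ K, t.1.perm i = i ∧ t.1.sgn i = 1 := by
  constructor
  · intro h i hi
    have h1 := h _ (Submodule.subset_span ⟨i, hi, rfl⟩)
    rw [acts_bO] at h1
    exact sgn_smul_inj orthonormal_bvec (v := 1) (by rw [h1]; simp)
  · intro h v hv
    induction hv using Submodule.span_induction with
    | mem v hv =>
      obtain ⟨i, hi, rfl⟩ := hv
      rw [acts_bO, (h i hi).1, (h i hi).2]
      simp
    | zero => simp
    | add v w _ _ hv hw => rw [map_add, hv, hw]
    | smul c v _ hv => rw [map_smul, hv]

theorem mem_A_iff {t : Gam lam} :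
    bO t ∈ A lam ↔ t ∈ Dsub lam ∧ ∀ i ∈ Jset lam, t.1.perm i = i ∧ t.1.sgn i = 1 := by
  have h : bO t ∈ A lam ↔ bO t ∈ D lam ∧ ∀ v ∈ (Y lam)ᗮ, bO t v = v := Iff.rfl
  rw [h, Yperp_eq, bO_fixes_span_iff, D_eq, Subgroup.mem_map_iff_mem bO_injective]

theorem mem_B_iff {t : Gam lam} :
    bO t ∈ B lam ↔ t ∈ Dsub lam ∧ ∀ i ∉ Jset lam, t.1.perm i = i ∧ t.1.sgn i = 1 := by
  have h : bO t ∈ B lam ↔ bO t ∈ D lam ∧ ∀ v ∈ X lam ⊓ Y lam, bO t v = v := Iff.rfl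
  rw [h, X_inf_Y_eq, bO_fixes_span_iff, D_eq, Subgroup.mem_map_iff_mem bO_injective]
  rfl

theorem A_le_D : A lam ≤ D lam := fun _ h => h.1

theorem B_le_D : B lam ≤ D lam := fun _ h => h.1

theorem eq_map_of_mem_iff {H : Subgroup (O n)} (hH : H ≤ D lam) {K : Subgroup (Gam lam)}
    (h : ∀ t, bO t ∈ H ↔ t ∈ K) : H = K.map bO := by
  apply le_antisymm
  · intro g hg
    have hg' := hH hg
    rw [D_eq] at hg'
    obtain ⟨t, -, rfl⟩ := hg'
    exact Subgroup.mem_map_of_mem _ ((h t).1 hg)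
  · rintro _ ⟨t, ht, rfl⟩
    exact (h t).2 ht

theorem A_eq_of_le (hm : mult lam 1 ≤ 1) : A lam = (KS lam (· ≠ 2)).map bO := by
  refine eq_map_of_mem_iff A_le_D fun t => ?_
  rw [mem_A_iff]
  constructor
  · rintro ⟨h1, h2⟩
    exact ⟨fun i hi => h2 i (.inl (not_not.1 hi)), h1.1⟩
  · rintro ⟨h1, h2⟩
    refine ⟨⟨h2, fun i => ⟨fun hi => (h1 i (not_not.2 hi)).2, fun hi =>
      ⟨eq_of_part_one hm ((part_perm t i).trans hi) hi, fun hl => ?_⟩⟩⟩, fun i hi => ?_⟩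
    · have h3 : part lam (i + 1) ≤ part lam i := part_anti lam (by omega)
      have h4 : 0 < part lam (i + 1) := (part_pos_iff lam).2 hl
      have h5 := eq_of_part_one hm hi (j := ⟨i + 1, hl⟩) (by dsimp only; omega)
      have := congrArg Fin.val h5
      simp at this
    · rcases hi with hi | ⟨-, hi⟩
      · exact h1 i (not_not.2 hi)
      · omega

theorem A_eq_of_lt (hm : 1 < mult lam 1) : A lam = (KS lam (2 < ·)).map bO := by
  refine eq_map_of_mem_iff A_le_D fun t => ?_
  have hJ : ∀ i, i ∈ Jset lam ↔ ¬ 2 < part lam i := fun i => by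
    have := part_pos lam i
    change _ ∨ _ ↔ _
    omega
  rw [mem_A_iff]
  constructor
  · rintro ⟨h1, h2⟩
    exact ⟨fun i hi => h2 i ((hJ i).2 hi), h1.1⟩
  · rintro ⟨h1, h2⟩
    refine ⟨⟨h2, fun i => ⟨fun hi => (h1 i (by omega)).2, fun hi =>
      ⟨(h1 i (by omega)).1, fun _ => (h1 i (by omega)).2⟩⟩⟩, fun i hi => h1 i ((hJ i).1 hi)⟩

theorem B_eq : B lam = (Bsub lam).map bO := by
  refine eq_map_of_mem_iff B_le_D fun t => ?_
  rw [mem_B_iff]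
  constructor
  · rintro ⟨h1, h2⟩
    have h3 : ∀ i : Fin (len lam), part lam i ≠ 2 → t.1.perm i = i := fun i hi => by
      by_cases hi1 : part lam i = 1
      · exact ((h1.2 i).2 hi1).1
      · refine (h2 i ?_).1
        rintro (h | ⟨h, -⟩)
        · exact hi h
        · exact hi1 h
    have h4 : ∀ i : Fin (len lam), (part lam i = 1 → (i : ℕ) + 1 < len lam) → t.1.sgn i = 1 := by
      intro i hi
      by_cases hi1 : part lam i = 1
      · exact ((h1.2 i).2 hi1).2 (hi hi1)
      by_cases hi2 : part lam i = 2
      · exact (h1.2 i).1 hi2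
      · refine (h2 i ?_).2
        rintro (h | ⟨h, -⟩)
        · exact hi2 h
        · exact hi1 h
    have h5 : ∀ i, t.1.sgn i = 1 := by
      intro i
      by_cases hi : part lam i = 1 → (i : ℕ) + 1 < len lam
      · exact h4 i hi
      · push Not at hi
        refine sgn_eq_one_of_chi h1.1 (by rw [hi.1]; exact odd_one) fun j hj _ => h4 j fun _ => ?_
        have : (j : ℕ) ≠ i := fun h => hj (Fin.ext h)
        have := j.2
        omega
    exact ⟨fun i hi => ⟨h3 i hi, h5 i⟩, h5⟩
  · rintro ⟨h1, h2⟩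
    refine ⟨⟨chi_eq_one_of_sgn h2, fun i => ⟨fun _ => h2 i, fun hi =>
      ⟨(h1 i (by omega)).1, fun _ => h2 i⟩⟩⟩, fun i hi => ⟨(h1 i fun h => hi (.inl h)).1, h2 i⟩⟩

theorem isDirect_A_B : IsDirect (A lam) (B lam) (A lam ⊔ B lam) := by
  refine ⟨rfl, ?_, ?_⟩
  · rw [eq_bot_iff]
    rintro g ⟨h1, h2⟩
    have h3 := A_le_D h1
    rw [D_eq] at h3
    obtain ⟨t, -, rfl⟩ := h3
    classical
    have h4 := (mem_A_iff.1 h1).2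
    have h5 := (mem_B_iff.1 h2).2
    rw [Gam.eq_one fun i => if hi : i ∈ Jset lam then h4 i hi else h5 i hi, map_one]
    exact one_mem _
  · intro a ha b hb
    have ha' := A_le_D ha
    have hb' := B_le_D hb
    rw [D_eq] at ha' hb'
    obtain ⟨s, -, rfl⟩ := ha'
    obtain ⟨t, -, rfl⟩ := hb'
    rw [← map_mul, ← map_mul]
    congr 1
    exact Subtype.ext (SP.commute_of_disjoint (· ∈ Jset lam) (mem_A_iff.1 ha).2 (mem_B_iff.1 hb).2)

/-- Elements of `W(D_n)` that act on blocks of two kinds, of which one kind has even sizes only,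
decompose into a product. -/
theorem isDirect_KS {p q r : ℕ → Prop}
    (hr : ∀ i : Fin (len lam), r (part lam i) ↔ p (part lam i) ∨ q (part lam i))
    (hpq : ∀ k, p k → ¬ q k) (hp : ∀ k, p k → Even k) :
    IsDirect ((KS lam p).map bO) ((KS lam q).map bO) ((KS lam r).map bO) := by
  refine ⟨?_, ?_, ?_⟩
  · rw [← Subgroup.map_sup]
    congr 1
    apply le_antisymm
    · exact sup_le (fun t ht => ⟨fun i hi => ht.1 i fun h => hi ((hr i).2 (.inl h)), ht.2⟩)
        (fun t ht => ⟨fun i hi => ht.1 i fun h => hi ((hr i).2 (.inr h)), ht.2⟩)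
    · intro t ht
      have h1 := restr_mul_restr p t
      have h2 : chi lam (restr p t) = 1 := chi_eq_one_of_even (Gsub_mono hp (restr_mem p t))
      have h3 : chi lam (restr (fun k => ¬ p k) t) = 1 := by
        have := congrArg (chi lam) h1
        rwa [map_mul, h2, one_mul, show chi lam t = 1 from ht.2] at this
      rw [← h1]
      refine mul_mem (Subgroup.mem_sup_left ⟨restr_mem p t, h2⟩)
        (Subgroup.mem_sup_right ⟨fun i hi => ?_, h3⟩)
      by_cases hpi : p (part lam i)
      · exact restr_neg t (not_not.2 hpi)
      · rw [(restr_pos (p := fun k => ¬ p k) t hpi).1, (restr_pos (p := fun k => ¬ p k) t hpi).2]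
        exact ht.1 i fun h => ((hr i).1 h).elim hpi hi
  · rw [← Subgroup.map_inf _ _ _ bO_injective, eq_bot_iff]
    rintro _ ⟨t, ⟨h1, h2⟩, rfl⟩
    classical
    rw [Gam.eq_one (s := t) fun i => if hi : p (part lam i) then h2.1 i (hpq _ hi) else h1.1 i hi,
      map_one]
    exact one_mem _
  · rintro _ ⟨s, hs, rfl⟩ _ ⟨t, ht, rfl⟩
    rw [← map_mul, ← map_mul, Gam.commute hs.1 (Gsub_mono (fun k hk hk' => hpq k hk' hk) ht.1)]

theorem restr_two_mem_Bsub {t : Gam lam} (ht : t ∈ Dsub lam) : restr (· = 2) t ∈ Bsub lam := by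
  refine ⟨restr_mem _ t, fun i => ?_⟩
  by_cases hi : part lam i = 2
  · rw [(restr_pos (p := (· = 2)) t hi).2]
    exact (ht.2 i).1 hi
  · exact (restr_neg (p := (· = 2)) t hi).2

theorem chi_restr_ne_two {t : Gam lam} (ht : chi lam t = 1) :
    chi lam (restr (fun k => ¬ k = 2) t) = 1 := by
  have h1 := restr_mul_restr (· = 2) t
  have h2 : chi lam (restr (· = 2) t) = 1 :=
    chi_eq_one_of_even (Gsub_mono (by rintro _ rfl; exact even_two) (restr_mem (· = 2) t))
  have := congrArg (chi lam) h1
  rwa [map_mul, h2, one_mul, ht] at this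

theorem isSemidirect_bot {H : Subgroup (O n)} : IsSemidirect H ⊥ H :=
  ⟨sup_bot_eq H, inf_bot_eq H, bot_le⟩

theorem A_sup_B_of_le (hm : mult lam 1 ≤ 1) : A lam ⊔ B lam = D lam := by
  apply le_antisymm (sup_le A_le_D B_le_D)
  rw [D_eq, A_eq_of_le hm, B_eq, ← Subgroup.map_sup]
  refine Subgroup.map_mono fun t ht => ?_
  rw [← restr_mul_restr (· = 2) t]
  exact mul_mem (Subgroup.mem_sup_right (restr_two_mem_Bsub ht))
    (Subgroup.mem_sup_left ⟨restr_mem _ t, chi_restr_ne_two ht.1⟩)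

/-- If there are several blocks of size `1`, an element of `Dsub` lies in `A × B` as soon as it
does not change the sign of the last block. -/
theorem mem_A_sup_B {t : Gam lam} (ht : t ∈ Dsub lam)
    (hl : ∀ i : Fin (len lam), part lam i = 1 → t.1.sgn i = 1) :
    t ∈ KS lam (2 < ·) ⊔ Bsub lam := by
  rw [← restr_mul_restr (· = 2) t]
  refine mul_mem (Subgroup.mem_sup_right (restr_two_mem_Bsub ht))
    (Subgroup.mem_sup_left ⟨fun i hi => ?_, chi_restr_ne_two ht.1⟩)
  by_cases h2 : part lam i = 2
  · exact restr_neg t (not_not.2 h2)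
  · have h1 : part lam i = 1 := by
      have := part_pos lam i
      omega
    rw [(restr_pos (p := fun k => ¬ k = 2) t h2).1, (restr_pos (p := fun k => ¬ k = 2) t h2).2]
    exact ⟨((ht.2 i).2 h1).1, hl i h1⟩

theorem A_sup_B_of_lt (hm : 1 < mult lam 1) (h : ∀ r, Odd (part lam r) → part lam r = 1) :
    A lam ⊔ B lam = D lam := by
  apply le_antisymm (sup_le A_le_D B_le_D)
  rw [D_eq, A_eq_of_lt hm, B_eq, ← Subgroup.map_sup]
  refine Subgroup.map_mono fun t ht => mem_A_sup_B ht fun i hi => ?_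
  by_cases hl : (i : ℕ) + 1 < len lam
  · exact ((ht.2 i).2 hi).2 hl
  · refine sgn_eq_one_of_chi ht.1 (by rw [hi]; exact odd_one) fun j hj ho => ?_
    refine ((ht.2 j).2 (h j ho)).2 ?_
    have : (j : ℕ) ≠ i := fun h => hj (Fin.ext h)
    have := j.2
    omega

theorem A_eq_A0 (hm : 1 < mult lam 1) (h : ∀ r, Odd (part lam r) → part lam r = 1) :
    A lam = A0 lam := by
  rw [A_eq_of_lt hm, A0_eq, KS, KS]
  congr 2
  refine Gsub_congr fun i => ⟨fun hi => ⟨hi, ?_⟩, fun hi => hi.1⟩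
  by_contra ho
  have := h i (Nat.not_even_iff_odd.1 ho)
  omega

theorem len_pos (hm : 1 < mult lam 1) : 0 < len lam := by
  rw [mult_eq_card, Fintype.one_lt_card_iff] at hm
  obtain ⟨a, -⟩ := hm
  exact lt_of_le_of_lt (Nat.zero_le _) a.1.2

theorem part_last (hm : 1 < mult lam 1) : part lam (len lam - 1) = 1 := by
  have hl := len_pos hm
  have h0 : 0 < part lam (len lam - 1) := (part_pos_iff lam).2 (by omega)
  rw [mult_eq_card, Fintype.one_lt_card_iff] at hm
  obtain ⟨a, -⟩ := hm
  have h1 : part lam (len lam - 1) ≤ part lam a.1 := part_anti lam (by have := a.1.2; omega)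
  have := a.2
  omega

theorem mul_self_z' {i j : ℕ} (hi : i < len lam) (hj : j < len lam) :
    z' lam i j * z' lam i j = 1 := by
  rw [z'_eq i j hi hj, ← map_mul]
  nth_rw 1 [ng_comm]
  rw [mul_assoc, ← mul_assoc (ng lam ⟨i, hi⟩), ng_mul_self, one_mul, ng_mul_self, map_one]

theorem eq_one_or_of_mem_zpowers {G : Type*} [Group G] {z g : G} (hz : z * z = 1)
    (hg : g ∈ Subgroup.zpowers z) : g = 1 ∨ g = z := by
  obtain ⟨k, rfl⟩ := Subgroup.mem_zpowers_iff.1 hg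
  rcases Int.even_or_odd' k with ⟨m, rfl | rfl⟩
  · left
    rw [zpow_mul, zpow_ofNat, pow_two, hz, one_zpow]
  · right
    rw [zpow_add, zpow_mul, zpow_ofNat, pow_two, hz, one_zpow, one_mul, zpow_one]

/-- The complement of `A × B` in `D` if there are several blocks of size `1` and an odd block of
size greater than `1`. -/
theorem isSemidirect_zpowers (hm : 1 < mult lam 1) {r : ℕ} (hr : Odd (part lam r))
    (hr1 : 1 < part lam r) :
    IsSemidirect (A lam ⊔ B lam) (Subgroup.zpowers (z' lam r (len lam - 1))) (D lam) ∧
      Nat.card (Subgroup.zpowers (z' lam r (len lam - 1))) = 2 := by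
  have hlen := len_pos hm
  have hrl : r < len lam := lt_len_of_pos (by omega)
  have hl : len lam - 1 < len lam := by omega
  have hlast := part_last hm
  have hsq := mul_self_z' hrl hl
  have hz := z'_eq r (len lam - 1) hrl hl
  have hne : (⟨len lam - 1, hl⟩ : Fin (len lam)) ≠ ⟨r, hrl⟩ := fun h => by
    have h' : len lam - 1 = r := congrArg Fin.val h
    rw [← h', hlast] at hr1
    exact absurd hr1 (lt_irrefl _)
  set c : Gam lam := ng lam ⟨r, hrl⟩ * ng lam ⟨len lam - 1, hl⟩
  have hcsgn : c.1.sgn ⟨len lam - 1, hl⟩ = -1 := by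
    simp [c, ng_sgn, hne]
  have hcG : c ∈ Gsub lam (· ≠ 2) := mul_mem
    (ng_mem_Gsub _ (by dsimp only; rintro h; rw [h] at hr; exact absurd hr (by decide)))
    (ng_mem_Gsub _ (by dsimp only; omega))
  have hcD : c ∈ Dsub lam := by
    refine ⟨?_, fun i => ⟨fun hi => (hcG i (not_not.2 hi)).2, fun hi => ⟨rfl, fun hil => ?_⟩⟩⟩
    · rw [map_mul, chi_ng, chi_ng, hr.neg_one_pow]
      simp only [hlast]
      rfl
    · have h1 : i ≠ ⟨r, hrl⟩ := by rintro rfl; dsimp only at hi; omega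
      have h2 : i ≠ ⟨len lam - 1, hl⟩ := by rintro rfl; dsimp only at hil; omega
      simp [c, ng_sgn, h1, h2]
  have hAB : A lam ⊔ B lam = (KS lam (2 < ·) ⊔ Bsub lam).map bO := by
    rw [A_eq_of_lt hm, B_eq, Subgroup.map_sup]
  have hABsgn : KS lam (2 < ·) ⊔ Bsub lam ≤ Gsub lam (· ≠ 1) :=
    sup_le (fun t ht => Gsub_mono (fun k hk => by omega) ht.1)
      (fun t ht => Gsub_mono (fun k hk => by omega) ht.1)
  have hz1 : z' lam r (len lam - 1) ∉ A lam ⊔ B lam := by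
    rw [hAB, hz, Subgroup.mem_map_iff_mem bO_injective]
    intro h
    have := (hABsgn h ⟨len lam - 1, hl⟩ (not_not.2 hlast)).2
    rw [hcsgn] at this
    exact absurd this (by decide)
  refine ⟨⟨?_, ?_, ?_⟩, ?_⟩
  · apply le_antisymm
    · refine sup_le (sup_le A_le_D B_le_D) ?_
      rw [Subgroup.zpowers_le, hz, D_eq]
      exact Subgroup.mem_map_of_mem _ hcD
    · have key : ∀ t ∈ Dsub lam, t.1.sgn ⟨len lam - 1, hl⟩ = 1 → bO t ∈ A lam ⊔ B lam := by
        intro t ht ht1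
        rw [hAB]
        refine Subgroup.mem_map_of_mem _ (mem_A_sup_B ht fun i hi => ?_)
        by_cases hil : (i : ℕ) + 1 < len lam
        · exact ((ht.2 i).2 hi).2 hil
        · have := i.2
          rwa [show i = ⟨len lam - 1, hl⟩ from Fin.ext (by dsimp only; omega)]
      rw [D_eq]
      rintro _ ⟨t, ht, rfl⟩
      rcases Int.units_eq_one_or (t.1.sgn ⟨len lam - 1, hl⟩) with h1 | h1
      · exact Subgroup.mem_sup_left (key t ht h1)
      · have h2 := key (t * c) (mul_mem ht hcD) (by
          rw [Subgroup.coe_mul, SP.mul_sgn, hcsgn]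
          change t.1.sgn ⟨len lam - 1, hl⟩ * _ = _
          rw [h1]
          rfl)
        have h3 : bO t = bO (t * c) * z' lam r (len lam - 1) := by
          rw [map_mul, ← hz, mul_assoc, hsq, mul_one]
        rw [h3]
        exact mul_mem (Subgroup.mem_sup_left h2)
          (Subgroup.mem_sup_right (Subgroup.mem_zpowers _))
  · rw [eq_bot_iff]
    rintro g ⟨h1, h2⟩
    rcases eq_one_or_of_mem_zpowers hsq h2 with rfl | rfl
    · exact one_mem _
    · exact absurd h1 hz1
  · rw [Subgroup.zpowers_le]
    have h1 : Subgroup.zpowers c ≤ Subgroup.normalizer ((KS lam (2 < ·) ⊔ Bsub lam :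
        Subgroup (Gam lam)) : Set (Gam lam)) := by
      intro g hg
      have hg' : g ∈ Gsub lam (· ≠ 2) := (Subgroup.zpowers_le.2 hcG) hg
      refine Subgroup.mem_normalizer_iff.2 fun t => ?_
      have key : ∀ g ∈ Gsub lam (· ≠ 2), KS lam (2 < ·) ⊔ Bsub lam ≤
          (KS lam (2 < ·) ⊔ Bsub lam).comap (MulAut.conj g).toMonoidHom := by
        intro g hg
        refine sup_le (fun t ht => Subgroup.mem_sup_left ((KS_normal _).conj_mem t ht g))
          fun t ht => Subgroup.mem_sup_right ?_
        change g * t * g⁻¹ ∈ Bsub lam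
        rw [← Gam.commute ht.1 hg, mul_inv_cancel_right]
        exact ht
      refine ⟨fun ht => key g hg' ht, fun ht => ?_⟩
      have h2 := key g⁻¹ (inv_mem hg') ht
      have h3 : g⁻¹ * (g * t * g⁻¹) * g⁻¹⁻¹ = t := by group
      exact (congrArg (· ∈ KS lam (2 < ·) ⊔ Bsub lam) h3).mp h2
    have h2 := h1 (Subgroup.mem_zpowers c)
    rw [hAB, hz]
    refine Subgroup.mem_normalizer_iff.2 fun g => ?_
    constructor
    · rintro ⟨t, ht, rfl⟩
      exact ⟨c * t * c⁻¹, (Subgroup.mem_normalizer_iff.1 h2 t).1 ht, by simp⟩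
    · rintro ⟨t, ht, h3⟩
      refine ⟨c⁻¹ * t * c, (Subgroup.mem_normalizer_iff.1 h2 _).2 ?_, ?_⟩
      · have : c * (c⁻¹ * t * c) * c⁻¹ = t := by group
        rw [this]
        exact ht
      · rw [map_mul, map_mul, h3, map_inv]
        group
  · rw [Nat.card_zpowers]
    refine orderOf_eq_prime (by rw [pow_two, hsq]) fun h => hz1 ?_
    rw [h]
    exact one_mem _

theorem isSemidirect_Q_B : IsSemidirect (Q lam) (B lam) (Q lam ⊔ B lam) := by
  refine ⟨rfl, ?_, le_normalizer_of_conj fun g hg p hp =>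
    conj_mem_orthComplement (D_le_N (B_le_D hg)) hp⟩
  rw [Q_eq, B_eq, ← Subgroup.map_inf _ _ _ bO_injective, eq_bot_iff]
  rintro _ ⟨t, ⟨h1, h2⟩, rfl⟩
  rw [Gam.eq_one (s := t) fun i => ⟨if hi : part lam i = 1 then (h2.1 i (by omega)).1
    else (h1.2 i).1 hi, h2.2 i⟩, map_one]
  exact one_mem _

theorem isSemidirect_young_B : IsSemidirect (young lam) (B lam) (young lam ⊔ B lam) := by
  refine ⟨rfl, ?_, fun g hg => (Subgroup.mem_inf.1 (D_le_N (B_le_D hg))).2⟩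
  rw [B_eq, eq_bot_iff]
  rintro _ ⟨h1, t, -, rfl⟩
  rw [bO_mem_young h1, map_one]
  exact one_mem _

end Spaces

/-! ### Signed permutations of disjoint unions and of subsets -/

namespace SP
section Emb
variable {α κ : Type*}

/-- Extension of a signed permutation by the identity along an embedding. -/
def emb (j : α ↪ κ) : SP α →* SP κ where
  toFun s := ⟨s.perm.viaEmbedding j, Function.extend j s.sgn fun _ => 1⟩
  map_one' := by
    refine ext_iff'.2 fun k => ?_
    by_cases hk : k ∈ Set.range j
    · obtain ⟨a, rfl⟩ := hk
      simp [Equiv.Perm.viaEmbedding_apply, j.injective.extend_apply]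
    · simp [Equiv.Perm.viaEmbedding_apply_of_notMem _ _ _ hk, Function.extend_apply' _ _ _ hk]
  map_mul' s t := by
    refine ext_iff'.2 fun k => ?_
    by_cases hk : k ∈ Set.range j
    · obtain ⟨a, rfl⟩ := hk
      simp [Equiv.Perm.viaEmbedding_apply, j.injective.extend_apply]
    · simp [Equiv.Perm.viaEmbedding_apply_of_notMem _ _ _ hk, Function.extend_apply' _ _ _ hk]

variable (j : α ↪ κ)

@[simp] theorem emb_perm (s : SP α) (a : α) : (emb j s).perm (j a) = j (s.perm a) :=
  Equiv.Perm.viaEmbedding_apply _ _ _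

@[simp] theorem emb_sgn (s : SP α) (a : α) : (emb j s).sgn (j a) = s.sgn a :=
  j.injective.extend_apply s.sgn (fun _ => 1) a

theorem emb_of_notMem (s : SP α) {k : κ} (hk : k ∉ Set.range j) :
    (emb j s).perm k = k ∧ (emb j s).sgn k = 1 :=
  ⟨Equiv.Perm.viaEmbedding_apply_of_notMem _ _ _ hk,
    Function.extend_apply' s.sgn (fun _ => 1) k hk⟩

theorem emb_injective : Function.Injective (emb j) := by
  intro s t h
  refine ext_iff'.2 fun a => ⟨j.injective ?_, ?_⟩
  · rw [← emb_perm, h, emb_perm]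
  · rw [← emb_sgn j, h, emb_sgn]

theorem exists_emb_eq {s : SP κ} (h : ∀ k ∉ Set.range j, s.perm k = k ∧ s.sgn k = 1) :
    ∃ t, emb j t = s := by
  have key : ∀ s : SP κ, (∀ k ∉ Set.range j, s.perm k = k) → ∀ a, ∃ b, j b = s.perm (j a) := by
    intro s h a
    by_contra hcon
    have h1 := s.perm.injective (h (s.perm (j a)) hcon)
    exact hcon ⟨a, h1.symm⟩
  have hinv : ∀ k ∉ Set.range j, s⁻¹.perm k = k := fun k hk =>
    Equiv.Perm.inv_eq_iff_eq.2 (h k hk).1.symm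
  choose f hf using key s fun k hk => (h k hk).1
  choose g hg using key s⁻¹ hinv
  refine ⟨⟨⟨f, g, fun a => j.injective ?_, fun a => j.injective ?_⟩, fun a => s.sgn (j a)⟩, ?_⟩
  · rw [hg, hf]
    exact s.perm.symm_apply_apply _
  · rw [hf, hg]
    exact s.perm.apply_symm_apply _
  · refine ext_iff'.2 fun k => ?_
    by_cases hk : k ∈ Set.range j
    · obtain ⟨a, rfl⟩ := hk
      rw [emb_perm, emb_sgn]
      exact ⟨hf a, rfl⟩
    · rw [(emb_of_notMem j _ hk).1, (emb_of_notMem j _ hk).2, (h k hk).1, (h k hk).2]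
      exact ⟨rfl, rfl⟩

theorem isRefl_emb {s : SP α} : (emb j s).IsRefl ↔ s.IsRefl := by
  have hr : ∀ i, ¬ ((emb j s).perm i = i ∧ (emb j s).sgn i = 1) → ∃ a, j a = i := by
    intro i hi
    by_contra hcon
    exact hi (emb_of_notMem j s hcon)
  constructor
  · rintro (⟨i, k, hik, h1, h2, h3, h4⟩ | ⟨i, h1, h2, h3⟩)
    · obtain ⟨a, rfl⟩ := hr i fun h => hik (h.1.symm.trans h1)
      obtain ⟨b, rfl⟩ := hr k fun h => hik (h2.symm.trans h.1)
      rw [emb_perm, j.apply_eq_iff_eq] at h1 h2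
      rw [emb_sgn, emb_sgn] at h3
      refine .inl ⟨a, b, fun h => hik (by rw [h]), h1, h2, h3, fun c hc hc' => ?_⟩
      simpa using h4 (j c) (by simpa using hc) (by simpa using hc')
    · obtain ⟨a, rfl⟩ := hr i fun h => absurd (h2.symm.trans h.2) (by decide)
      rw [emb_perm, j.apply_eq_iff_eq] at h1
      rw [emb_sgn] at h2
      refine .inr ⟨a, h1, h2, fun c hc => ?_⟩
      simpa using h3 (j c) (by simpa using hc)
  · rintro (⟨a, b, hab, h1, h2, h3, h4⟩ | ⟨a, h1, h2, h3⟩)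
    · refine .inl ⟨j a, j b, by simpa using hab, by simp [h1], by simp [h2], by simp [h3],
        fun k hk hk' => ?_⟩
      by_cases h : k ∈ Set.range j
      · obtain ⟨c, rfl⟩ := h
        simpa using h4 c (by rintro rfl; exact hk rfl) (by rintro rfl; exact hk' rfl)
      · exact emb_of_notMem j s h
    · refine .inr ⟨j a, by simp [h1], by simp [h2], fun k hk => ?_⟩
      by_cases h : k ∈ Set.range j
      · obtain ⟨c, rfl⟩ := h
        simpa using h3 c (by rintro rfl; exact hk rfl)
      · exact emb_of_notMem j s h

end Emb

theorem isRefl_ne_one {κ : Type*} {s : SP κ} (h : s.IsRefl) : s ≠ 1 := by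
  rintro rfl
  rcases h with ⟨i, j, hij, h1, -⟩ | ⟨i, -, h2, -⟩
  · exact hij h1
  · exact absurd h2 (by simp)

section Sigma
variable {T : Type*} {α : T → Type*}

/-- A family of signed permutations, as a signed permutation of the disjoint union. -/
def sigma : (∀ t, SP (α t)) →* SP (Σ t, α t) where
  toFun m := ⟨Equiv.sigmaCongrRight fun t => (m t).perm, fun x => (m x.1).sgn x.2⟩
  map_one' := ext_iff'.2 fun _ => ⟨rfl, rfl⟩
  map_mul' _ _ := ext_iff'.2 fun _ => ⟨rfl, rfl⟩

@[simp] theorem sigma_perm (m : ∀ t, SP (α t)) (t : T) (a : α t) :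
    (sigma m).perm ⟨t, a⟩ = ⟨t, (m t).perm a⟩ := rfl

@[simp] theorem sigma_sgn (m : ∀ t, SP (α t)) (t : T) (a : α t) :
    (sigma m).sgn ⟨t, a⟩ = (m t).sgn a := rfl

theorem sigma_injective : Function.Injective (sigma : (∀ t, SP (α t)) →* SP (Σ t, α t)) := by
  refine (injective_iff_map_eq_one _).2 fun m hm => funext fun t => ext_iff'.2 fun a => ?_
  have h := ext_iff'.1 hm ⟨t, a⟩
  simpa using h

theorem exists_sigma_eq {s : SP (Σ t, α t)} (h : ∀ x, (s.perm x).1 = x.1) : ∃ m, sigma m = s := by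
  have hinv : ∀ x, (s⁻¹.perm x).1 = x.1 := fun x => by
    rw [← h (s⁻¹.perm x)]
    exact congrArg Sigma.fst (s.perm.apply_symm_apply x)
  have key : ∀ s : SP (Σ t, α t), (∀ x, (s.perm x).1 = x.1) →
      ∀ t (a : α t), ∃ b : α t, s.perm ⟨t, a⟩ = ⟨t, b⟩ := by
    intro s h t a
    have h1 := h ⟨t, a⟩
    rcases h2 : s.perm ⟨t, a⟩ with ⟨t', b⟩
    rw [h2] at h1
    dsimp only at h1
    subst h1
    exact ⟨b, rfl⟩
  choose f hf using key s h
  choose g hg using key s⁻¹ hinv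
  refine ⟨fun t => ⟨⟨f t, g t, fun a => ?_, fun a => ?_⟩, fun a => s.sgn ⟨t, a⟩⟩, ?_⟩
  · have h1 : s⁻¹.perm (s.perm ⟨t, a⟩) = ⟨t, a⟩ := s.perm.symm_apply_apply _
    rw [hf, hg] at h1
    exact eq_of_heq (Sigma.mk.inj h1).2
  · have h1 : s.perm (s⁻¹.perm ⟨t, a⟩) = ⟨t, a⟩ := s.perm.apply_symm_apply _
    rw [hg, hf] at h1
    exact eq_of_heq (Sigma.mk.inj h1).2
  · refine ext_iff'.2 ?_
    rintro ⟨t, a⟩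
    exact ⟨(hf t a).symm, rfl⟩

theorem isRefl_sigma {m : ∀ t, SP (α t)} :
    (sigma m).IsRefl ↔ ∃ t, (m t).IsRefl ∧ ∀ t', t' ≠ t → m t' = 1 := by
  constructor
  · rintro (⟨⟨t, a⟩, ⟨t', b⟩, hab, h1, h2, h3, h4⟩ | ⟨⟨t, a⟩, h1, h2, h3⟩)
    · obtain rfl : t = t' := congrArg Sigma.fst h1
      rw [sigma_perm] at h1 h2
      refine ⟨t, .inl ⟨a, b, fun h => hab (by rw [h]), eq_of_heq (Sigma.mk.inj h1).2,
        eq_of_heq (Sigma.mk.inj h2).2, h3, fun c hc hc' => ?_⟩, fun t' ht' =>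
          ext_iff'.2 fun c => ?_⟩
      · have := h4 ⟨t, c⟩ (by simpa using hc) (by simpa using hc')
        simpa using this
      · have := h4 ⟨t', c⟩ (fun h => ht' (congrArg Sigma.fst h))
          (fun h => ht' (congrArg Sigma.fst h))
        simpa using this
    · rw [sigma_perm] at h1
      refine ⟨t, .inr ⟨a, eq_of_heq (Sigma.mk.inj h1).2, h2, fun c hc => ?_⟩, fun t' ht' =>
          ext_iff'.2 fun c => ?_⟩
      · have := h3 ⟨t, c⟩ (by simpa using hc)
        simpa using this
      · have := h3 ⟨t', c⟩ (fun h => ht' (congrArg Sigma.fst h))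
        simpa using this
  · rintro ⟨t, ⟨a, b, hab, h1, h2, h3, h4⟩ | ⟨a, h1, h2, h3⟩, h5⟩
    · refine .inl ⟨⟨t, a⟩, ⟨t, b⟩, by simpa using hab, by simp [h1], by simp [h2], h3, ?_⟩
      rintro ⟨t', c⟩ hc hc'
      by_cases ht : t' = t
      · subst ht
        simpa using h4 c (by rintro rfl; exact hc rfl) (by rintro rfl; exact hc' rfl)
      · simp [h5 t' ht]
    · refine .inr ⟨⟨t, a⟩, by simp [h1], h2, ?_⟩
      rintro ⟨t', c⟩ hc
      by_cases ht : t' = t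
      · subst ht
        simpa using h3 c (by rintro rfl; exact hc rfl)
      · simp [h5 t' ht]

end Sigma

section Sum
variable {α β : Type*}

/-- Two signed permutations, as a signed permutation of the disjoint union. -/
def sum : SP α × SP β →* SP (α ⊕ β) where
  toFun m := ⟨Equiv.sumCongr m.1.perm m.2.perm, Sum.elim m.1.sgn m.2.sgn⟩
  map_one' := ext_iff'.2 fun x => by rcases x with x | x <;> exact ⟨rfl, rfl⟩
  map_mul' _ _ := ext_iff'.2 fun x => by rcases x with x | x <;> exact ⟨rfl, rfl⟩

@[simp] theorem sum_perm_inl (m : SP α × SP β) (a : α) :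
    (sum m).perm (.inl a) = .inl (m.1.perm a) := rfl
@[simp] theorem sum_perm_inr (m : SP α × SP β) (a : β) :
    (sum m).perm (.inr a) = .inr (m.2.perm a) := rfl
@[simp] theorem sum_sgn_inl (m : SP α × SP β) (a : α) : (sum m).sgn (.inl a) = m.1.sgn a := rfl
@[simp] theorem sum_sgn_inr (m : SP α × SP β) (a : β) : (sum m).sgn (.inr a) = m.2.sgn a := rfl

theorem sum_injective : Function.Injective (sum : SP α × SP β →* SP (α ⊕ β)) := by
  refine (injective_iff_map_eq_one _).2 fun m hm => Prod.ext (ext_iff'.2 fun a => ?_)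
    (ext_iff'.2 fun a => ?_)
  · simpa using ext_iff'.1 hm (.inl a)
  · simpa using ext_iff'.1 hm (.inr a)

theorem exists_sum_eq {s : SP (α ⊕ β)} (h : ∀ x, (s.perm x).isLeft = x.isLeft) :
    ∃ m, sum m = s := by
  have hinv : ∀ x, (s⁻¹.perm x).isLeft = x.isLeft := fun x => by
    rw [← h (s⁻¹.perm x)]
    exact congrArg Sum.isLeft (s.perm.apply_symm_apply x)
  have key : ∀ s : SP (α ⊕ β), (∀ x, (s.perm x).isLeft = x.isLeft) →
      (∀ a, ∃ b, s.perm (.inl a) = .inl b) ∧ ∀ a, ∃ b, s.perm (.inr a) = .inr b := by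
    intro s h
    refine ⟨fun a => Sum.isLeft_iff.1 (h (.inl a)), fun a => Sum.isRight_iff.1 ?_⟩
    rw [← Sum.not_isLeft, h]
    simp
  obtain ⟨h1, h2⟩ := key s h
  obtain ⟨h3, h4⟩ := key s⁻¹ hinv
  choose f hf using h1
  choose f' hf' using h2
  choose g hg using h3
  choose g' hg' using h4
  refine ⟨(⟨⟨f, g, fun a => ?_, fun a => ?_⟩, fun a => s.sgn (.inl a)⟩,
    ⟨⟨f', g', fun a => ?_, fun a => ?_⟩, fun a => s.sgn (.inr a)⟩), ext_iff'.2 ?_⟩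
  · have h1 : s⁻¹.perm (s.perm (.inl a)) = .inl a := s.perm.symm_apply_apply _
    rw [hf, hg] at h1
    exact Sum.inl_injective h1
  · have h1 : s.perm (s⁻¹.perm (.inl a)) = .inl a := s.perm.apply_symm_apply _
    rw [hg, hf] at h1
    exact Sum.inl_injective h1
  · have h1 : s⁻¹.perm (s.perm (.inr a)) = .inr a := s.perm.symm_apply_apply _
    rw [hf', hg'] at h1
    exact Sum.inr_injective h1
  · have h1 : s.perm (s⁻¹.perm (.inr a)) = .inr a := s.perm.apply_symm_apply _
    rw [hg', hf'] at h1
    exact Sum.inr_injective h1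
  · rintro (a | a)
    · exact ⟨(hf a).symm, rfl⟩
    · exact ⟨(hf' a).symm, rfl⟩

theorem isRefl_sum {m : SP α × SP β} :
    (sum m).IsRefl ↔ (m.1.IsRefl ∧ m.2 = 1) ∨ (m.1 = 1 ∧ m.2.IsRefl) := by
  constructor
  · rintro (⟨a | a, b | b, hab, h1, h2, h3, h4⟩ | ⟨a | a, h1, h2, h3⟩)
    · refine .inl ⟨.inl ⟨a, b, by simpa using hab, by simpa using h1, by simpa using h2, h3,
        fun c hc hc' => ?_⟩, ext_iff'.2 fun c => ?_⟩
      · simpa using h4 (.inl c) (by simpa using hc) (by simpa using hc')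
      · simpa using h4 (.inr c) (by simp) (by simp)
    · simp at h1
    · simp at h1
    · refine .inr ⟨ext_iff'.2 fun c => ?_, .inl ⟨a, b, by simpa using hab, by simpa using h1,
        by simpa using h2, h3, fun c hc hc' => ?_⟩⟩
      · simpa using h4 (.inl c) (by simp) (by simp)
      · simpa using h4 (.inr c) (by simpa using hc) (by simpa using hc')
    · refine .inl ⟨.inr ⟨a, by simpa using h1, h2, fun c hc => ?_⟩, ext_iff'.2 fun c => ?_⟩
      · simpa using h3 (.inl c) (by simpa using hc)
      · simpa using h3 (.inr c) (by simp)
    · refine .inr ⟨ext_iff'.2 fun c => ?_, .inr ⟨a, by simpa using h1, h2, fun c hc => ?_⟩⟩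
      · simpa using h3 (.inl c) (by simp)
      · simpa using h3 (.inr c) (by simpa using hc)
  · rintro (⟨⟨a, b, hab, h1, h2, h3, h4⟩ | ⟨a, h1, h2, h3⟩, h5⟩ |
      ⟨h5, ⟨a, b, hab, h1, h2, h3, h4⟩ | ⟨a, h1, h2, h3⟩⟩)
    · refine .inl ⟨.inl a, .inl b, by simpa using hab, by simp [h1], by simp [h2], h3, ?_⟩
      rintro (c | c) hc hc'
      · simpa using h4 c (by simpa using hc) (by simpa using hc')
      · simp [h5]
    · refine .inr ⟨.inl a, by simp [h1], h2, ?_⟩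
      rintro (c | c) hc
      · simpa using h3 c (by simpa using hc)
      · simp [h5]
    · refine .inl ⟨.inr a, .inr b, by simpa using hab, by simp [h1], by simp [h2], h3, ?_⟩
      rintro (c | c) hc hc'
      · simp [h5]
      · simpa using h4 c (by simpa using hc) (by simpa using hc')
    · refine .inr ⟨.inr a, by simp [h1], h2, ?_⟩
      rintro (c | c) hc
      · simp [h5]
      · simpa using h3 c (by simpa using hc)

end Sum

theorem ofPerm_injective {κ : Type*} : Function.Injective (ofPerm : Equiv.Perm κ →* SP κ) :=
  fun _ _ h => congrArg SP.perm h

theorem isRefl_ofPerm {κ : Type*} [DecidableEq κ] {σ : Equiv.Perm κ} :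
    (ofPerm σ).IsRefl ↔ σ.IsSwap := by
  constructor
  · rintro (⟨i, j, hij, h1, h2, -, h4⟩ | ⟨i, -, h2, -⟩)
    · refine ⟨i, j, hij, Equiv.ext fun k => ?_⟩
      rw [ofPerm_perm] at h1 h2 h4
      by_cases hi : k = i
      · rw [hi, h1, Equiv.swap_apply_left]
      by_cases hj : k = j
      · rw [hj, h2, Equiv.swap_apply_right]
      · rw [Equiv.swap_apply_of_ne_of_ne hi hj, (h4 k hi hj).1]
    · exact absurd h2 (by simp)
  · rintro ⟨i, j, hij, rfl⟩
    exact .inl ⟨i, j, hij, by simp, by simp, rfl, fun k hi hj =>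
      ⟨Equiv.swap_apply_of_ne_of_ne hi hj, rfl⟩⟩

/-- Sequences of permutations of two points, as changes of signs. -/
def ofPermTwo (a : ℕ) : (Fin a → Equiv.Perm (Fin 2)) →* SP (Fin a) where
  toFun p := ofSign fun i => Equiv.Perm.sign (p i)
  map_one' := ext_iff'.2 fun _ => by simp
  map_mul' p q := ext_iff'.2 fun _ => by simp

@[simp] theorem ofPermTwo_perm {a : ℕ} (p : Fin a → Equiv.Perm (Fin 2)) :
    (ofPermTwo a p).perm = 1 := rfl

@[simp] theorem ofPermTwo_sgn {a : ℕ} (p : Fin a → Equiv.Perm (Fin 2)) (i : Fin a) :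
    (ofPermTwo a p).sgn i = Equiv.Perm.sign (p i) := rfl

theorem sign_perm_two (σ : Equiv.Perm (Fin 2)) : Equiv.Perm.sign σ = 1 ↔ σ = 1 := by
  revert σ; decide

theorem sign_perm_two' (σ : Equiv.Perm (Fin 2)) : Equiv.Perm.sign σ = -1 ↔ σ ∈ reflS 2 := by
  have : ∀ σ : Equiv.Perm (Fin 2), Equiv.Perm.sign σ = -1 ↔ ∃ x y, x ≠ y ∧ σ = Equiv.swap x y := by
    decide
  exact this σ

theorem ofPermTwo_injective (a : ℕ) : Function.Injective (ofPermTwo a) :=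
  (injective_iff_map_eq_one _).2 fun _ hp => funext fun i =>
    (sign_perm_two _).1 (ext_iff'.1 hp i).2

theorem exists_ofPermTwo_eq {a : ℕ} {s : SP (Fin a)} (h : s.perm = 1) :
    ∃ p, ofPermTwo a p = s := by
  refine ⟨fun i => if s.sgn i = 1 then 1 else Equiv.swap 0 1,
    ext_iff'.2 fun i => ⟨by rw [h]; rfl, ?_⟩⟩
  rcases Int.units_eq_one_or (s.sgn i) with h1 | h1
  · simp [h1]
  · have h2 : ¬ ((-1 : ℤˣ) = 1) := by decide
    simp [h1, h2]

theorem isRefl_ofPermTwo {a : ℕ} {p : Fin a → Equiv.Perm (Fin 2)} :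
    (ofPermTwo a p).IsRefl ↔ p ∈ piRefl fun _ : Fin a => reflS 2 := by
  constructor
  · rintro (⟨i, j, hij, h1, -⟩ | ⟨i, -, h2, h3⟩)
    · exact absurd h1 hij
    · exact ⟨i, (sign_perm_two' _).1 h2, fun j hj => (sign_perm_two _).1 (h3 j hj).2⟩
  · rintro ⟨i, h1, h2⟩
    exact .inr ⟨i, rfl, (sign_perm_two' _).2 h1, fun j hj => ⟨rfl, (sign_perm_two _).2 (h2 j hj)⟩⟩

end SP

/-! ### Models of the groups of signed permutations of the blocks -/

section Models
variable {a : ℕ}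

/-- `W(B_a)`, as a group of abstract signed permutations. -/
def wbSP (a : ℕ) : WB a →* SP (Fin a) := (equivWB a).symm.toMonoidHom

theorem wbSP_injective (a : ℕ) : Function.Injective (wbSP a) := (equivWB a).symm.injective

theorem wbSP_surjective (a : ℕ) : Function.Surjective (wbSP a) := (equivWB a).symm.surjective

theorem toO_wbSP (w : WB a) : toO (wbSP a w) = w :=
  congrArg Subtype.val ((equivWB a).apply_symm_apply w)

theorem isRefl_wbSP {w : WB a} : (wbSP a w).IsRefl ↔ w ∈ reflB a := by
  rw [← isRefl_toO, toO_wbSP]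
  rfl

theorem WD_le_WB : WD a ≤ WB a := by
  rintro _ ⟨σ, ε, -, rfl⟩
  exact ⟨σ, ε, rfl⟩

/-- `W(D_a)`, as a group of abstract signed permutations. -/
def wdSP (a : ℕ) : WD a →* SP (Fin a) := (wbSP a).comp (Subgroup.inclusion WD_le_WB)

theorem wdSP_injective (a : ℕ) : Function.Injective (wdSP a) :=
  (wbSP_injective a).comp (Subgroup.inclusion_injective WD_le_WB)

theorem toO_wdSP (w : WD a) : toO (wdSP a w) = w := toO_wbSP _

theorem isRefl_wdSP {w : WD a} : (wdSP a w).IsRefl ↔ w ∈ reflD a := by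
  rw [← isRefl_toO, toO_wdSP]
  rfl

theorem detSgn_wdSP (w : WD a) : detSgn (wdSP a w) = 1 :=
  toO_mem_WD.1 (by rw [toO_wdSP]; exact w.2)

theorem exists_wdSP_eq {s : SP (Fin a)} (h : detSgn s = 1) : ∃ w, wdSP a w = s :=
  ⟨⟨toO s, toO_mem_WD.2 h⟩, toO_injective (toO_wdSP _)⟩

variable {n : ℕ} (lam : n.Partition)

/-- A numbering of the blocks of size `k`. -/
def blkIdx (k : ℕ) : Fin (mult lam k) ≃ {i : Fin (len lam) // part lam i = k} :=
  (Fintype.equivFinOfCardEq (mult_eq_card lam k).symm).symm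

theorem part_blkIdx (k : ℕ) (c : Fin (mult lam k)) : part lam (blkIdx lam k c).1 = k :=
  (blkIdx lam k c).2

theorem exists_blkIdx_eq {k : ℕ} {i : Fin (len lam)} (h : part lam i = k) :
    ∃ c, (blkIdx lam k c).1 = i :=
  ⟨(blkIdx lam k).symm ⟨i, h⟩, by rw [Equiv.apply_symm_apply]⟩

theorem blkIdx_inj {k k' : ℕ} {c : Fin (mult lam k)} {c' : Fin (mult lam k')}
    (h : (blkIdx lam k c).1 = (blkIdx lam k' c').1) :
    (⟨k, c⟩ : Σ k, Fin (mult lam k)) = ⟨k', c'⟩ := by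
  have hk : k = k' := by rw [← part_blkIdx lam k c, h, part_blkIdx]
  subst hk
  rw [(blkIdx lam k).injective (Subtype.ext h)]

/-- The blocks whose size belongs to `S`. -/
def embS (S : Finset ℕ) : (Σ k : S, Fin (mult lam k)) ↪ Fin (len lam) where
  toFun x := (blkIdx lam x.1 x.2).1
  inj' := by
    rintro ⟨⟨k, hk⟩, c⟩ ⟨⟨k', hk'⟩, c'⟩ h
    have := blkIdx_inj lam h
    cases this
    rfl

theorem part_embS (S : Finset ℕ) (x : Σ k : S, Fin (mult lam k)) : part lam (embS lam S x) = x.1 :=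
  part_blkIdx lam _ _

theorem mem_range_embS {S : Finset ℕ} {i : Fin (len lam)} :
    i ∈ Set.range (embS lam S) ↔ part lam i ∈ S := by
  constructor
  · rintro ⟨x, rfl⟩
    rw [part_embS]
    exact x.1.2
  · intro h
    obtain ⟨c, hc⟩ := exists_blkIdx_eq lam (i := i) rfl
    exact ⟨⟨⟨_, h⟩, c⟩, hc⟩

/-- The signed permutations of the blocks whose size belongs to `S`, one family for each size. -/
def baseS (S : Finset ℕ) : prodB lam S →* Gam lam :=
  ((SP.emb (embS lam S)).comp (SP.sigma.comp (MonoidHom.pi fun k : S =>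
    (wbSP (mult lam k)).comp (Pi.evalMonoidHom _ k)))).codRestrict (Gam lam) (by
    intro m i
    by_cases hi : i ∈ Set.range (embS lam S)
    · obtain ⟨⟨k, c⟩, rfl⟩ := hi
      simp only [MonoidHom.comp_apply, SP.emb_perm, SP.sigma_perm, part_embS]
    · rw [MonoidHom.comp_apply, (SP.emb_of_notMem _ _ hi).1])

theorem coe_baseS (S : Finset ℕ) (m : prodB lam S) : (baseS lam S m).1 =
    SP.emb (embS lam S) (SP.sigma fun k : S => wbSP (mult lam k) (m k)) := rfl

theorem baseS_injective (S : Finset ℕ) : Function.Injective (baseS lam S) := by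
  intro m m' h
  have h1 := SP.sigma_injective (SP.emb_injective _ (congrArg Subtype.val h))
  exact funext fun k => wbSP_injective _ (congrFun h1 k)

theorem range_baseS (S : Finset ℕ) : (baseS lam S).range = Gsub lam (· ∈ S) := by
  apply le_antisymm
  · rintro _ ⟨m, rfl⟩ i hi
    exact SP.emb_of_notMem _ _ (by rwa [mem_range_embS])
  · intro t ht
    obtain ⟨s, hs⟩ := SP.exists_emb_eq (embS lam S) (s := t.1) fun i hi =>
      ht i (by rwa [mem_range_embS] at hi)
    obtain ⟨m, rfl⟩ := SP.exists_sigma_eq (s := s) fun x => by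
      have h1 := part_perm t (embS lam S x)
      rw [← hs, SP.emb_perm, part_embS, part_embS] at h1
      exact Subtype.ext h1
    choose w hw using fun k => wbSP_surjective (mult lam k)
    refine ⟨fun k => w k (m k), Subtype.ext ?_⟩
    rw [coe_baseS, ← hs]
    congr 2
    funext k
    exact hw k (m k)

theorem isRefl_baseS {S : Finset ℕ} {m : prodB lam S} :
    (baseS lam S m).1.IsRefl ↔ m ∈ reflProdB lam S := by
  rw [coe_baseS, SP.isRefl_emb, SP.isRefl_sigma]
  refine exists_congr fun k => and_congr isRefl_wbSP (forall₂_congr fun k' _ => ?_)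
  rw [← map_one (wbSP _), (wbSP_injective _).eq_iff]

/-- The group `W(D_n) ∩ ∏ W(B_{a_k})` has index `2` in the product if there is a block of odd
size. -/
theorem exists_index_two {S : Finset ℕ} {i : Fin (len lam)} (hi : Odd (part lam i))
    (hS : part lam i ∈ S) {H : Subgroup (O n)} (hH : H = (KS lam (· ∈ S)).map bO) :
    ∃ K : Subgroup (prodB lam S), K.index = 2 ∧ Nonempty (H ≃* K) := by
  refine ⟨((chi lam).comp (baseS lam S)).ker, ?_, ?_⟩
  · have hs : Function.Surjective ((chi lam).comp (baseS lam S)) := by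
      intro u
      rcases Int.units_eq_one_or u with rfl | rfl
      · exact ⟨1, map_one _⟩
      · have h1 : ng lam i ∈ (baseS lam S).range := by
          rw [range_baseS]
          exact ng_mem_Gsub i hS
        obtain ⟨m, hm⟩ := h1
        exact ⟨m, by rw [MonoidHom.comp_apply, hm, chi_ng, hi.neg_one_pow]⟩
    rw [Subgroup.index_ker, MonoidHom.range_eq_top.2 hs, Nat.card_congr Subgroup.topEquiv.toEquiv,
      Nat.card_eq_fintype_card, Fintype.card_units_int]
  · have h1 : (((chi lam).comp (baseS lam S)).ker).map (bO.comp (baseS lam S)) = H := by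
      rw [hH]
      apply le_antisymm
      · rintro _ ⟨m, hm, rfl⟩
        refine Subgroup.mem_map_of_mem _ ⟨?_, hm⟩
        rw [← range_baseS]
        exact ⟨m, rfl⟩
      · rintro _ ⟨t, ⟨ht, ht'⟩, rfl⟩
        rw [← range_baseS] at ht
        obtain ⟨m, rfl⟩ := ht
        exact ⟨m, ht', rfl⟩
    rw [← h1]
    exact ⟨(Subgroup.equivMapOfInjective _ (bO.comp (baseS lam S))
      (bO_injective.comp (baseS_injective lam S))).symm⟩

/-- The blocks of size `1` and `2`. -/
def emb12 : Fin (mult lam 1) ⊕ Fin (mult lam 2) ↪ Fin (len lam) where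
  toFun := Sum.elim (fun c => (blkIdx lam 1 c).1) fun c => (blkIdx lam 2 c).1
  inj' := by
    rintro (c | c) (c' | c') h
    · have := blkIdx_inj lam h
      cases this
      rfl
    · have := congrArg Sigma.fst (blkIdx_inj lam h)
      simp at this
    · have := congrArg Sigma.fst (blkIdx_inj lam h)
      simp at this
    · have := blkIdx_inj lam h
      cases this
      rfl

theorem part_emb12_inl (c : Fin (mult lam 1)) : part lam (emb12 lam (.inl c)) = 1 :=
  part_blkIdx lam _ _

theorem part_emb12_inr (c : Fin (mult lam 2)) : part lam (emb12 lam (.inr c)) = 2 :=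
  part_blkIdx lam _ _

theorem mem_range_emb12 {i : Fin (len lam)} :
    i ∈ Set.range (emb12 lam) ↔ part lam i = 1 ∨ part lam i = 2 := by
  constructor
  · rintro ⟨c | c, rfl⟩
    · exact .inl (part_emb12_inl lam c)
    · exact .inr (part_emb12_inr lam c)
  · rintro (h | h)
    · obtain ⟨c, hc⟩ := exists_blkIdx_eq lam h
      exact ⟨.inl c, hc⟩
    · obtain ⟨c, hc⟩ := exists_blkIdx_eq lam h
      exact ⟨.inr c, hc⟩

/-- The signed permutations of the blocks of size `1` and `2`. -/
def base12 : SP (Fin (mult lam 1)) × SP (Fin (mult lam 2)) →* Gam lam :=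
  ((SP.emb (emb12 lam)).comp SP.sum).codRestrict (Gam lam) (by
    intro m i
    by_cases hi : i ∈ Set.range (emb12 lam)
    · obtain ⟨c | c, rfl⟩ := hi
      · simp only [MonoidHom.comp_apply, SP.emb_perm, SP.sum_perm_inl, part_emb12_inl]
      · simp only [MonoidHom.comp_apply, SP.emb_perm, SP.sum_perm_inr, part_emb12_inr]
    · rw [MonoidHom.comp_apply, (SP.emb_of_notMem _ _ hi).1])

theorem coe_base12 (m : SP (Fin (mult lam 1)) × SP (Fin (mult lam 2))) :
    (base12 lam m).1 = SP.emb (emb12 lam) (SP.sum m) := rfl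

theorem base12_injective : Function.Injective (base12 lam) := fun _ _ h =>
  SP.sum_injective (SP.emb_injective _ (congrArg Subtype.val h))

theorem base12_mem (m : SP (Fin (mult lam 1)) × SP (Fin (mult lam 2))) :
    base12 lam m ∈ Gsub lam fun k => k = 1 ∨ k = 2 := fun _ hi =>
  SP.emb_of_notMem _ _ (by rwa [mem_range_emb12])

theorem exists_base12_eq {t : Gam lam} (ht : t ∈ Gsub lam fun k => k = 1 ∨ k = 2) :
    ∃ m, base12 lam m = t := by
  obtain ⟨s, hs⟩ := SP.exists_emb_eq (emb12 lam) (s := t.1) fun i hi =>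
    ht i (by rwa [mem_range_emb12] at hi)
  obtain ⟨m, rfl⟩ := SP.exists_sum_eq (s := s) fun x => by
    have h1 := part_perm t (emb12 lam x)
    rw [← hs, SP.emb_perm] at h1
    rcases x with c | c
    · rcases h2 : s.perm (.inl c) with d | d
      · rfl
      · rw [h2, part_emb12_inl, part_emb12_inr] at h1
        simp at h1
    · rcases h2 : s.perm (.inr c) with d | d
      · rw [h2, part_emb12_inl, part_emb12_inr] at h1
        simp at h1
      · rfl
  exact ⟨m, Subtype.ext hs⟩

theorem isRefl_base12 {m : SP (Fin (mult lam 1)) × SP (Fin (mult lam 2))} :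
    (base12 lam m).1.IsRefl ↔ (m.1.IsRefl ∧ m.2 = 1) ∨ (m.1 = 1 ∧ m.2.IsRefl) := by
  rw [coe_base12, SP.isRefl_emb, SP.isRefl_sum]

theorem chi_base12 (m : SP (Fin (mult lam 1)) × SP (Fin (mult lam 2))) :
    chi lam (base12 lam m) = detSgn m.1 := by
  rw [chi_eq, ← Fintype.prod_of_injective (emb12 lam) (emb12 lam).injective
    (fun x => (SP.sum m).sgn x ^ part lam (emb12 lam x)), Fintype.prod_sum_type]
  · simp only [SP.sum_sgn_inl, SP.sum_sgn_inr, part_emb12_inl, part_emb12_inr, pow_one,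
      Int.units_sq, Finset.prod_const_one, mul_one]
    rfl
  · intro i hi
    rw [coe_base12, (SP.emb_of_notMem _ _ hi).2, one_pow]
  · intro x
    rw [coe_base12, SP.emb_sgn]

theorem base12_perm_inl (m : SP (Fin (mult lam 1)) × SP (Fin (mult lam 2))) (c) :
    (base12 lam m).1.perm (blkIdx lam 1 c).1 = (blkIdx lam 1 (m.1.perm c)).1 :=
  SP.emb_perm (emb12 lam) _ (.inl c)

theorem base12_perm_inr (m : SP (Fin (mult lam 1)) × SP (Fin (mult lam 2))) (c) :
    (base12 lam m).1.perm (blkIdx lam 2 c).1 = (blkIdx lam 2 (m.2.perm c)).1 :=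
  SP.emb_perm (emb12 lam) _ (.inr c)

theorem base12_sgn_inl (m : SP (Fin (mult lam 1)) × SP (Fin (mult lam 2))) (c) :
    (base12 lam m).1.sgn (blkIdx lam 1 c).1 = m.1.sgn c :=
  SP.emb_sgn (emb12 lam) _ (.inl c)

theorem base12_sgn_inr (m : SP (Fin (mult lam 1)) × SP (Fin (mult lam 2))) (c) :
    (base12 lam m).1.sgn (blkIdx lam 2 c).1 = m.2.sgn c :=
  SP.emb_sgn (emb12 lam) _ (.inr c)

theorem blkIdx_val_inj {k : ℕ} {c c' : Fin (mult lam k)}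
    (h : (blkIdx lam k c).1 = (blkIdx lam k c').1) : c = c' :=
  (blkIdx lam k).injective (Subtype.ext h)

end Models

/-! ### Coxeter types on the span of the blocks -/

section Types
variable {n : ℕ} {lam : n.Partition}

theorem isRefl_sw {i j : Fin (len lam)} (h : part lam i = part lam j) (hij : i ≠ j) :
    (sw lam i j h).1.IsRefl := SP.isRefl_ofPerm.2 ⟨i, j, hij, rfl⟩

theorem isRefl_ng (i : Fin (len lam)) : (ng lam i).1.IsRefl :=
  .inr ⟨i, rfl, by simp [ng_sgn], fun k hk => ⟨rfl, by simp [ng_sgn, hk]⟩⟩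

theorem isRefl_gsw {i j : Fin (len lam)} (h : part lam i = part lam j) (hij : i ≠ j) (η : ℤˣ) :
    (gsw lam i j h η).1.IsRefl :=
  .inl ⟨i, j, hij, by simp [gsw_perm], by simp [gsw_perm], by simp [gsw_sgn], fun k hi hj =>
    ⟨by rw [gsw_perm, Equiv.swap_apply_of_ne_of_ne hi hj], by simp [gsw_sgn, hi, hj]⟩⟩

theorem exists_isRefl_x {i : ℕ} (h : part lam i = part lam (i + 1)) (h0 : 0 < part lam i) :
    ∃ t : Gam lam, t.1.IsRefl ∧ bO t = x lam i :=
  ⟨_, isRefl_sw _ (by simp [Fin.ext_iff]), (x_eq i (lt_len_of_pos (h ▸ h0)) h).symm⟩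

theorem exists_isRefl_y {i : ℕ} (h0 : 0 < part lam i) :
    ∃ t : Gam lam, t.1.IsRefl ∧ bO t = y lam i :=
  ⟨_, isRefl_ng _, (y_eq i (lt_len_of_pos h0)).symm⟩

theorem exists_isRefl_y' {i : ℕ} (h : part lam i = part lam (i + 1)) (h0 : 0 < part lam i) :
    ∃ t : Gam lam, t.1.IsRefl ∧ bO t = y' lam i := by
  have h1 := lt_len_of_pos (h ▸ h0)
  have hne : (⟨i, by omega⟩ : Fin (len lam)) ≠ ⟨i + 1, h1⟩ := by simp [Fin.ext_iff]
  exact ⟨_, isRefl_gsw h hne (-1), by rw [gsw_neg_one _ _ _ hne, y'_eq i h1 h]⟩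

/-- A criterion for a group of signed permutations of the blocks, generated by elements that are
reflections on the span `X` of the normalized sums of the blocks. -/
theorem hasTypeOn_X {M : Type} [Group M] {R : Set M} {G : Subgroup (O n)} {S : Set (O n)}
    (θ : M →* Gam lam) (hθ : Function.Injective θ) (hR : ∀ m, (θ m).1.IsRefl ↔ m ∈ R)
    (hG : G = θ.range.map bO) (hS : G = Subgroup.closure S)
    (hgen : ∀ g ∈ S, ∃ t : Gam lam, t.1.IsRefl ∧ bO t = g) : HasTypeOn G (X lam) R := by
  rw [X_eq]
  refine hasTypeOn_span orthonormal_bvec (bO.comp θ) ((Gam lam).subtype.comp θ)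
    (Subtype.val_injective.comp hθ) (fun m => acts_bO _) hR ?_ ?_
  · rw [hG, MonoidHom.range_comp]
  · conv_lhs => rw [hS]
    rw [Subgroup.closure_le]
    intro g hg
    obtain ⟨t, ht, rfl⟩ := hgen g hg
    exact Subgroup.subset_closure ⟨by rw [hS]; exact Subgroup.subset_closure hg,
      ((acts_bO t).actsAsRefl_iff orthonormal_bvec).2 ht⟩

theorem hasTypeOn_A0 :
    HasTypeOn (A0 lam) (X lam ⊓ Y lam) (reflProdB lam {k ∈ Finset.Icc 3 n | Even k}) := by
  have hX : HasTypeOn (A0 lam) (X lam) (reflProdB lam {k ∈ Finset.Icc 3 n | Even k}) := by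
    refine hasTypeOn_X (baseS lam _) (baseS_injective lam _) (fun m => isRefl_baseS lam) ?_ rfl ?_
    · rw [range_baseS, A0_eq]
      congr 1
      have h1 : Gsub lam (· ∈ ({k ∈ Finset.Icc 3 n | Even k} : Finset ℕ)) =
          Gsub lam fun k => 2 < k ∧ Even k := Gsub_congr fun i => by
        have := part_le lam i
        rw [Finset.mem_filter, Finset.mem_Icc]
        exact and_congr_left fun _ => by omega
      rw [h1]
      exact inf_eq_left.2 fun t ht => chi_eq_one_of_even (Gsub_mono (fun k hk => hk.2) ht)
    · rintro _ (⟨i, h, h0, -, rfl⟩ | ⟨i, h0, -, rfl⟩)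
      · exact exists_isRefl_x h (by omega)
      · exact exists_isRefl_y (by omega)
  refine (hasTypeOn_iff_of_le inf_le_left hX.1.1 ?_).2 hX
  intro g hg v hv
  rw [X_inf_Y_eq, X_inf_span_orthogonal, compl_compl] at hv
  rw [A0_eq] at hg
  obtain ⟨t, ht, rfl⟩ := hg
  refine bO_fixes_span_iff.2 (fun i hi => ht.1 i ?_) v hv
  rintro ⟨h, -⟩
  rcases hi with hi | ⟨hi, -⟩ <;> omega

theorem Yperp_le_X : (Y lam)ᗮ ≤ X lam := by
  rw [Yperp_eq, X_eq]
  exact Submodule.span_mono (Set.image_subset_range _ _)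

theorem Q_fixes {g : O n} (hg : g ∈ Q lam) {v : E n} (hv : v ∈ Y lam) : g v = v := hv g hg

theorem sup_Q_B_fixes {g : O n} (hg : g ∈ Q lam ⊔ B lam) {v : E n} (hv : v ∈ X lam ⊓ Y lam) :
    g v = v := by
  have h : Q lam ⊔ B lam ≤ pointwiseStab ⊤ (X lam ⊓ Y lam) :=
    sup_le (fun g hg => ⟨trivial, fun v hv => Q_fixes hg hv.2⟩) fun g hg => ⟨trivial, hg.2⟩
  exact (h hg).2 v hv

/-- The groups `Q`, `B` and `Q ⋊ B` fix `X ∩ Y`, so that their types can be read off on `X`. -/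
theorem hasTypeOn_Yperp {M : Type} [Group M] {R : Set M} {G : Subgroup (O n)}
    (hG : G ≤ Q lam ⊔ B lam) (h : HasTypeOn G (X lam) R) : HasTypeOn G (Y lam)ᗮ R :=
  (hasTypeOn_iff_of_le Yperp_le_X h.1.1 fun g hg v hv => sup_Q_B_fixes (hG hg)
    (by rwa [Submodule.orthogonal_orthogonal] at hv)).2 h

theorem hasTypeOn_top {M : Type} [Group M] {R : Set M} (h : HasTypeOn (Q lam) (X lam) R) :
    HasTypeOn (Q lam) ⊤ R :=
  (hasTypeOn_iff_of_le le_top (fun _ _ _ _ => trivial) fun g hg v hv => Q_fixes hg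
    (by rw [Submodule.orthogonal_orthogonal] at hv; exact hv.2)).1
      (hasTypeOn_Yperp le_sup_left h)

/-- A permutation of the blocks of size `2` with signs. -/
theorem base12_inr_mem (s : SP (Fin (mult lam 2))) : base12 lam (1, s) ∈ Gsub lam (· = 2) := by
  intro i hi
  by_cases h1 : part lam i = 1
  · obtain ⟨c, rfl⟩ := exists_blkIdx_eq lam h1
    rw [base12_perm_inl, base12_sgn_inl]
    exact ⟨rfl, rfl⟩
  · exact base12_mem lam _ i (by omega)

theorem exists_base12_inr_eq {t : Gam lam} (ht : t ∈ Gsub lam (· = 2)) :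
    ∃ s, base12 lam (1, s) = t := by
  obtain ⟨⟨s₁, s₂⟩, rfl⟩ := exists_base12_eq lam (Gsub_mono (fun k hk => Or.inr hk) ht)
  refine ⟨s₂, ?_⟩
  congr 2
  refine (SP.ext_iff'.2 fun c => ?_).symm
  have h := ht (blkIdx lam 1 c).1 (by rw [part_blkIdx]; decide)
  rw [base12_perm_inl, base12_sgn_inl] at h
  exact ⟨blkIdx_val_inj lam h.1, h.2⟩

theorem isRefl_base12_inr {s : SP (Fin (mult lam 2))} :
    (base12 lam (1, s)).1.IsRefl ↔ s.IsRefl := by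
  rw [isRefl_base12]
  constructor
  · rintro (⟨h, -⟩ | ⟨-, h⟩)
    · exact absurd rfl (SP.isRefl_ne_one h)
    · exact h
  · exact fun h => .inr ⟨rfl, h⟩

theorem base12_inr_injective :
    Function.Injective fun s : SP (Fin (mult lam 2)) => base12 lam (1, s) :=
  fun _ _ h => congrArg Prod.snd (base12_injective lam h)

theorem base12_inr_mem_Bsub {s : SP (Fin (mult lam 2))} (hs : ∀ c, s.sgn c = 1) :
    base12 lam (1, s) ∈ Bsub lam := by
  refine ⟨base12_inr_mem s, fun i => ?_⟩
  by_cases h : part lam i = 2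
  · obtain ⟨c, rfl⟩ := exists_blkIdx_eq lam h
    rw [base12_sgn_inr]
    exact hs c
  · exact (base12_inr_mem s i h).2

theorem exists_of_mem_Bsub {t : Gam lam} (ht : t ∈ Bsub lam) :
    ∃ σ : Equiv.Perm (Fin (mult lam 2)), base12 lam (1, SP.ofPerm σ) = t := by
  obtain ⟨s, rfl⟩ := exists_base12_inr_eq ht.1
  refine ⟨s.perm, ?_⟩
  congr 2
  refine SP.ext_iff'.2 fun c => ⟨rfl, ?_⟩
  rw [← base12_sgn_inr lam (1, s) c, ht.2]
  rfl

variable (lam) in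
/-- The realization of the symmetric group on the blocks of size `2`. -/
def permTwo : Equiv.Perm (Fin (mult lam 2)) →* Gam lam :=
  (base12 lam).comp ((MonoidHom.inr _ _).comp SP.ofPerm)

theorem permTwo_injective : Function.Injective (permTwo lam) :=
  base12_inr_injective.comp SP.ofPerm_injective

theorem range_permTwo : (permTwo lam).range = Bsub lam := by
  apply le_antisymm
  · rintro _ ⟨σ, rfl⟩
    exact base12_inr_mem_Bsub fun _ => rfl
  · exact fun t ht => exists_of_mem_Bsub ht

theorem B_eq_closure : B lam = Subgroup.closure
    {g | ∃ i, part lam i = part lam (i + 1) ∧ part lam i = 2 ∧ g = x lam i} :=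
  B_eq.trans map_Bsub_eq

theorem Q_eq_closure : Q lam = Subgroup.closure
    ({g | ∃ i, part lam i = part lam (i + 1) ∧ part lam i = 1 ∧ (g = x lam i ∨ g = y' lam i)} ∪
     {g | ∃ j, part lam j = 2 ∧ g = y lam j}) :=
  Q_eq.trans map_Qsub_eq

theorem hasTypeOn_B_Yperp : HasTypeOn (B lam) (Y lam)ᗮ (reflS (mult lam 2)) := by
  refine hasTypeOn_Yperp le_sup_right (hasTypeOn_X (permTwo lam) permTwo_injective
    (fun σ => isRefl_base12_inr.trans SP.isRefl_ofPerm) ?_ B_eq_closure ?_)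
  · rw [range_permTwo, B_eq]
  · rintro _ ⟨i, h, h0, rfl⟩
    exact exists_isRefl_x h (by omega)

theorem exists_isRefl_of_gen_Q {g : O n}
    (hg : g ∈ {g | ∃ i, part lam i = part lam (i + 1) ∧ part lam i = 1 ∧
        (g = x lam i ∨ g = y' lam i)} ∪ {g | ∃ j, part lam j = 2 ∧ g = y lam j}) :
    ∃ t : Gam lam, t.1.IsRefl ∧ bO t = g := by
  rcases hg with ⟨i, h, h0, rfl | rfl⟩ | ⟨i, h0, rfl⟩
  · exact exists_isRefl_x h (by omega)
  · exact exists_isRefl_y' h (by omega)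
  · exact exists_isRefl_y (by omega)

/-- The elements of `Qsub` in terms of `base12`. -/
theorem base12_mem_Qsub {m : SP (Fin (mult lam 1)) × SP (Fin (mult lam 2))} :
    base12 lam m ∈ Qsub lam ↔ detSgn m.1 = 1 ∧ m.2.perm = 1 := by
  rw [mem_Qsub, chi_base12]
  refine and_congr_right fun _ => ⟨fun h => Equiv.ext fun c => ?_, fun h i => ⟨fun hi => ?_,
    fun hi => (base12_mem lam m i (by omega)).2⟩⟩
  · have h1 := (h (blkIdx lam 2 c).1).1 (by rw [part_blkIdx]; decide)
    rw [base12_perm_inr] at h1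
    exact blkIdx_val_inj lam h1
  · by_cases h2 : part lam i = 2
    · obtain ⟨c, rfl⟩ := exists_blkIdx_eq lam h2
      rw [base12_perm_inr, h]
      rfl
    · exact (base12_mem lam m i (by omega)).1

theorem Qsub_le : Qsub lam ≤ Gsub lam fun k => k = 1 ∨ k = 2 := fun t ht i hi => by
  have := part_pos lam i
  exact ⟨(ht.2 i).1 (by omega), (ht.2 i).2 (by omega)⟩

theorem hasTypeOn_Q_of_le (hm : mult lam 1 ≤ 1) :
    HasTypeOn (Q lam) ⊤ (piRefl fun _ : Fin (mult lam 2) => reflS 2) := by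
  refine hasTypeOn_top (hasTypeOn_X
    ((base12 lam).comp ((MonoidHom.inr _ _).comp (SP.ofPermTwo (mult lam 2))))
    (base12_inr_injective.comp (SP.ofPermTwo_injective _))
    (fun p => isRefl_base12_inr.trans SP.isRefl_ofPermTwo) ?_ Q_eq_closure
    fun g hg => exists_isRefl_of_gen_Q hg)
  rw [Q_eq]
  congr 1
  apply le_antisymm
  · intro t ht
    have hG : t ∈ Gsub lam (· = 2) := fun i hi => by
      by_cases h1 : part lam i = 1
      · refine Qsub_trivial ht ?_
        rintro (h | ⟨-, h⟩)
        · exact hi h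
        · omega
      · exact Qsub_le ht i (by omega)
    obtain ⟨s, rfl⟩ := exists_base12_inr_eq hG
    obtain ⟨p, rfl⟩ := SP.exists_ofPermTwo_eq (base12_mem_Qsub.1 ht).2
    exact ⟨p, rfl⟩
  · rintro _ ⟨p, rfl⟩
    exact base12_mem_Qsub.2 ⟨map_one _, rfl⟩

/-- Reflections of a product of two groups that are realized on the blocks of size `1` and `2`. -/
theorem isRefl_base12_prodMap {M M' : Type} [Group M] [Group M'] {R : Set M} {R' : Set M'}
    {f : M →* SP (Fin (mult lam 1))} {f' : M' →* SP (Fin (mult lam 2))}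
    (hf : Function.Injective f) (hf' : Function.Injective f') (hR : ∀ m, (f m).IsRefl ↔ m ∈ R)
    (hR' : ∀ m, (f' m).IsRefl ↔ m ∈ R') (m : M × M') :
    ((base12 lam).comp (f.prodMap f') m).1.IsRefl ↔ m ∈ prodRefl R R' := by
  rw [MonoidHom.comp_apply, isRefl_base12]
  exact or_congr (and_congr (hR _) (map_eq_one_iff f' hf'))
    (and_congr (map_eq_one_iff f hf) (hR' _))

theorem hasTypeOn_Q : HasTypeOn (Q lam) ⊤
    (prodRefl (reflD (mult lam 1)) (piRefl fun _ : Fin (mult lam 2) => reflS 2)) := by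
  refine hasTypeOn_top (hasTypeOn_X
    ((base12 lam).comp ((wdSP (mult lam 1)).prodMap (SP.ofPermTwo (mult lam 2))))
    ((base12_injective lam).comp ((wdSP_injective _).prodMap (SP.ofPermTwo_injective _)))
    (isRefl_base12_prodMap (wdSP_injective _) (SP.ofPermTwo_injective _) (fun _ => isRefl_wdSP)
      fun _ => SP.isRefl_ofPermTwo) ?_ Q_eq_closure fun g hg => exists_isRefl_of_gen_Q hg)
  rw [Q_eq]
  congr 1
  apply le_antisymm
  · intro t ht
    obtain ⟨⟨s₁, s₂⟩, rfl⟩ := exists_base12_eq lam (Qsub_le ht)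
    obtain ⟨w, rfl⟩ := exists_wdSP_eq (base12_mem_Qsub.1 ht).1
    obtain ⟨p, rfl⟩ := SP.exists_ofPermTwo_eq (base12_mem_Qsub.1 ht).2
    exact ⟨(w, p), rfl⟩
  · rintro _ ⟨m, rfl⟩
    exact base12_mem_Qsub.2 ⟨detSgn_wdSP _, rfl⟩

theorem Q_sup_B_eq : Q lam ⊔ B lam = (KS lam fun k => k = 1 ∨ k = 2).map bO := by
  apply le_antisymm
  · rw [Q_eq, B_eq, ← Subgroup.map_sup]
    exact Subgroup.map_mono (sup_le (fun t ht => ⟨Qsub_le ht, ht.1⟩) fun t ht =>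
      ⟨Gsub_mono (fun k hk => .inr hk) ht.1, chi_eq_one_of_sgn ht.2⟩)
  · rw [Q_eq_closure, B_eq_closure]
    refine map_KS_le ?_ ?_ ?_ ?_
    · rintro i h - (h1 | h2)
      · exact Subgroup.mem_sup_left (Subgroup.subset_closure (.inl ⟨i, h, h1, .inl rfl⟩))
      · exact Subgroup.mem_sup_right (Subgroup.subset_closure ⟨i, h, h2, rfl⟩)
    · rintro i - (h1 | h2) he
      · rw [h1] at he
        exact absurd he (by decide)
      · exact Subgroup.mem_sup_left (Subgroup.subset_closure (.inr ⟨i, h2, rfl⟩))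
    · rintro i h (h1 | h2) ho
      · exact Subgroup.mem_sup_left (Subgroup.subset_closure (.inl ⟨i, h, h1, .inr rfl⟩))
      · rw [h2] at ho
        exact absurd ho (by decide)
    · rintro i j hij (hi | hi) hj hoi
      · omega
      · rw [hi] at hoi
        exact absurd hoi (by decide)

theorem hasTypeOn_Q_sup_B : HasTypeOn (Q lam ⊔ B lam) (Y lam)ᗮ
    (prodRefl (reflD (mult lam 1)) (reflB (mult lam 2))) := by
  refine hasTypeOn_Yperp le_rfl (hasTypeOn_X
    ((base12 lam).comp ((wdSP (mult lam 1)).prodMap (wbSP (mult lam 2))))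
    ((base12_injective lam).comp ((wdSP_injective _).prodMap (wbSP_injective _)))
    (isRefl_base12_prodMap (wdSP_injective _) (wbSP_injective _) (fun _ => isRefl_wdSP)
      fun _ => isRefl_wbSP) ?_ (by rw [Q_eq_closure, B_eq_closure, ← Subgroup.closure_union]) ?_)
  · rw [Q_sup_B_eq]
    congr 1
    apply le_antisymm
    · rintro t ⟨ht, ht'⟩
      obtain ⟨⟨s₁, s₂⟩, rfl⟩ := exists_base12_eq lam ht
      obtain ⟨w, rfl⟩ := exists_wdSP_eq ((chi_base12 lam _).symm.trans ht')
      obtain ⟨w', rfl⟩ := wbSP_surjective _ s₂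
      exact ⟨(w, w'), rfl⟩
    · rintro _ ⟨m, rfl⟩
      exact ⟨base12_mem lam _, (chi_base12 lam _).trans (detSgn_wdSP _)⟩
  · rintro g (hg | ⟨i, h, h0, rfl⟩)
    · exact exists_isRefl_of_gen_Q hg
    · exact exists_isRefl_x h (by omega)

end Types

/-! ### Coxeter types on the orthogonal complement of the fixed space -/

section Moved
variable {n : ℕ} (lam : n.Partition)

/-- The points of the blocks of size `2`. -/
def ptTwo (c : Fin (mult lam 2)) (q : Fin 2) : Fin n :=
  pt lam (blkIdx lam 2 c).1 q (by rw [part_blkIdx]; exact q.2)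

@[simp] theorem bl_ptTwo (c : Fin (mult lam 2)) (q : Fin 2) :
    bl lam (ptTwo lam c q) = (blkIdx lam 2 c).1 := bl_pt _ _ _

@[simp] theorem ps_ptTwo (c : Fin (mult lam 2)) (q : Fin 2) : ps lam (ptTwo lam c q) = q :=
  ps_pt _ _ _

theorem part_bl_ptTwo (c : Fin (mult lam 2)) (q : Fin 2) :
    part lam (bl lam (ptTwo lam c q)) = 2 := by
  rw [bl_ptTwo, part_blkIdx]

theorem ptTwo_inj {c c' : Fin (mult lam 2)} {q q' : Fin 2} :
    ptTwo lam c q = ptTwo lam c' q' ↔ c = c' ∧ q = q' := by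
  constructor
  · intro h
    have h1 := congrArg (bl lam) h
    have h2 := congrArg (ps lam) h
    rw [bl_ptTwo, bl_ptTwo] at h1
    rw [ps_ptTwo, ps_ptTwo] at h2
    exact ⟨blkIdx_val_inj lam h1, Fin.ext h2⟩
  · rintro ⟨rfl, rfl⟩
    rfl

theorem exists_ptTwo_eq {v : Fin n} (h : part lam (bl lam v) = 2) :
    ∃ c q, ptTwo lam c q = v := by
  obtain ⟨c, hc⟩ := exists_blkIdx_eq lam h
  have h1 := ps_lt lam v
  exact ⟨c, ⟨ps lam v, by omega⟩, block_ext (by rw [bl_ptTwo, hc]) (ps_ptTwo lam _ _)⟩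

/-- The index set of the points in blocks of size greater than `2`. -/
abbrev BigIdx : Type :=
  Σ x : (Σ k : Finset.Icc 3 n, Fin (mult lam k)), Fin x.1

/-- The points in blocks of size greater than `2`. -/
def ptBig : BigIdx lam ↪ Fin n where
  toFun x := pt lam (embS lam _ x.1) x.2 ((part_embS lam _ x.1).symm ▸ x.2.2)
  inj' := by
    rintro ⟨x, q⟩ ⟨x', q'⟩ h
    have h1 := congrArg (bl lam) h
    have h2 := congrArg (ps lam) h
    rw [bl_pt, bl_pt] at h1
    rw [ps_pt, ps_pt] at h2
    obtain rfl : x = x' := (embS lam _).injective h1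
    exact congrArg (Sigma.mk x) (Fin.ext h2)

@[simp] theorem bl_ptBig (x : BigIdx lam) : bl lam (ptBig lam x) = embS lam _ x.1 :=
  bl_pt _ _ ((part_embS lam _ x.1).symm ▸ x.2.2)

theorem ps_ptBig (x : BigIdx lam) : ps lam (ptBig lam x) = x.2 :=
  ps_pt _ _ ((part_embS lam _ x.1).symm ▸ x.2.2)

theorem part_bl_ptBig (x : BigIdx lam) : 2 < part lam (bl lam (ptBig lam x)) := by
  rw [bl_ptBig, part_embS]
  exact (Finset.mem_Icc.1 x.1.1.2).1

theorem mem_range_ptBig {v : Fin n} (h : 2 < part lam (bl lam v)) :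
    v ∈ Set.range (ptBig lam) := by
  obtain ⟨x, hx⟩ := (mem_range_embS lam (S := Finset.Icc 3 n)).2
    (Finset.mem_Icc.2 ⟨h, part_le lam (bl lam v)⟩)
  have h1 := ps_lt lam v
  rw [← hx, part_embS] at h1
  exact ⟨⟨x, ⟨ps lam v, h1⟩⟩, block_ext (by rw [bl_ptBig, hx]) (ps_ptBig lam _)⟩

/-- The difference of the two basis vectors of a block of size `2`, normalized. -/
def dvec (c : Fin (mult lam 2)) : E n := (√2)⁻¹ • (e (ptTwo lam c 0) - e (ptTwo lam c 1))

/-- An orthonormal family whose span contains `Xᗮ`: the normalized differences for the blocks of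
size `2`, and the basis vectors for the blocks of size greater than `2`. -/
def mvec : Fin (mult lam 2) ⊕ BigIdx lam → E n := Sum.elim (dvec lam) fun x => e (ptBig lam x)

theorem ptTwo_ne_ptBig (c : Fin (mult lam 2)) (q : Fin 2) (x : BigIdx lam) :
    ptTwo lam c q ≠ ptBig lam x := fun h => by
  have h1 := part_bl_ptBig lam x
  rw [← h, part_bl_ptTwo] at h1
  exact absurd h1 (lt_irrefl _)

theorem orthonormal_mvec : Orthonormal ℝ (mvec lam) := by
  classical
  have h2 : (√2)⁻¹ * ((√2)⁻¹ * 2) = (1 : ℝ) := by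
    have : √2 * √2 = (2 : ℝ) := Real.mul_self_sqrt (by norm_num)
    field_simp
    linarith
  rw [orthonormal_iff_ite]
  rintro (c | x) (c' | x')
  · simp only [mvec, Sum.elim_inl, dvec, inner_smul_left, inner_smul_right, inner_sub_left,
      inner_sub_right, inner_e, ptTwo_inj, conj_trivial]
    by_cases h : c = c'
    · subst h
      norm_num
      linarith
    · simp [h]
  · simp [mvec, dvec, inner_smul_left, inner_sub_left, inner_e, ptTwo_ne_ptBig]
  · simp [mvec, dvec, inner_smul_right, inner_sub_right, inner_e, (ptTwo_ne_ptBig lam _ _ _).symm]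
  · simp [mvec, inner_e, Sum.inr_injective.eq_iff]

/-- A product of symmetric groups, as permutations of the points in blocks of size greater
than `2`. -/
def permBig : prodA lam →* SP (BigIdx lam) :=
  SP.sigma.comp (MonoidHom.pi fun x : (Σ k : Finset.Icc 3 n, Fin (mult lam k)) =>
    SP.ofPerm.comp ((Pi.evalMonoidHom (fun _ : Fin (mult lam x.1) => Equiv.Perm (Fin x.1)) x.2).comp
      (Pi.evalMonoidHom (fun k : Finset.Icc 3 n => Fin (mult lam k) → Equiv.Perm (Fin k)) x.1)))

theorem permBig_apply (p : prodA lam) :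
    permBig lam p = SP.sigma fun x : (Σ k : Finset.Icc 3 n, Fin (mult lam k)) =>
      SP.ofPerm (p x.1 x.2) := rfl

theorem permBig_injective : Function.Injective (permBig lam) := fun _ _ h =>
  funext fun k => funext fun c => SP.ofPerm_injective (congrFun (SP.sigma_injective h) ⟨k, c⟩)

theorem isRefl_permBig {p : prodA lam} : (permBig lam p).IsRefl ↔ p ∈ reflProdA lam := by
  rw [permBig_apply, SP.isRefl_sigma]
  simp only [SP.isRefl_ofPerm, map_eq_one_iff SP.ofPerm SP.ofPerm_injective]
  constructor
  · rintro ⟨⟨k, c⟩, h, h'⟩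
    exact ⟨k, ⟨c, h, fun c' hc => h' ⟨k, c'⟩ (by simpa using hc)⟩, fun k' hk => funext fun c' =>
      h' ⟨k', c'⟩ fun h => hk (congrArg Sigma.fst h)⟩
  · rintro ⟨k, ⟨c, h, h1⟩, h2⟩
    refine ⟨⟨k, c⟩, h, ?_⟩
    rintro ⟨k', c'⟩ h'
    by_cases hk : k' = k
    · subst hk
      exact h1 c' (by rintro rfl; exact h' rfl)
    · exact congrFun (h2 k' hk) c'

theorem exists_permBig_eq {s : SP (BigIdx lam)} (h : ∀ x, (s.perm x).1 = x.1 ∧ s.sgn x = 1) :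
    ∃ p, permBig lam p = s := by
  obtain ⟨m, rfl⟩ := SP.exists_sigma_eq fun x => (h x).1
  refine ⟨fun k c => (m ⟨k, c⟩).perm, ?_⟩
  rw [permBig_apply]
  congr 1
  funext x
  exact SP.ext_iff'.2 fun a => ⟨rfl, ((h ⟨x, a⟩).2).symm⟩

/-- The signed permutations of the blocks of size `2`, as permutations of their points. -/
def actTwo : SP (Fin (mult lam 2)) →* SP (Fin n) :=
  SP.ofPerm.comp (SP.permHom.comp (blk.comp ((base12 lam).comp (MonoidHom.inr _ _))))

theorem actTwo_apply (s : SP (Fin (mult lam 2))) :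
    actTwo lam s = SP.ofPerm (blk (base12 lam (1, s))).perm := rfl

theorem actTwo_eq_blk {s : SP (Fin (mult lam 2))} (hs : ∀ c, s.sgn c = 1) :
    actTwo lam s = blk (base12 lam (1, s)) :=
  SP.ext_iff'.2 fun _ => ⟨rfl, ((base12_inr_mem_Bsub hs).2 _).symm⟩

theorem actTwo_of_ne {s : SP (Fin (mult lam 2))} {v : Fin n} (hv : part lam (bl lam v) ≠ 2) :
    (actTwo lam s).perm v = v ∧ (actTwo lam s).sgn v = 1 := by
  have h := base12_inr_mem s (bl lam v) hv
  refine ⟨block_ext (lam := lam) ?_ ?_, rfl⟩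
  · rw [actTwo_apply, SP.ofPerm_perm, bl_blk, h.1]
  · rw [actTwo_apply, SP.ofPerm_perm, ps_blk, h.2, flp_one]

theorem actTwo_ptTwo (s : SP (Fin (mult lam 2))) (c : Fin (mult lam 2)) (q : Fin 2) :
    (actTwo lam s).perm (ptTwo lam c q) =
      ptTwo lam (s.perm c) (if s.sgn c = 1 then q else Fin.rev q) := by
  refine block_ext (lam := lam) ?_ ?_
  · rw [actTwo_apply, SP.ofPerm_perm, bl_blk, bl_ptTwo, bl_ptTwo, base12_perm_inr]
  · rw [actTwo_apply, SP.ofPerm_perm, ps_blk, bl_ptTwo, base12_sgn_inr, part_blkIdx, ps_ptTwo,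
      ps_ptTwo, flp]
    split_ifs
    · rfl
    · rw [Fin.val_rev]
      omega

/-- Products of permutations of the blocks of size greater than `2`, as permutations of points. -/
def actBig : prodA lam →* SP (Fin n) := (SP.emb (ptBig lam)).comp (permBig lam)

theorem actBig_of_le {p : prodA lam} {v : Fin n} (hv : part lam (bl lam v) ≤ 2) :
    (actBig lam p).perm v = v ∧ (actBig lam p).sgn v = 1 := by
  refine SP.emb_of_notMem _ _ ?_
  rintro ⟨x, rfl⟩
  exact absurd (part_bl_ptBig lam x) (by omega)

theorem actBig_ptBig (p : prodA lam) (x : BigIdx lam) :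
    (actBig lam p).perm (ptBig lam x) = ptBig lam ((permBig lam p).perm x) :=
  SP.emb_perm _ _ _

theorem actBig_sgn (p : prodA lam) (v : Fin n) : (actBig lam p).sgn v = 1 := by
  by_cases h : v ∈ Set.range (ptBig lam)
  · obtain ⟨x, rfl⟩ := h
    exact SP.emb_sgn _ _ _
  · exact (SP.emb_of_notMem _ _ h).2

theorem commute_actTwo_actBig (s : SP (Fin (mult lam 2))) (p : prodA lam) :
    Commute (actTwo lam s) (actBig lam p) :=
  SP.commute_of_disjoint (fun v => part lam (bl lam v) ≠ 2) (fun _ h => actTwo_of_ne lam h)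
    fun _ h => actBig_of_le lam (not_not.1 h).le

theorem acts_actTwo (s : SP (Fin (mult lam 2))) :
    Acts (toO (actTwo lam s)) (mvec lam) (SP.sum (s, 1)) := by
  have h : ∀ v, toO (actTwo lam s) (e v) = e ((actTwo lam s).perm v) := fun v => by
    rw [acts_toO]
    simp [actTwo_apply]
  rintro (c | x)
  · rw [SP.sum_perm_inl, SP.sum_sgn_inl]
    simp only [mvec, Sum.elim_inl, dvec, map_smul, map_sub, h, actTwo_ptTwo]
    rcases Int.units_eq_one_or (s.sgn c) with h1 | h1
    · rw [h1, if_pos rfl, if_pos rfl]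
      simp
    · rw [h1, if_neg (by decide), if_neg (by decide)]
      change _ • (e (ptTwo lam _ 1) - e (ptTwo lam _ 0)) = _
      push_cast
      module
  · change toO (actTwo lam s) (e (ptBig lam x)) = (((1 : ℤˣ) : ℤ) : ℝ) • e (ptBig lam x)
    rw [h, (actTwo_of_ne lam (part_bl_ptBig lam x).ne').1]
    simp

theorem acts_actBig (p : prodA lam) :
    Acts (toO (actBig lam p)) (mvec lam) (SP.sum (1, permBig lam p)) := by
  have h : ∀ v, toO (actBig lam p) (e v) = e ((actBig lam p).perm v) := fun v => by
    rw [acts_toO, actBig_sgn]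
    simp
  rintro (c | x)
  · change toO (actBig lam p) (dvec lam c) = (((1 : ℤˣ) : ℤ) : ℝ) • dvec lam c
    have h1 : ∀ q, (actBig lam p).perm (ptTwo lam c q) = ptTwo lam c q := fun q =>
      (actBig_of_le lam (part_bl_ptTwo lam c q).le).1
    simp only [dvec, map_smul, map_sub, h, h1]
    simp
  · change toO (actBig lam p) (e (ptBig lam x)) =
      (((1 : ℤˣ) : ℤ) : ℝ) • e (ptBig lam ((permBig lam p).perm x))
    rw [h, actBig_ptBig]
    simp

theorem Acts.mul {κ : Type*} {b : κ → E n} {g h : O n} {s t : SP κ} (hg : Acts g b s)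
    (hh : Acts h b t) : Acts (g * h) b (s * t) := by
  intro i
  change g (h (b i)) = _
  rw [hh, map_smul, hg, smul_smul, SP.mul_perm, SP.mul_sgn, mul_comm]
  push_cast
  rfl

/-- The realization of `W(B_a) × ∏ (S_k)^{a_k}`, where `a` is the number of blocks of size `2`. -/
def actMoved : WB (mult lam 2) × prodA lam →* O n :=
  MonoidHom.noncommCoprod ((toO.comp (actTwo lam)).comp (wbSP _)) (toO.comp (actBig lam))
    fun _ _ => (commute_actTwo_actBig lam _ _).map toO

theorem actMoved_apply (m : WB (mult lam 2) × prodA lam) :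
    actMoved lam m = toO (actTwo lam (wbSP _ m.1)) * toO (actBig lam m.2) := rfl

theorem acts_actMoved (m : WB (mult lam 2) × prodA lam) : Acts (actMoved lam m) (mvec lam)
    (SP.sum.comp ((wbSP _).prodMap (permBig lam)) m) := by
  have h := (acts_actTwo lam (wbSP _ m.1)).mul (acts_actBig lam m.2)
  rw [← map_mul SP.sum, Prod.mk_mul_mk, mul_one, one_mul] at h
  exact h

theorem actTwo_mem (s : SP (Fin (mult lam 2))) : toO (actTwo lam s) ∈ young lam ⊔ B lam := by
  set t : Gam lam := base12 lam (1, SP.ofPerm s.perm)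
  have ht : t ∈ Bsub lam := base12_inr_mem_Bsub fun _ => rfl
  have hperm : t.1.perm = (base12 lam (1, s)).1.perm := rfl
  have h1 : toO (blk t⁻¹ * actTwo lam s) ∈ young lam := by
    refine toO_mem_young.2 fun v => ⟨?_, ?_⟩
    · rw [SP.mul_perm, Equiv.Perm.mul_apply, bl_blk, actTwo_apply, SP.ofPerm_perm, bl_blk, ← hperm]
      exact t.1.perm.symm_apply_apply _
    · rw [SP.mul_sgn, blk_sgn, (inv_mem ht).2]
      rfl
  have h2 : toO (actTwo lam s) = bO t * toO (blk t⁻¹ * actTwo lam s) := by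
    rw [bO_apply, ← map_mul, map_inv, mul_inv_cancel_left]
  rw [h2]
  refine mul_mem (Subgroup.mem_sup_right ?_) (Subgroup.mem_sup_left h1)
  rw [B_eq]
  exact Subgroup.mem_map_of_mem _ ht

theorem actBig_mem (p : prodA lam) : toO (actBig lam p) ∈ young lam := by
  refine toO_mem_young.2 fun v => ⟨?_, actBig_sgn lam p v⟩
  by_cases h : 2 < part lam (bl lam v)
  · obtain ⟨⟨x, q⟩, rfl⟩ := mem_range_ptBig lam h
    rw [actBig_ptBig, bl_ptBig, bl_ptBig, permBig_apply, SP.sigma_perm]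
  · rw [(actBig_of_le lam (not_lt.1 h)).1]

theorem exists_actTwo_eq {u v : Fin n} (huv : u ≠ v) (hb : bl lam u = bl lam v)
    (h : part lam (bl lam u) = 2) : ∃ s, actTwo lam s = SP.ofPerm (Equiv.swap u v) := by
  obtain ⟨s, hs⟩ := exists_base12_inr_eq (ng_mem_Gsub (p := (· = 2)) (bl lam u) h)
  refine ⟨s, ?_⟩
  rw [actTwo_apply, hs, blk_ng h huv hb]
  rfl

theorem exists_actBig_eq {u v : Fin n} (hb : bl lam u = bl lam v)
    (h : 2 < part lam (bl lam u)) : ∃ p, actBig lam p = SP.ofPerm (Equiv.swap u v) := by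
  have hbl : ∀ k, bl lam (Equiv.swap u v k) = bl lam k := by
    intro k
    rw [Equiv.swap_apply_def]
    split_ifs with h1 h2
    · rw [h1, hb]
    · rw [h2, hb]
    · rfl
  obtain ⟨s, hs⟩ := SP.exists_emb_eq (ptBig lam) (s := SP.ofPerm (Equiv.swap u v)) fun k hk =>
    ⟨Equiv.swap_apply_of_ne_of_ne (by rintro rfl; exact hk (mem_range_ptBig lam h))
      (by rintro rfl; exact hk (mem_range_ptBig lam (hb ▸ h))), rfl⟩
  obtain ⟨p, rfl⟩ := exists_permBig_eq lam (s := s) fun x => by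
    constructor
    · apply (embS lam _).injective
      rw [← bl_ptBig, ← bl_ptBig, ← SP.emb_perm, hs]
      exact hbl _
    · rw [← SP.emb_sgn (ptBig lam), hs]
      rfl
  exact ⟨p, hs⟩

theorem B_le_range_actMoved : B lam ≤ (actMoved lam).range := by
  rw [B_eq]
  rintro _ ⟨t, ht, rfl⟩
  obtain ⟨σ, rfl⟩ := exists_of_mem_Bsub ht
  obtain ⟨w, hw⟩ := wbSP_surjective _ (SP.ofPerm σ)
  refine ⟨(w, 1), ?_⟩
  rw [actMoved_apply, map_one, map_one, mul_one, hw, actTwo_eq_blk lam fun _ => rfl]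
  rfl

theorem range_actMoved : (actMoved lam).range = young lam ⊔ B lam := by
  apply le_antisymm
  · rintro _ ⟨m, rfl⟩
    exact mul_mem (actTwo_mem lam _) (Subgroup.mem_sup_left (actBig_mem lam _))
  · refine sup_le (young_le_of_swap fun u v huv hb => ?_) (B_le_range_actMoved lam)
    have h0 := part_pos lam (bl lam u)
    by_cases h1 : part lam (bl lam u) = 1
    · exact absurd (eq_of_bl_eq h1 hb) huv
    by_cases h2 : part lam (bl lam u) = 2
    · obtain ⟨s, hs⟩ := exists_actTwo_eq lam huv hb h2
      obtain ⟨w, rfl⟩ := wbSP_surjective _ s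
      exact ⟨(w, 1), by rw [actMoved_apply, map_one, map_one, mul_one, hs]⟩
    · obtain ⟨p, hp⟩ := exists_actBig_eq lam hb (by omega)
      exact ⟨(1, p), by rw [actMoved_apply, map_one, map_one, map_one, one_mul, hp]⟩

theorem sub_mem_span_mvec {u v : Fin n} (huv : u ≠ v) (hb : bl lam u = bl lam v) :
    e u - e v ∈ Submodule.span ℝ (Set.range (mvec lam)) := by
  have h0 := part_pos lam (bl lam u)
  by_cases h1 : part lam (bl lam u) = 1
  · exact absurd (eq_of_bl_eq h1 hb) huv
  by_cases h2 : part lam (bl lam u) = 2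
  · obtain ⟨c, q, rfl⟩ := exists_ptTwo_eq lam h2
    obtain ⟨c', q', rfl⟩ := exists_ptTwo_eq lam (hb ▸ h2)
    rw [bl_ptTwo, bl_ptTwo] at hb
    obtain rfl := blkIdx_val_inj lam hb
    have hd : √2 • dvec lam c = e (ptTwo lam c 0) - e (ptTwo lam c 1) := by
      rw [dvec, smul_smul, mul_inv_cancel₀ (by positivity), one_smul]
    have h3 : e (ptTwo lam c 0) - e (ptTwo lam c 1) ∈
        Submodule.span ℝ (Set.range (mvec lam)) := by
      rw [← hd]
      exact Submodule.smul_mem _ _ (Submodule.subset_span ⟨.inl c, rfl⟩)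
    fin_cases q <;> fin_cases q'
    · exact absurd rfl huv
    · exact h3
    · rw [← neg_sub]
      exact neg_mem h3
    · exact absurd rfl huv
  · obtain ⟨x, rfl⟩ := mem_range_ptBig lam (v := u) (by omega)
    obtain ⟨x', rfl⟩ := mem_range_ptBig lam (v := v) (by rw [← hb]; omega)
    exact sub_mem (Submodule.subset_span ⟨.inr x, rfl⟩) (Submodule.subset_span ⟨.inr x', rfl⟩)

theorem exists_perm_of_gen_B {i : ℕ} (h : part lam i = part lam (i + 1)) (h2 : part lam i = 2) :
    ∃ σ : Equiv.Perm (Fin (mult lam 2)), σ.IsSwap ∧ toO (actTwo lam (SP.ofPerm σ)) = x lam i := by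
  have hi := lt_len_of_pos (lam := lam) (i := i + 1) (by omega)
  have hx := x_eq i hi h
  have hB : sw lam ⟨i, by omega⟩ ⟨i + 1, hi⟩ h ∈ Bsub lam :=
    ⟨sw_mem_Gsub (p := (· = 2)) _ _ _ h2, fun _ => rfl⟩
  obtain ⟨σ, hσ⟩ := exists_of_mem_Bsub hB
  refine ⟨σ, ?_, ?_⟩
  · rw [← SP.isRefl_ofPerm, ← isRefl_base12_inr (lam := lam), hσ]
    exact isRefl_sw _ (by simp [Fin.ext_iff])
  · rw [actTwo_eq_blk lam fun _ => rfl, hσ, hx, bO_apply]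

/-- The generators of `B` act as reflections on the span of `mvec`. -/
theorem actsAsRefl_gen_B {i : ℕ} (h : part lam i = part lam (i + 1)) (h2 : part lam i = 2) :
    ActsAsRefl (x lam i) (Submodule.span ℝ (Set.range (mvec lam))) := by
  obtain ⟨σ, hσ, hx⟩ := exists_perm_of_gen_B lam h h2
  rw [← hx, (acts_actTwo lam _).actsAsRefl_iff (orthonormal_mvec lam), SP.isRefl_sum]
  exact .inl ⟨SP.isRefl_ofPerm.2 hσ, rfl⟩

theorem B_le_closure_refl {G : Subgroup (O n)} (hG : B lam ≤ G) : B lam ≤ Subgroup.closure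
    {s | s ∈ G ∧ ActsAsRefl s (Submodule.span ℝ (Set.range (mvec lam)))} := by
  conv_lhs => rw [B_eq_closure]
  rw [Subgroup.closure_le]
  rintro _ ⟨i, h, h2, rfl⟩
  refine Subgroup.subset_closure ⟨hG ?_, actsAsRefl_gen_B lam h h2⟩
  rw [B_eq_closure]
  exact Subgroup.subset_closure ⟨i, h, h2, rfl⟩

theorem hasTypeOn_young_sup_B_span : HasTypeOn (young lam ⊔ B lam)
    (Submodule.span ℝ (Set.range (mvec lam)))
    (prodRefl (reflB (mult lam 2)) (reflProdA lam)) := by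
  refine hasTypeOn_span (orthonormal_mvec lam) (actMoved lam) _
    (SP.sum_injective.comp ((wbSP_injective _).prodMap (permBig_injective lam)))
    (acts_actMoved lam) (fun m => ?_) (range_actMoved lam) ?_
  · rw [MonoidHom.comp_apply, SP.isRefl_sum]
    exact or_congr (and_congr isRefl_wbSP (map_eq_one_iff _ (permBig_injective lam)))
      (and_congr (map_eq_one_iff _ (wbSP_injective _)) (isRefl_permBig lam))
  · refine sup_le (young_le_of_swap fun u v huv hb => ?_) (B_le_closure_refl lam le_sup_right)
    have h1 := toO_sgnSwap huv 1
    rw [sgnSwap_one, Units.val_one, Int.cast_one, one_smul] at h1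
    have h2 := sub_smul_ne_zero huv 1
    rw [Units.val_one, Int.cast_one, one_smul] at h2
    refine Subgroup.subset_closure ⟨Subgroup.mem_sup_left ?_, _, sub_mem_span_mvec lam huv hb, h2,
      fun v _ => by rw [h1]⟩
    rw [← sgnSwap_one]
    exact toO_sgnSwap_mem_young.2 ⟨hb, rfl⟩

theorem hasTypeOn_B_span : HasTypeOn (B lam) (Submodule.span ℝ (Set.range (mvec lam)))
    (reflS (mult lam 2)) := by
  refine hasTypeOn_span (orthonormal_mvec lam) (bO.comp (permTwo lam))
    (SP.sum.comp ((MonoidHom.inl _ _).comp SP.ofPerm)) ?_ (fun σ => ?_) (fun σ => ?_) ?_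
    (B_le_closure_refl lam le_rfl)
  · exact fun σ τ h => SP.ofPerm_injective (congrArg Prod.fst (SP.sum_injective h))
  · have h := acts_actTwo lam (SP.ofPerm σ)
    rw [actTwo_eq_blk lam fun _ => rfl] at h
    exact h
  · rw [MonoidHom.comp_apply, SP.isRefl_sum]
    constructor
    · rintro (⟨h, -⟩ | ⟨-, h⟩)
      · exact SP.isRefl_ofPerm.1 h
      · exact absurd rfl (SP.isRefl_ne_one h)
    · exact fun h => .inl ⟨SP.isRefl_ofPerm.2 h, rfl⟩
  · rw [MonoidHom.range_comp, range_permTwo, B_eq]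

theorem mem_X_of_const {v : E n} (h : ∀ a b, bl lam a = bl lam b → v a = v b) : v ∈ X lam := by
  intro g hg
  obtain ⟨s, rfl, hs⟩ := exists_of_mem_young hg
  ext a
  obtain ⟨a, rfl⟩ := s.perm.surjective a
  rw [toO_apply_coord, (hs a).2, h _ _ (hs a).1]
  simp

theorem Xperp_le : (X lam)ᗮ ≤ Submodule.span ℝ (Set.range (mvec lam)) := by
  have h : (Submodule.span ℝ (Set.range (mvec lam)))ᗮ ≤ X lam := by
    intro v hv
    refine mem_X_of_const lam fun a b hb => ?_
    by_cases hab : a = b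
    · rw [hab]
    have h1 := hv _ (sub_mem_span_mvec lam hab hb)
    rw [inner_sub_left, e, e, EuclideanSpace.inner_single_left,
      EuclideanSpace.inner_single_left] at h1
    simp only [map_one, one_mul] at h1
    linarith
  have h1 := Submodule.orthogonal_le h
  rwa [Submodule.orthogonal_orthogonal] at h1

theorem span_mvec_le_Y : Submodule.span ℝ (Set.range (mvec lam)) ≤ Y lam := by
  have hin : ∀ (i : Fin (len lam)) (v : Fin n), ⟪bvec i, (e v : E n)⟫_ℝ = bvec i v := fun i v => by
    rw [e, EuclideanSpace.inner_single_right]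
    simp
  have h : (Submodule.span ℝ (bvec '' Jset lam)) ≤
      (Submodule.span ℝ (Set.range (mvec lam)))ᗮ := by
    rw [Submodule.span_le]
    rintro _ ⟨i, hi, rfl⟩
    rw [SetLike.mem_coe, Submodule.mem_orthogonal']
    intro u hu
    induction hu using Submodule.span_induction with
    | mem u hu =>
      obtain ⟨c | x, rfl⟩ := hu
      · change ⟪bvec i, dvec lam c⟫_ℝ = 0
        rw [dvec, inner_smul_right, inner_sub_right, hin, hin, bvec_apply, bvec_apply, bl_ptTwo,
          bl_ptTwo, sub_self, mul_zero]
      · change ⟪bvec i, e (ptBig lam x)⟫_ℝ = 0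
        rw [hin, bvec_apply, if_neg]
        intro hx
        have h1 := part_bl_ptBig lam x
        rw [hx] at h1
        rcases hi with hi | ⟨hi, -⟩ <;> omega
    | zero => simp
    | add u w _ _ hu hw => rw [inner_add_right, hu, hw, add_zero]
    | smul c u _ hu => rw [inner_smul_right, hu, mul_zero]
  have h1 := Submodule.orthogonal_le h
  rwa [Submodule.orthogonal_orthogonal, ← Y_eq] at h1

/-- Both `P` and `B` fix the intersection of `X` with the span of `mvec`, so that types can be
computed on this span. -/
theorem hasTypeOn_Xperp {M : Type} [Group M] {R : Set M} {G : Subgroup (O n)}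
    (hG : G ≤ young lam ⊔ B lam)
    (h : HasTypeOn G (Submodule.span ℝ (Set.range (mvec lam))) R) : HasTypeOn G (X lam)ᗮ R := by
  refine (hasTypeOn_iff_of_le (Xperp_le lam) h.1.1 fun g hg v hv => ?_).2 h
  rw [Submodule.orthogonal_orthogonal] at hv
  have h1 : young lam ⊔ B lam ≤ pointwiseStab ⊤ (X lam ⊓ Y lam) :=
    sup_le (fun g hg => ⟨trivial, fun v hv => hv.1 g hg⟩) fun g hg => ⟨trivial, hg.2⟩
  exact (h1 (hG hg)).2 v ⟨hv.2, span_mvec_le_Y lam hv.1⟩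

theorem hasTypeOn_B_Xperp : HasTypeOn (B lam) (X lam)ᗮ (reflS (mult lam 2)) :=
  hasTypeOn_Xperp lam le_sup_right (hasTypeOn_B_span lam)

theorem hasTypeOn_young_sup_B : HasTypeOn (young lam ⊔ B lam) (X lam)ᗮ
    (prodRefl (reflB (mult lam 2)) (reflProdA lam)) :=
  hasTypeOn_Xperp lam le_rfl (hasTypeOn_young_sup_B_span lam)

end Moved

/-! ### The structure of the normalizer -/

section Structure
variable {n : ℕ} {lam : n.Partition}

theorem KS_congr {p q : ℕ → Prop} (h : ∀ i : Fin (len lam), p (part lam i) ↔ q (part lam i)) :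
    KS lam p = KS lam q := by
  rw [KS, KS, Gsub_congr h]

theorem exists_odd_part (hlam : ¬ ∀ k ∈ lam.parts, Even k) :
    ∃ i : Fin (len lam), Odd (part lam i) := by
  by_contra hcon
  push Not at hcon
  refine hlam fun k hk => ?_
  rw [parts_eq, Multiset.mem_map] at hk
  obtain ⟨i, -, rfl⟩ := hk
  exact Nat.not_odd_iff_even.1 (hcon i)

theorem exists_howlett_mulEquiv (hlam : ¬ ∀ k ∈ lam.parts, Even k) {P : Subgroup (O n)}
    (hP : HasLabel P lam) {ρ : E n} (hρ : IsRegular P ρ) :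
    ∃ K : Subgroup (prodB lam (Finset.Icc 1 n)), K.index = 2 ∧
      Nonempty (howlett (normalizerIn (WD n) P) (posRoots P ρ) ≃* K) := by
  obtain ⟨-, w, hw, hPw⟩ := hP
  obtain ⟨i, hi⟩ := exists_odd_part hlam
  obtain ⟨f⟩ := nonempty_howlett_equiv young_le (isRegular_stdRho (young lam)) hρ hw hPw
  obtain ⟨K, hK, ⟨g⟩⟩ := exists_index_two lam hi (part_mem_Icc lam i)
    (howlett_young_eq.trans (congrArg _ (KS_congr fun i =>
      iff_of_true trivial (part_mem_Icc lam i))))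
  exact ⟨K, hK, ⟨f.trans g⟩⟩

theorem Q_eq_closure_of_le (hm : mult lam 1 ≤ 1) :
    Q lam = Subgroup.closure {g | ∃ j, part lam j = 2 ∧ g = y lam j} := by
  rw [Q_eq_closure]
  apply le_antisymm
  · rw [Subgroup.closure_le]
    rintro g (⟨i, h, h1, -⟩ | hg)
    · have h2 : part lam (i + 1) = 1 := by rw [← h, h1]
      have := eq_of_part_one hm (i := ⟨i, lt_len_of_pos (by omega)⟩)
        (j := ⟨i + 1, lt_len_of_pos (by omega)⟩) h1 h2
      simp [Fin.ext_iff] at this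
    · exact Subgroup.subset_closure hg
  · exact Subgroup.closure_mono Set.subset_union_right

theorem isDirect_A0_A1 {m : ℕ} (hm : m ≤ 2) (h1 : 0 < m ∨ mult lam 1 ≤ 1) {r : ℕ → Prop}
    (hA : A lam = (KS lam r).map bO)
    (hr : ∀ i : Fin (len lam), r (part lam i) ↔
      (2 < part lam i ∧ Even (part lam i)) ∨ (m < part lam i ∧ Odd (part lam i))) :
    IsDirect (A0 lam) (A1 lam m) (A lam) := by
  rw [A0_eq, A1_eq hm h1, hA]
  exact isDirect_KS hr (fun k hk hk' => Nat.not_even_iff_odd.2 hk'.2 hk.2) fun k hk => hk.2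

theorem ne_two_iff (k : ℕ) (h : 0 < k) : k ≠ 2 ↔ (2 < k ∧ Even k) ∨ (0 < k ∧ Odd k) := by
  rw [Nat.even_iff, Nat.odd_iff]
  omega

theorem two_lt_iff (k : ℕ) : 2 < k ↔ (2 < k ∧ Even k) ∨ (2 < k ∧ Odd k) := by
  rw [← and_or_left]
  exact (and_iff_left (Nat.even_or_odd k)).symm

theorem exists_A1_mulEquiv {m : ℕ} (hm : m ≤ 2) (h1 : 0 < m ∨ mult lam 1 ≤ 1) {i : Fin (len lam)}
    (hi : Odd (part lam i)) (hmi : m < part lam i) :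
    ∃ K : Subgroup (prodB lam {k ∈ Finset.Icc (m + 1) n | Odd k}), K.index = 2 ∧
      Nonempty (A1 lam m ≃* K) := by
  have hS : ∀ i : Fin (len lam), m < part lam i ∧ Odd (part lam i) ↔
      part lam i ∈ ({k ∈ Finset.Icc (m + 1) n | Odd k} : Finset ℕ) := fun i => by
    have := part_le lam i
    rw [Finset.mem_filter, Finset.mem_Icc]
    exact and_congr_left fun _ => by omega
  exact exists_index_two lam hi ((hS i).1 ⟨hmi, hi⟩)
    ((A1_eq hm h1).trans (congrArg _ (KS_congr hS)))

end Structure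

end ParabolicD

end

open ParabolicD in
theorem mainTheorem9 (n : ℕ) (lam : n.Partition) (hlam : ¬ ∀ k ∈ lam.parts, Even k) :
    -- the Howlett complement of any parabolic subgroup `P` with label `lam`
    (∀ P : Subgroup (O n), HasLabel P lam → ∀ ρ : E n, IsRegular P ρ →
      ∃ K : Subgroup (prodB lam (Finset.Icc 1 n)), K.index = 2 ∧
        Nonempty (howlett (normalizerIn (WD n) P) (posRoots P ρ) ≃* K)) ∧
    -- from here on, `P = young lam` is the standard choice
    HasLabel (young lam) lam ∧
    IsRegular (young lam ⊔ Q lam) (stdRho n) ∧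
    howlett (N lam) (posRoots (young lam) (stdRho n)) = Subgroup.closure
      ({g | ∃ i, part lam i = part lam (i + 1) ∧ 0 < part lam i ∧ g = x lam i} ∪
       {g | ∃ j, 0 < part lam j ∧ Even (part lam j) ∧ g = y lam j} ∪
       {g | ∃ i, part lam i = part lam (i + 1) ∧ Odd (part lam i) ∧ g = y' lam i} ∪
       {g | ∃ i j, i < j ∧ part lam i ≠ part lam j ∧ Odd (part lam i) ∧ Odd (part lam j) ∧
          g = z' lam i j}) ∧
    -- `N = (P × Q) ⋊ D`, and `A × B` is normal in `D`
    IsDirect (young lam) (Q lam) (young lam ⊔ Q lam) ∧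
    IsSemidirect (young lam ⊔ Q lam) (D lam) (N lam) ∧
    IsDirect (A lam) (B lam) (A lam ⊔ B lam) ∧
    -- the groups `Q`, `A`, `B`, `C`, where `C` is a complement of `A × B` in `D`
    (mult lam 1 ≤ 1 →
      Q lam = Subgroup.closure {g | ∃ j, part lam j = 2 ∧ g = y lam j} ∧
      HasTypeOn (Q lam) ⊤ (piRefl fun _ : Fin (mult lam 2) => reflS 2) ∧
      IsDirect (A0 lam) (A1 lam 0) (A lam) ∧
      (∃ K : Subgroup (prodB lam {k ∈ Finset.Icc 1 n | Odd k}), K.index = 2 ∧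
        Nonempty (A1 lam 0 ≃* K)) ∧
      IsSemidirect (A lam ⊔ B lam) ⊥ (D lam)) ∧
    (1 < mult lam 1 →
      Q lam = Subgroup.closure
        ({g | ∃ i, part lam i = part lam (i + 1) ∧ part lam i = 1 ∧ (g = x lam i ∨ g = y' lam i)} ∪
         {g | ∃ j, part lam j = 2 ∧ g = y lam j}) ∧
      HasTypeOn (Q lam) ⊤
        (prodRefl (reflD (mult lam 1)) (piRefl fun _ : Fin (mult lam 2) => reflS 2)) ∧
      (∀ r, Odd (part lam r) → 1 < part lam r →
        IsDirect (A0 lam) (A1 lam 2) (A lam) ∧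
        (∃ K : Subgroup (prodB lam {k ∈ Finset.Icc 3 n | Odd k}), K.index = 2 ∧
          Nonempty (A1 lam 2 ≃* K)) ∧
        IsSemidirect (A lam ⊔ B lam) (Subgroup.zpowers (z' lam r (len lam - 1))) (D lam) ∧
        Nat.card (Subgroup.zpowers (z' lam r (len lam - 1))) = 2) ∧
      ((∀ r, Odd (part lam r) → part lam r = 1) →
        A lam = A0 lam ∧ IsSemidirect (A lam ⊔ B lam) ⊥ (D lam))) ∧
    B lam = Subgroup.closure
      {g | ∃ i, part lam i = part lam (i + 1) ∧ part lam i = 2 ∧ g = x lam i} ∧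
    -- the actions on `X ∩ Y`, on `Yᗮ` and on `Xᗮ`
    HasTypeOn (A0 lam) (X lam ⊓ Y lam) (reflProdB lam {k ∈ Finset.Icc 3 n | Even k}) ∧
    HasTypeOn (B lam) (Y lam)ᗮ (reflS (mult lam 2)) ∧
    HasTypeOn (B lam) (X lam)ᗮ (reflS (mult lam 2)) ∧
    IsSemidirect (Q lam) (B lam) (Q lam ⊔ B lam) ∧
    HasTypeOn (Q lam ⊔ B lam) (Y lam)ᗮ
      (prodRefl (reflD (mult lam 1)) (reflB (mult lam 2))) ∧
    IsSemidirect (young lam) (B lam) (young lam ⊔ B lam) ∧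
    HasTypeOn (young lam ⊔ B lam) (X lam)ᗮ
      (prodRefl (reflB (mult lam 2)) (reflProdA lam)) := by
  obtain ⟨i₀, hi₀⟩ := exists_odd_part hlam
  refine ⟨fun P hP ρ hρ => exists_howlett_mulEquiv hlam hP hρ, hasLabel_young,
    isRegular_stdRho _, howlett_young_eq.trans closure_howlett_eq, isDirect_young_Q,
    isSemidirect_D, isDirect_A_B, fun hm => ⟨Q_eq_closure_of_le hm, hasTypeOn_Q_of_le hm,
      isDirect_A0_A1 (by omega) (.inr hm) (A_eq_of_le hm) fun i => ne_two_iff _ (part_pos lam i),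
      exists_A1_mulEquiv (by omega) (.inr hm) hi₀ (part_pos lam i₀), ?_⟩,
    fun hm => ⟨Q_eq_closure, hasTypeOn_Q, fun r hr hr1 => ?_, fun h => ⟨A_eq_A0 hm h, ?_⟩⟩,
    B_eq_closure, hasTypeOn_A0, hasTypeOn_B_Yperp, hasTypeOn_B_Xperp lam, isSemidirect_Q_B,
    hasTypeOn_Q_sup_B, isSemidirect_young_B, hasTypeOn_young_sup_B lam⟩
  · rw [A_sup_B_of_le hm]
    exact isSemidirect_bot
  · -- an odd part greater than `1` is greater than `2`
    have hr2 : 2 < part lam r := by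
      obtain ⟨k, hk⟩ := hr
      omega
    exact ⟨isDirect_A0_A1 le_rfl (.inl two_pos) (A_eq_of_lt hm) fun i => two_lt_iff _,
      exists_A1_mulEquiv (i := ⟨r, lt_len_of_pos (by omega)⟩) le_rfl (.inl two_pos) hr hr2,
      isSemidirect_zpowers hm hr hr1⟩
  · rw [A_sup_B_of_lt hm h]
    exact isSemidirect_bot
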